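/- Let $t\ge 0$ and $r\ge t+1$ be fixed integers, and let $t'$ be the largest integer with $t'(t'-1)/2\le t$. For a graph $G$ and an integer $k\ge 0$, call a set $\mathcal K$ of $k$ distinct subgraphs of $G$, each of which is a clique with at least $t+1$ and at most $r$ vertices, a $t$-edge-overlap packing if any two distinct members of $\mathcal K$ share at most $t$ edges, and a $t'$-vertex-overlap packing if any two distinct members share at most $t'$ vertices. The $K_r$-Packing with $t$-Edge-Overlap problem asks, for a finite graph $G$ and a non-negative integer $k$ (the parameter), whether $G$ has a $t$-edge-overlap packing of $k$ such cliques. Then: (1) $\mathcal K$ is a $t$-edge-overlap packing of $G$ if and only if $\mathcal K$ is a $t'$-vertex-overlap packing of $G$. (2) The $K_r$-Packing with $t$-Edge-Overlap problem has a kernel with $O(r^r k^{r-t'-1})$ vertices. That is, there is an absolute constant $C>0$ such that for all fixed $r,t$ as above some algorithm transforms every instance $(G,k)$, in time polynomial in the size of the instance, into an instance $(G',k')$ of the same problem such that $(G,k)$ is a yes-instance if and only if $(G',k')$ is one, $k'\le k$, and $|V(G')|\le C\,r^r k^{r-t'-1}$. -/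

import Mathlib

/-! ### A step-counting machine model

Imperative programs over natural-number variables and two-dimensional arrays (a random access
machine with unit-cost addition and truncated subtraction, and without multiplication, so that
numbers grow by at most one bit per addition). Unit-cost time on it is polynomially related to
Turing machine time. -/

namespace RAM

/-- A memory state: scalar variables, and arrays `arr a i j` (array `a`, row `i`, column `j`). -/
structure State where
  var : ℕ → ℕ
  arr : ℕ → ℕ → ℕ → ℕ

namespace State

/-- Overwrite variable `x` by `v`. -/
def setVar (σ : State) (x v : ℕ) : State where
  var := fun y => if y = x then v else σ.var y
  arr := σ.arr

/-- Overwrite cell `(i, j)` of array `a` by `v`. -/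
def setArr (σ : State) (a i j v : ℕ) : State where
  var := σ.var
  arr := fun b p q => if b = a ∧ p = i ∧ q = j then v else σ.arr b p q

end State

/-- Arithmetic expressions. -/
inductive Expr where
  | const (c : ℕ)
  | var (x : ℕ)
  | arr (a : ℕ) (i j : Expr)
  | add (e₁ e₂ : Expr)
  | sub (e₁ e₂ : Expr)

namespace Expr

/-- The value of an expression (`sub` is truncated subtraction). -/
def eval (σ : State) : Expr → ℕ
  | const c => c
  | var x => σ.var x
  | arr a i j => σ.arr a (i.eval σ) (j.eval σ)
  | add e₁ e₂ => e₁.eval σ + e₂.eval σ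
  | sub e₁ e₂ => e₁.eval σ - e₂.eval σ

/-- The number of elementary operations used to evaluate an expression. -/
def cost : Expr → ℕ
  | const _ => 1
  | var _ => 1
  | arr _ i j => i.cost + j.cost + 1
  | add e₁ e₂ => e₁.cost + e₂.cost + 1
  | sub e₁ e₂ => e₁.cost + e₂.cost + 1

end Expr

/-- Programs. The tests `cond e c₁ c₂` (if-then-else) and `loop e c` (while) ask whether the value
of `e` is nonzero. -/
inductive Prog where
  | skip
  | assign (x : ℕ) (e : Expr)
  | store (a : ℕ) (i j e : Expr)
  | seq (c₁ c₂ : Prog)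
  | cond (e : Expr) (c₁ c₂ : Prog)
  | loop (e : Expr) (c : Prog)

/-- `Exec c σ σ' T`: program `c`, started in state `σ`, halts in state `σ'` after exactly
`T` steps. -/
inductive Exec : Prog → State → State → ℕ → Prop where
  | skip (σ : State) : Exec .skip σ σ 1
  | assign (σ : State) (x : ℕ) (e : Expr) :
      Exec (.assign x e) σ (σ.setVar x (e.eval σ)) (e.cost + 1)
  | store (σ : State) (a : ℕ) (i j e : Expr) :
      Exec (.store a i j e) σ (σ.setArr a (i.eval σ) (j.eval σ) (e.eval σ))
        (i.cost + j.cost + e.cost + 1)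
  | seq {c₁ c₂ : Prog} {σ σ₁ σ₂ : State} {T₁ T₂ : ℕ} :
      Exec c₁ σ σ₁ T₁ → Exec c₂ σ₁ σ₂ T₂ → Exec (.seq c₁ c₂) σ σ₂ (T₁ + T₂)
  | condTrue {e : Expr} {c₁ c₂ : Prog} {σ σ' : State} {T : ℕ} :
      e.eval σ ≠ 0 → Exec c₁ σ σ' T → Exec (.cond e c₁ c₂) σ σ' (e.cost + 1 + T)
  | condFalse {e : Expr} {c₁ c₂ : Prog} {σ σ' : State} {T : ℕ} :
      e.eval σ = 0 → Exec c₂ σ σ' T → Exec (.cond e c₁ c₂) σ σ' (e.cost + 1 + T)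
  | loopFalse {e : Expr} {c : Prog} {σ : State} :
      e.eval σ = 0 → Exec (.loop e c) σ σ (e.cost + 1)
  | loopTrue {e : Expr} {c : Prog} {σ σ₁ σ₂ : State} {T₁ T₂ : ℕ} :
      e.eval σ ≠ 0 → Exec c σ σ₁ T₁ → Exec (.loop e c) σ₁ σ₂ T₂ →
      Exec (.loop e c) σ σ₂ (e.cost + 1 + T₁ + T₂)

open Classical in
/-- The input state for the instance `(G, k)`, `G` a graph on `n` vertices: variable `0` holds `n`,
variable `1` holds `k`, array `0` holds the adjacency matrix of `G`, all the rest is zero. -/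
noncomputable def inputState {n : ℕ} (G : SimpleGraph (Fin n)) (k : ℕ) : State where
  var := fun x => if x = 0 then n else if x = 1 then k else 0
  arr := fun a i j =>
    if a = 0 ∧ ∃ (hi : i < n) (hj : j < n), G.Adj ⟨i, hi⟩ ⟨j, hj⟩ then 1 else 0

/-- The state `σ` holds the instance `(G, k)` as output: variable `0` holds the number `n` of
vertices, variable `1` holds `k`, the first `n` rows and columns of array `0` are the adjacency
matrix of `G`. The other variables and cells may hold anything. -/
def HoldsInstance (σ : State) {n : ℕ} (G : SimpleGraph (Fin n)) (k : ℕ) : Prop :=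
  σ.var 0 = n ∧ σ.var 1 = k ∧
    ∀ i j : Fin n, (G.Adj i j → σ.arr 0 i j = 1) ∧ (¬ G.Adj i j → σ.arr 0 i j = 0)

end RAM

/-! ### Kernelization -/

/-- A parameterized graph problem: a property of a finite graph and a parameter `k`. -/
abbrev ParamGraphProblem : Type := ∀ n : ℕ, SimpleGraph (Fin n) → ℕ → Prop

/-- The problem `Q` has a kernel with at most `B k` vertices: some program transforms every
instance `(G, k)`, in time polynomial in the size of the instance (`k` is given in binary), into an
equivalent instance `(G', k')` of the same problem with `k' ≤ k` and `|V(G')| ≤ B k`. -/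
def HasKernelWithVertices (Q : ParamGraphProblem) (B : ℕ → ℝ) : Prop :=
  ∃ (c : RAM.Prog) (p : Polynomial ℕ),
    ∀ (n : ℕ) (G : SimpleGraph (Fin n)) (k : ℕ),
      ∃ (n' : ℕ) (G' : SimpleGraph (Fin n')) (k' : ℕ) (σ' : RAM.State) (T : ℕ),
        RAM.Exec c (RAM.inputState G k) σ' T ∧
        T ≤ p.eval (n + Nat.size k) ∧
        RAM.HoldsInstance σ' G' k' ∧
        (Q n G k ↔ Q n' G' k') ∧
        k' ≤ k ∧
        (n' : ℝ) ≤ B k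

/-! ### Packings of graphs with bounded overlap -/

/-- A family of finite graphs. -/
abbrev GraphFamily : Type := Set (Σ s : ℕ, SimpleGraph (Fin s))

/-- The family of cliques `K_a, …, K_r`. -/
def cliqueFamily (a r : ℕ) : GraphFamily :=
  {F | ∃ s : ℕ, a ≤ s ∧ s ≤ r ∧ F = ⟨s, (⊤ : SimpleGraph (Fin s))⟩}

/-- `H` is an `ℋ`-subgraph of `G`: a subgraph isomorphic to some member of `ℋ`. -/
def IsFamilySubgraph {V : Type*} {G : SimpleGraph V} (ℋ : GraphFamily) (H : G.Subgraph) : Prop :=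
  ∃ F ∈ ℋ, Nonempty (H.coe ≃g F.2)

/-- `K` is a set of `k` many `ℋ`-subgraphs of `G` that pairwise share at most `t` vertices. -/
def IsVertexPacking {V : Type*} {G : SimpleGraph V} (ℋ : GraphFamily) (k t : ℕ)
    (K : Finset G.Subgraph) : Prop :=
  K.card = k ∧ (∀ H ∈ K, IsFamilySubgraph ℋ H) ∧
    ∀ H ∈ K, ∀ H' ∈ K, H ≠ H' → (H.verts ∩ H'.verts).ncard ≤ t

/-- `K` is a set of `k` many `ℋ`-subgraphs of `G` that pairwise share at most `t` edges. -/
def IsEdgePacking {V : Type*} {G : SimpleGraph V} (ℋ : GraphFamily) (k t : ℕ)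
    (K : Finset G.Subgraph) : Prop :=
  K.card = k ∧ (∀ H ∈ K, IsFamilySubgraph ℋ H) ∧
    ∀ H ∈ K, ∀ H' ∈ K, H ≠ H' → (H.edgeSet ∩ H'.edgeSet).ncard ≤ t

/-- The `K_r`-Packing with `t`-Edge-Overlap problem: does `G` contain `k` cliques, each with at
least `t + 1` and at most `r` vertices, that pairwise share at most `t` edges? -/
def cliqueEdgeOverlapProblem (r t : ℕ) : ParamGraphProblem := fun _ G k =>
  ∃ K : Finset G.Subgraph, IsEdgePacking (cliqueFamily (t + 1) r) k t K

/-! Part (1): the common edges of two cliques are the pairs of common vertices, so cliques with v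
common vertices share `v.choose 2` edges (`ncard_edgeSet_inter`), and this is at most t exactly when
v ≤ t' (`choose_two_le_iff`). From here on the problem is about families of finite sets that
pairwise share at most s = t' elements.

Part (2), easy case r ≤ s + 1: distinct sets of at most r elements never share more than s of them,
so only the number of cliques matters, and an instance without vertices suffices
(`hasKernel_of_count`).

Main case s + 2 ≤ r. Choose greedily a maximal family R of admissible cliques in which every set Q
lies in at most `threshold r s k Q.card` members. The threshold of the empty set bounds |R| by r^s
(rk)^(r-s-1), so R covers at most r^r k^(r-s-1) vertices. Let A ∉ R belong to a packing of k
cliques. By maximality some Q ⊆ A has reached its threshold. If |Q| ≤ s, then R is so large that it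
contains a packing of k members (`exists_overlap_of_le_card`). If s < |Q| < r - 1, some member of R
above Q meets the rest of the packing only inside Q and can replace A (`exists_avoiding`). If |Q| ≥
r - 1, then A shares r - 1 vertices with a member of R. Hence the packing may be assumed to consist
of members of R and of such near members (`exists_overlap_near`). A near member that is not covered
by R is an (r-1)-subset of a member of R plus one uncovered vertex.

It remains to discard uncovered vertices. Join an uncovered vertex to an (r-1)-subset of a member of
R when they form a clique together, and run an auction with the vertices as bidders and the subsets
as items. When no bid is left, a price level that no item has separates off expensive items that are
all owned, whose owners see only expensive items, and which include every item seen by a bidder who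
owns nothing (`Auction.Valid.exists_level`). This is a crown: near members built on expensive items
can be moved to the owners of these items, and all others already use owners
(`exists_overlap_kept`). There are at most r|R| items, hence as many owners, and the kernel has at
most 2 r^r k^(r-s-1) vertices (`card_kept_le`).

Polynomial time: the algorithm is written in a language in which every loop and sum has the same
bound, (n+2)^r, which exceeds the number of cliques with at most r vertices. Since k is given in
binary, the program computes with the minimum of k and this bound; a larger k makes both instances
no-instances. -/

namespace RAM

/-! ### A loop language with bounded sums, compiled to RAM programs -/

/-- Expressions with bounded sums: `sum x e` is the sum of `e` over all values of `x` below the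
value of variable `2`. -/
inductive HExpr where
  | const (c : ℕ)
  | var (x : ℕ)
  | arr (a : ℕ) (i j : HExpr)
  | add (e₁ e₂ : HExpr)
  | sub (e₁ e₂ : HExpr)
  | ite (c e₁ e₂ : HExpr)
  | sum (x : ℕ) (e : HExpr)

/-- Programs whose loops `loop x c` let `x` run through all values below variable `2`. -/
inductive HProg where
  | assign (x : ℕ) (e : HExpr)
  | store (a : ℕ) (i j e : HExpr)
  | seq (c₁ c₂ : HProg)
  | ite (e : HExpr) (c : HProg)
  | loop (x : ℕ) (c : HProg)

/-- Variables from `tmpBase` on are reserved for the compiler. -/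
def tmpBase : ℕ := 20

namespace HExpr

/-- The value of an expression. -/
def eval : HExpr → State → ℕ
  | const c, _ => c
  | var x, σ => σ.var x
  | arr a i j, σ => σ.arr a (i.eval σ) (j.eval σ)
  | add e₁ e₂, σ => e₁.eval σ + e₂.eval σ
  | sub e₁ e₂, σ => e₁.eval σ - e₂.eval σ
  | ite c e₁ e₂, σ => if c.eval σ ≠ 0 then e₁.eval σ else e₂.eval σ
  | sum x e, σ => ∑ i ∈ Finset.range (σ.var 2), e.eval (σ.setVar x i)

/-- All variables are below `tmpBase`, and bound variables are not `2`. -/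
def WF : HExpr → Prop
  | const _ => True
  | var x => x < tmpBase
  | arr _ i j => i.WF ∧ j.WF
  | add e₁ e₂ => e₁.WF ∧ e₂.WF
  | sub e₁ e₂ => e₁.WF ∧ e₂.WF
  | ite c e₁ e₂ => c.WF ∧ e₁.WF ∧ e₂.WF
  | sum x e => x < tmpBase ∧ x ≠ 2 ∧ e.WF

/-- Compilation: the value of the expression is put into variable `d`, using only
variables from `d` on as scratch space. -/
def compile : HExpr → ℕ → Prog
  | const c, d => .assign d (.const c)
  | var x, d => .assign d (.var x)
  | arr a i j, d => .seq (i.compile d) (.seq (j.compile (d + 1))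
      (.assign d (.arr a (.var d) (.var (d + 1)))))
  | add e₁ e₂, d => .seq (e₁.compile d) (.seq (e₂.compile (d + 1))
      (.assign d (.add (.var d) (.var (d + 1)))))
  | sub e₁ e₂, d => .seq (e₁.compile d) (.seq (e₂.compile (d + 1))
      (.assign d (.sub (.var d) (.var (d + 1)))))
  | ite c e₁ e₂, d => .seq (c.compile d) (.cond (.var d) (e₁.compile d) (e₂.compile d))
  | sum x e, d => .seq (.assign (d + 1) (.var x)) (.seq (.assign (d + 2) (.const 0))
      (.seq (.assign d (.const 0)) (.seq
        (.loop (.sub (.var 2) (.var (d + 2)))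
          (.seq (.assign x (.var (d + 2))) (.seq (e.compile (d + 3))
            (.seq (.assign d (.add (.var d) (.var (d + 3))))
              (.assign (d + 2) (.add (.var (d + 2)) (.const 1)))))))
        (.assign x (.var (d + 1))))))

/-- A bound for the running time in terms of the loop bound. -/
noncomputable def time : HExpr → Polynomial ℕ
  | const _ => 2
  | var _ => 2
  | arr _ i j => i.time + j.time + 4
  | add e₁ e₂ => e₁.time + e₂.time + 4
  | sub e₁ e₂ => e₁.time + e₂.time + 4
  | ite c e₁ e₂ => c.time + e₁.time + e₂.time + 2
  | sum _ e => Polynomial.X * (e.time + 14) + 12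

end HExpr

namespace HProg

/-- The effect of a program. -/
def run : HProg → State → State
  | assign x e, σ => σ.setVar x (e.eval σ)
  | store a i j e, σ => σ.setArr a (i.eval σ) (j.eval σ) (e.eval σ)
  | seq c₁ c₂, σ => c₂.run (c₁.run σ)
  | ite e c, σ => if e.eval σ ≠ 0 then c.run σ else σ
  | .loop x c, σ => (List.range (σ.var 2)).foldl (fun τ i => c.run (τ.setVar x i)) σ

/-- All variables are below `tmpBase`, and variable `2` is not modified. -/
def WF : HProg → Prop
  | assign x e => x < tmpBase ∧ x ≠ 2 ∧ e.WF
  | store _ i j e => i.WF ∧ j.WF ∧ e.WF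
  | seq c₁ c₂ => c₁.WF ∧ c₂.WF
  | ite e c => e.WF ∧ c.WF
  | .loop x c => x < tmpBase ∧ x ≠ 2 ∧ c.WF

/-- Compilation, with scratch space from variable `d` on. -/
def compile : HProg → ℕ → Prog
  | assign x e, d => .seq (e.compile d) (.assign x (.var d))
  | store a i j e, d => .seq (i.compile d) (.seq (j.compile (d + 1)) (.seq (e.compile (d + 2))
      (.store a (.var d) (.var (d + 1)) (.var (d + 2)))))
  | seq c₁ c₂, d => .seq (c₁.compile d) (c₂.compile d)
  | ite e c, d => .seq (e.compile d) (.cond (.var d) (c.compile d) .skip)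
  | .loop x c, d => .seq (.assign d (.const 0))
      (.loop (.sub (.var 2) (.var d)) (.seq (.assign x (.var d)) (.seq (c.compile (d + 1))
        (.assign d (.add (.var d) (.const 1))))))

/-- A bound for the running time in terms of the loop bound. -/
noncomputable def time : HProg → Polynomial ℕ
  | assign _ e => e.time + 2
  | store _ i j e => i.time + j.time + e.time + 4
  | seq c₁ c₂ => c₁.time + c₂.time
  | ite e c => e.time + c.time + 3
  | .loop _ c => Polynomial.X * (c.time + 10) + 6

end HProg

/-! ### Correctness and running time of the compiler. -/

@[simp] theorem State.setVar_var (σ : State) (x v y : ℕ) :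
    (σ.setVar x v).var y = if y = x then v else σ.var y := rfl

@[simp] theorem State.setVar_arr (σ : State) (x v : ℕ) : (σ.setVar x v).arr = σ.arr := rfl

@[simp] theorem State.setArr_var (σ : State) (a i j v : ℕ) : (σ.setArr a i j v).var = σ.var := rfl

@[simp] theorem State.setArr_arr (σ : State) (a i j v b p q : ℕ) :
    (σ.setArr a i j v).arr b p q = if b = a ∧ p = i ∧ q = j then v else σ.arr b p q := rfl

/-- Two states agree outside the compiler's scratch space. -/
def Agree (σ τ : State) : Prop := σ.arr = τ.arr ∧ ∀ x < tmpBase, σ.var x = τ.var x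

theorem Agree.setVar {σ τ : State} (h : Agree σ τ) (x v : ℕ) :
    Agree (σ.setVar x v) (τ.setVar x v) :=
  ⟨h.1, fun y hy => by simp [h.2 y hy]⟩

theorem HExpr.eval_congr {e : HExpr} (he : e.WF) : ∀ {σ τ : State}, Agree σ τ →
    e.eval σ = e.eval τ := by
  induction e with
  | const c => intros; rfl
  | var x => intro σ τ h; exact h.2 x he
  | arr a i j hi hj => intro σ τ h; simp only [eval, hi he.1 h, hj he.2 h, h.1]
  | add e₁ e₂ h₁ h₂ => intro σ τ h; simp only [eval, h₁ he.1 h, h₂ he.2 h]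
  | sub e₁ e₂ h₁ h₂ => intro σ τ h; simp only [eval, h₁ he.1 h, h₂ he.2 h]
  | ite c e₁ e₂ hc h₁ h₂ =>
    intro σ τ h; simp only [eval, hc he.1 h, h₁ he.2.1 h, h₂ he.2.2 h]
  | sum x e ih =>
    intro σ τ h
    simp only [eval, h.2 2 (by decide)]
    exact Finset.sum_congr rfl fun i _ => ih he.2.2 (h.setVar x i)

/-- The rule for all compiled loops, which count a variable up to the value of variable `2`. Each
round costs the body plus 4 for the test, and the last 4 pays for the failing test. -/
theorem exec_count {b : Prog} {cnt N B : ℕ} {Inv : ℕ → State → Prop}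
    (hcnt : ∀ i τ, Inv i τ → τ.var cnt = i ∧ τ.var 2 = N)
    (hbody : ∀ i < N, ∀ τ, Inv i τ → ∃ τ' T, Exec b τ τ' T ∧ Inv (i + 1) τ' ∧ T ≤ B) :
    ∀ j i, i + j = N → ∀ τ, Inv i τ → ∃ τ' T,
      Exec (.loop (.sub (.var 2) (.var cnt)) b) τ τ' T ∧ Inv N τ' ∧ T ≤ j * (B + 4) + 4 := by
  intro j
  induction j with
  | zero =>
    intro i hi τ h
    obtain ⟨h1, h2⟩ := hcnt i τ h
    have hiN : i = N := by omega
    refine ⟨τ, _, Exec.loopFalse ?_, hiN ▸ h, by simp [Expr.cost]⟩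
    simp [Expr.eval, h1, h2, hiN]
  | succ j ih =>
    intro i hi τ h
    obtain ⟨h1, h2⟩ := hcnt i τ h
    obtain ⟨τ₁, T₁, e₁, hI, hT⟩ := hbody i (by omega) τ h
    obtain ⟨τ₂, T₂, e₂, hI₂, hT₂⟩ := ih (i + 1) (by omega) τ₁ hI
    refine ⟨τ₂, _, Exec.loopTrue ?_ e₁ e₂, hI₂, ?_⟩
    · simp only [Expr.eval, h1, h2]; omega
    · simp only [Expr.cost, add_mul, one_mul]; omega

/-- Scratch space works like a stack: everything below `d` survives, so a value already computed in
`d` is safe while the next subexpression runs from `d + 1` on. -/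
theorem HExpr.compile_exec {e : HExpr} (he : e.WF) : ∀ (d : ℕ) (σ : State), tmpBase ≤ d →
    ∃ σ' T, Exec (e.compile d) σ σ' T ∧ σ'.arr = σ.arr ∧ (∀ y < d, σ'.var y = σ.var y) ∧
      σ'.var d = e.eval σ ∧ T ≤ e.time.eval (σ.var 2) := by
  have two : ∀ {d}, tmpBase ≤ d → 2 < d := fun h => lt_of_lt_of_le (by decide) h
  -- Shared by array access, addition and subtraction. `σ''` is the state in which both operands are
  -- ready, just before the final assignment.
  have binary : ∀ {e₁ e₂ : HExpr}, e₁.WF → e₂.WF →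
      (∀ (d : ℕ) (σ : State), tmpBase ≤ d →
        ∃ σ' T, Exec (e₁.compile d) σ σ' T ∧ σ'.arr = σ.arr ∧ (∀ y < d, σ'.var y = σ.var y) ∧
        σ'.var d = e₁.eval σ ∧ T ≤ e₁.time.eval (σ.var 2)) →
      (∀ (d : ℕ) (σ : State), tmpBase ≤ d →
        ∃ σ' T, Exec (e₂.compile d) σ σ' T ∧ σ'.arr = σ.arr ∧ (∀ y < d, σ'.var y = σ.var y) ∧
        σ'.var d = e₂.eval σ ∧ T ≤ e₂.time.eval (σ.var 2)) →
      ∀ (f : Expr) (d : ℕ) (σ : State), tmpBase ≤ d → f.cost = 3 →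
        ∃ σ' σ'' T, Exec (.seq (e₁.compile d) (.seq (e₂.compile (d + 1)) (.assign d f))) σ σ' T ∧
          σ''.arr = σ.arr ∧ σ'.arr = σ.arr ∧ (∀ y < d, σ'.var y = σ.var y) ∧
          σ''.var d = e₁.eval σ ∧ σ''.var (d + 1) = e₂.eval σ ∧ σ'.var d = f.eval σ'' ∧
          T ≤ e₁.time.eval (σ.var 2) + e₂.time.eval (σ.var 2) + 4 := by
    intro e₁ e₂ w₁ w₂ h₁ h₂ f d σ hd hf
    obtain ⟨σ₁, T₁, x₁, a₁, v₁, r₁, t₁⟩ := h₁ d σ hd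
    obtain ⟨σ₂, T₂, x₂, a₂, v₂, r₂, t₂⟩ := h₂ (d + 1) σ₁ (by omega)
    refine ⟨_, σ₂, _, Exec.seq x₁ (Exec.seq x₂ (Exec.assign σ₂ d f)), a₂.trans a₁, a₂.trans a₁,
      fun y hy => ?_, ?_, ?_, ?_, ?_⟩
    · simp [hy.ne, v₂ y (by omega), v₁ y hy]
    · rw [v₂ d (by omega), r₁]
    · rw [r₂]
      exact eval_congr w₂ ⟨a₁, fun y hy => v₁ y (by omega)⟩
    · simp
    · rw [v₁ 2 (two hd)] at t₂
      omega
  induction e with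
  | const c =>
    intro d σ hd
    exact ⟨_, _, Exec.assign σ d _, rfl, fun y hy => by simp [hy.ne],
      by simp [Expr.eval, eval], by simp [Expr.cost, time]⟩
  | var x =>
    intro d σ hd
    exact ⟨_, _, Exec.assign σ d _, rfl, fun y hy => by simp [hy.ne],
      by simp [Expr.eval, eval], by simp [Expr.cost, time]⟩
  | arr a i j hi hj =>
    intro d σ hd
    obtain ⟨σ', σ'', T, x, a'', a', v, r1, r2, r, t⟩ :=
      binary he.1 he.2 (hi he.1) (hj he.2) (.arr a (.var d) (.var (d + 1))) d σ hd rfl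
    refine ⟨σ', T, x, a', v, ?_, ?_⟩
    · rw [r]; simp [Expr.eval, eval, r1, r2, a'']
    · simpa [time] using t
  | add i j hi hj =>
    intro d σ hd
    obtain ⟨σ', σ'', T, x, a'', a', v, r1, r2, r, t⟩ :=
      binary he.1 he.2 (hi he.1) (hj he.2) (.add (.var d) (.var (d + 1))) d σ hd rfl
    refine ⟨σ', T, x, a', v, ?_, ?_⟩
    · rw [r]; simp [Expr.eval, eval, r1, r2]
    · simpa [time] using t
  | sub i j hi hj =>
    intro d σ hd
    obtain ⟨σ', σ'', T, x, a'', a', v, r1, r2, r, t⟩ :=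
      binary he.1 he.2 (hi he.1) (hj he.2) (.sub (.var d) (.var (d + 1))) d σ hd rfl
    refine ⟨σ', T, x, a', v, ?_, ?_⟩
    · rw [r]; simp [Expr.eval, eval, r1, r2]
    · simpa [time] using t
  | ite c e₁ e₂ hc h₁ h₂ =>
    intro d σ hd
    obtain ⟨σ₁, T₁, x₁, a₁, v₁, r₁, t₁⟩ := hc he.1 d σ hd
    have agree : Agree σ₁ σ := ⟨a₁, fun y hy => v₁ y (by omega)⟩
    have e2 := v₁ 2 (two hd)
    by_cases hz : c.eval σ ≠ 0
    · obtain ⟨σ₂, T₂, x₂, a₂, v₂, r₂, t₂⟩ := h₁ he.2.1 d σ₁ hd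
      refine ⟨σ₂, _, Exec.seq x₁ (Exec.condTrue (by simpa [Expr.eval, r₁] using hz) x₂),
        a₂.trans a₁, fun y hy => (v₂ y hy).trans (v₁ y hy), ?_, ?_⟩
      · rw [r₂, eval_congr he.2.1 agree, eval, if_pos hz]
      · rw [e2] at t₂
        simp only [time, Polynomial.eval_add, Polynomial.eval_ofNat, Expr.cost]; omega
    · obtain ⟨σ₂, T₂, x₂, a₂, v₂, r₂, t₂⟩ := h₂ he.2.2 d σ₁ hd
      refine ⟨σ₂, _, Exec.seq x₁ (Exec.condFalse (by simpa [Expr.eval, r₁] using hz) x₂),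
        a₂.trans a₁, fun y hy => (v₂ y hy).trans (v₁ y hy), ?_, ?_⟩
      · rw [r₂, eval_congr he.2.2 agree, eval, if_neg hz]
      · rw [e2] at t₂
        simp only [time, Polynomial.eval_add, Polynomial.eval_ofNat, Expr.cost]; omega
  | sum x e ih =>
    intro d σ hd
    obtain ⟨hx, hx2, hw⟩ := he
    have hxd : x < d := by omega
    have h2d := two hd
    let N := σ.var 2
    -- Cell `d` is the accumulator, `d + 2` the counter, and `d + 1` keeps the old value of the
    -- bound variable, which the loop overwrites and which is restored afterwards.
    let Inv : ℕ → State → Prop := fun i τ => τ.arr = σ.arr ∧ τ.var (d + 2) = i ∧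
      τ.var (d + 1) = σ.var x ∧ (∀ y < d, y ≠ x → τ.var y = σ.var y) ∧
      τ.var d = ∑ i ∈ Finset.range i, e.eval (σ.setVar x i)
    let σ₃ := ((σ.setVar (d + 1) (σ.var x)).setVar (d + 2) 0).setVar d 0
    have h0 : Inv 0 σ₃ := by
      refine ⟨rfl, by simp [σ₃], by simp [σ₃], fun y hy _ => ?_, by simp [σ₃]⟩
      simp only [σ₃, State.setVar_var]
      rw [if_neg (by omega), if_neg (by omega), if_neg (by omega)]
    obtain ⟨τ, T, ex, hI, hT⟩ := exec_count (cnt := d + 2) (N := N) (Inv := Inv)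
      (b := .seq (.assign x (.var (d + 2))) (.seq (e.compile (d + 3))
            (.seq (.assign d (.add (.var d) (.var (d + 3))))
              (.assign (d + 2) (.add (.var (d + 2)) (.const 1))))))
      (B := e.time.eval N + 10)
      (fun i τ h => ⟨h.2.1, h.2.2.2.1 2 h2d hx2.symm⟩)
      (by
        intro i hi τ ⟨ha, hc, hs, hv, hr⟩
        obtain ⟨τ₁, T₁, x₁, a₁, v₁, r₁, t₁⟩ := ih hw (d + 3) (τ.setVar x i) (by omega)
        refine ⟨_, _, Exec.seq (Exec.assign τ x _) (Exec.seq
          (by simpa [Expr.eval, hc] using x₁) (Exec.seq (Exec.assign _ _ _) (Exec.assign _ _ _))),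
          ⟨?_, ?_, ?_, ?_, ?_⟩, ?_⟩
        · simp [a₁, ha]
        · simp [Expr.eval, v₁ (d + 2) (by omega), hc, show d + 2 ≠ x by omega]
        · simp [v₁ (d + 1) (by omega), hs, show d + 1 ≠ x by omega]
        · intro y hy hyx
          simp only [State.setVar_var]
          rw [if_neg (by omega), if_neg (by omega), v₁ y (by omega)]
          simp [hyx, hv y hy hyx]
        · simp only [State.setVar_var, Expr.eval]
          rw [if_neg (by omega), if_pos trivial, r₁, v₁ d (by omega), Finset.sum_range_succ]
          simp only [State.setVar_var]
          rw [if_neg (by omega), hr]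
          congr 1
          refine eval_congr hw ⟨ha, fun y hy => ?_⟩
          by_cases hyx : y = x
          · simp [hyx]
          · simp [hyx, hv y (by omega) hyx]
        · have : (τ.setVar x i).var 2 = N := by
            simp [hx2.symm, hv 2 h2d hx2.symm, N]
          rw [this] at t₁
          simp only [Expr.cost]; omega)
      N 0 (by omega) σ₃ h0
    obtain ⟨ha, hc, hs, hv, hr⟩ := hI
    refine ⟨_, _, Exec.seq (Exec.assign σ (d + 1) (.var x)) (Exec.seq (Exec.assign _ (d + 2) (.const 0))
      (Exec.seq (Exec.assign _ d (.const 0)) (Exec.seq ex (Exec.assign _ _ _)))), ?_, ?_, ?_, ?_⟩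
    · simp [ha]
    · intro y hy
      by_cases hyx : y = x
      · simp [hyx, Expr.eval, hs]
      · simp [hyx, hv y hy hyx]
    · simp [hr, eval, show d ≠ x by omega, N]
    · have : (sum x e).time.eval (σ.var 2) = N * (e.time.eval N + 14) + 12 := by
        simp [time, N]
      rw [this]
      simp only [Expr.cost]
      have : e.time.eval N + 10 + 4 = e.time.eval N + 14 := rfl
      rw [this] at hT
      omega

/-- The loop bound stays constant during a run, so all time polynomials are evaluated at the same
number. -/
theorem HProg.run_var_two {c : HProg} (hc : c.WF) : ∀ σ : State, (c.run σ).var 2 = σ.var 2 := by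
  induction c with
  | assign x e => intro σ; simp [run, hc.2.1.symm]
  | store a i j e => intro σ; rfl
  | seq c₁ c₂ h₁ h₂ => intro σ; rw [run, h₂ hc.2, h₁ hc.1]
  | ite e c h => intro σ; rw [run]; split_ifs; exacts [h hc.2 σ, rfl]
  | loop x c h =>
    intro σ
    have key : ∀ N, ((List.range N).foldl (fun τ i => c.run (τ.setVar x i)) σ).var 2 = σ.var 2 := by
      intro N
      induction N with
      | zero => rfl
      | succ N ih =>
        rw [List.range_succ, List.foldl_append, List.foldl_cons, List.foldl_nil, h hc.2.2]
        simp [hc.2.1.symm, ih]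
    exact key _

theorem HProg.compile_exec {c : HProg} (hc : c.WF) : ∀ (d : ℕ) (σ τ : State), tmpBase ≤ d →
    Agree σ τ → ∃ τ' T, Exec (c.compile d) τ τ' T ∧ Agree (c.run σ) τ' ∧
      (∀ y < d, tmpBase ≤ y → τ'.var y = τ.var y) ∧ T ≤ c.time.eval (σ.var 2) := by
  induction c with
  | assign x e =>
    intro d σ τ hd h
    have hx := hc.1
    obtain ⟨τ₁, T₁, x₁, a₁, v₁, r₁, t₁⟩ := HExpr.compile_exec hc.2.2 d τ hd
    refine ⟨_, _, Exec.seq x₁ (Exec.assign _ _ _), ⟨?_, ?_⟩, ?_, ?_⟩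
    · simp [run, h.1, a₁]
    · intro y hy
      simp only [run, State.setVar_var, Expr.eval, r₁, HExpr.eval_congr hc.2.2 h,
        v₁ y (by omega), h.2 y hy]
    · intro y hy hy'
      simp [v₁ y hy, show y ≠ x by omega]
    · rw [← h.2 2 (by decide)] at t₁
      simp only [time, Polynomial.eval_add, Polynomial.eval_ofNat, Expr.cost]; omega
  | store a i j e =>
    intro d σ τ hd h
    obtain ⟨τ₁, T₁, x₁, a₁, v₁, r₁, t₁⟩ := HExpr.compile_exec hc.1 d τ hd
    obtain ⟨τ₂, T₂, x₂, a₂, v₂, r₂, t₂⟩ := HExpr.compile_exec hc.2.1 (d + 1) τ₁ (by omega)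
    obtain ⟨τ₃, T₃, x₃, a₃, v₃, r₃, t₃⟩ := HExpr.compile_exec hc.2.2 (d + 2) τ₂ (by omega)
    have h₁ : Agree σ τ₁ := ⟨h.1.trans a₁.symm, fun y hy => (h.2 y hy).trans (v₁ y (by omega)).symm⟩
    have h₂ : Agree σ τ₂ :=
      ⟨h₁.1.trans a₂.symm, fun y hy => (h₁.2 y hy).trans (v₂ y (by omega)).symm⟩
    refine ⟨_, _, Exec.seq x₁ (Exec.seq x₂ (Exec.seq x₃ (Exec.store _ _ _ _ _))), ⟨?_, ?_⟩, ?_, ?_⟩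
    · funext b p q
      simp only [run, State.setArr_arr, Expr.eval]
      rw [v₃ d (by omega), v₂ d (by omega), v₃ (d + 1) (by omega), r₁, r₂, r₃,
        ← HExpr.eval_congr hc.1 h, ← HExpr.eval_congr hc.2.1 h₁, ← HExpr.eval_congr hc.2.2 h₂,
        a₃, ← h₂.1]
    · intro y hy
      simp only [run, State.setArr_var]
      rw [h₂.2 y hy, v₃ y (by omega)]
    · intro y hy _
      simp only [State.setArr_var]
      rw [v₃ y (by omega), v₂ y (by omega), v₁ y hy]
    · rw [← h.2 2 (by decide)] at t₁
      rw [← h₁.2 2 (by decide)] at t₂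
      rw [← h₂.2 2 (by decide)] at t₃
      simp only [time, Polynomial.eval_add, Polynomial.eval_ofNat, Expr.cost]; omega
  | seq c₁ c₂ ih₁ ih₂ =>
    intro d σ τ hd h
    obtain ⟨τ₁, T₁, x₁, h₁, v₁, t₁⟩ := ih₁ hc.1 d σ τ hd h
    obtain ⟨τ₂, T₂, x₂, h₂, v₂, t₂⟩ := ih₂ hc.2 d _ τ₁ hd h₁
    refine ⟨τ₂, _, Exec.seq x₁ x₂, h₂, fun y hy hy' => (v₂ y hy hy').trans (v₁ y hy hy'), ?_⟩
    rw [run_var_two hc.1] at t₂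
    simp only [time, Polynomial.eval_add]; omega
  | ite e c ih =>
    intro d σ τ hd h
    obtain ⟨τ₁, T₁, x₁, a₁, v₁, r₁, t₁⟩ := HExpr.compile_exec hc.1 d τ hd
    have h₁ : Agree σ τ₁ := ⟨h.1.trans a₁.symm, fun y hy => (h.2 y hy).trans (v₁ y (by omega)).symm⟩
    rw [← HExpr.eval_congr hc.1 h] at r₁
    rw [← h.2 2 (by decide)] at t₁
    by_cases hz : e.eval σ ≠ 0
    · obtain ⟨τ₂, T₂, x₂, h₂, v₂, t₂⟩ := ih hc.2 d _ τ₁ hd h₁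
      refine ⟨τ₂, _, Exec.seq x₁ (Exec.condTrue (by simpa [Expr.eval, r₁] using hz) x₂), ?_,
        fun y hy hy' => (v₂ y hy hy').trans (v₁ y hy), ?_⟩
      · rwa [run, if_pos hz]
      · simp only [time, Polynomial.eval_add, Polynomial.eval_ofNat, Expr.cost]; omega
    · refine ⟨τ₁, _, Exec.seq x₁ (Exec.condFalse (by simpa [Expr.eval, r₁] using hz) (Exec.skip _)),
        ?_, fun y hy _ => v₁ y hy, ?_⟩
      · rwa [run, if_neg hz]
      · simp only [time, Polynomial.eval_add, Polynomial.eval_ofNat, Expr.cost]; omega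
  | loop x c ih =>
    intro d σ τ hd h
    obtain ⟨hx, hx2, hw⟩ := hc
    let N := σ.var 2
    -- The ideal state after `i` rounds; the compiled loop is compared with it round by round.
    let ρ : ℕ → State := fun i => (List.range i).foldl (fun τ i => c.run (τ.setVar x i)) σ
    have hρ : ∀ i, ρ (i + 1) = c.run ((ρ i).setVar x i) := fun i => by
      simp [ρ, List.range_succ]
    have hρ2 : ∀ i, (ρ i).var 2 = N := by
      intro i
      induction i with
      | zero => rfl
      | succ i ih => rw [hρ, run_var_two hw]; simp [hx2.symm, ih]
    let Inv : ℕ → State → Prop := fun i τ' => Agree (ρ i) τ' ∧ τ'.var d = i ∧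
      ∀ y < d, tmpBase ≤ y → τ'.var y = τ.var y
    obtain ⟨τ', T, ex, hI, hT⟩ := exec_count (cnt := d) (N := N) (Inv := Inv)
      (b := .seq (.assign x (.var d)) (.seq (c.compile (d + 1))
        (.assign d (.add (.var d) (.const 1)))))
      (B := c.time.eval N + 6)
      (fun i τ' h => ⟨h.2.1, by rw [← h.1.2 2 (by decide), hρ2]⟩)
      (by
        intro i hi τ' ⟨ha, hc, hv⟩
        obtain ⟨τ₁, T₁, x₁, h₁, v₁, t₁⟩ :=
          ih hw (d + 1) ((ρ i).setVar x i) (τ'.setVar x i) (by omega) (ha.setVar x i)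
        refine ⟨_, _, Exec.seq (Exec.assign _ _ _) (Exec.seq (by simpa [Expr.eval, hc] using x₁)
          (Exec.assign _ _ _)), ⟨⟨?_, ?_⟩, ?_, ?_⟩, ?_⟩
        · rw [hρ]; exact h₁.1
        · intro y hy
          rw [hρ, h₁.2 y hy]
          simp [show y ≠ d by omega]
        · simp [Expr.eval, v₁ d (by omega) hd, hc, show d ≠ x by omega]
        · intro y hy hy'
          simp [show y ≠ d by omega, v₁ y (by omega) hy', show y ≠ x by omega, hv y hy hy']
        · have : ((ρ i).setVar x i).var 2 = N := by simp [hx2.symm, hρ2]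
          rw [this] at t₁
          simp only [Expr.cost]; omega)
      N 0 (by omega) (τ.setVar d 0)
      ⟨⟨h.1, fun y hy => by simp [h.2 y hy, ρ, show y ≠ d by omega]⟩, by simp,
        fun y hy _ => by simp [show y ≠ d by omega]⟩
    refine ⟨τ', _, Exec.seq (Exec.assign _ _ _) ex, hI.1, hI.2.2, ?_⟩
    have : (HProg.loop x c).time.eval (σ.var 2) = N * (c.time.eval N + 10) + 6 := by
      simp [time, N]
    rw [this]
    have : c.time.eval N + 6 + 4 = c.time.eval N + 10 := rfl
    rw [this] at hT
    simp only [Expr.cost]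
    omega

end RAM

/-! ### Packings of finite sets with bounded overlap -/

namespace SetPacking

variable {V : Type*} [DecidableEq V]

/-- Any two distinct members of `P` share at most `s` elements. -/
def Overlap (s : ℕ) (P : Finset (Finset V)) : Prop :=
  ∀ A ∈ P, ∀ B ∈ P, A ≠ B → (A ∩ B).card ≤ s

/-- The number of members of `R` that contain `Q`. -/
def deg (R : Finset (Finset V)) (Q : Finset V) : ℕ := (R.filter (Q ⊆ ·)).card

/-- The threshold for the number of sets containing a given set with `z` elements. -/
def threshold (r s k z : ℕ) : ℕ :=
  if z ≤ s then r ^ s * (r * k) ^ (r - s - 1) else (r * k) ^ (r - 1 - z)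

theorem Overlap.insert {s : ℕ} {P : Finset (Finset V)} (hP : Overlap s P) {A : Finset V}
    (hA : ∀ B ∈ P, A ≠ B → (A ∩ B).card ≤ s) : Overlap s (insert A P) := by
  intro B hB C hC hne
  rcases Finset.mem_insert.1 hB with hBA | hBP <;> rcases Finset.mem_insert.1 hC with hCA | hCP
  · exact absurd (hBA.trans hCA.symm) hne
  · subst hBA; exact hA C hCP hne
  · subst hCA; rw [Finset.inter_comm]; exact hA B hBP hne.symm
  · exact hP B hBP C hCP hne

theorem Overlap.mono {s : ℕ} {P P' : Finset (Finset V)} (hP : Overlap s P) (h : P' ⊆ P) :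
    Overlap s P' := fun A hA B hB => hP A (h hA) B (h hB)

/-- A large family with bounded degrees contains a large packing. -/
theorem exists_overlap_of_le_card {R : Finset (Finset V)} {r s D : ℕ}
    (hsr : s + 1 ≤ r) (hD : 1 ≤ D) (hR : ∀ A ∈ R, A.card ≤ r)
    (hdeg : ∀ Q : Finset V, Q.card = s + 1 → deg R Q ≤ D) :
    ∀ k : ℕ, k * (r ^ (s + 1) * D) ≤ R.card → ∃ P ⊆ R, P.card = k ∧ Overlap s P := by
  have hX : 1 ≤ r ^ (s + 1) * D := Nat.mul_pos (Nat.pow_pos (by omega)) hD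
  intro k
  induction k with
  | zero => intro _; exact ⟨∅, by simp, by simp, by simp [Overlap]⟩
  | succ k ih =>
    intro hk
    obtain ⟨P, hPR, hPc, hP⟩ := ih (by nlinarith)
    -- A set blocked by `B` contains one of the at most r^(s+1) subsets of `B` with s + 1 elements,
    -- and each of these lies in at most `D` members of `R`.
    have hblock : ∀ B ∈ P, (R.filter fun A => A = B ∨ s < (A ∩ B).card).card ≤
        r ^ (s + 1) * D := by
      intro B hB
      -- A set this small has no subset with s + 1 elements; it blocks only itself.
      by_cases hBs : B.card ≤ s
      · refine le_trans (Finset.card_le_card (t := {B}) ?_) (by simpa using hX)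
        intro A hA
        rw [Finset.mem_filter] at hA
        rcases hA.2 with h | h
        · simp [h]
        · have := Finset.card_le_card (Finset.inter_subset_right (s₁ := A) (s₂ := B))
          omega
      · have hsub : (R.filter fun A => A = B ∨ s < (A ∩ B).card) ⊆
            (B.powersetCard (s + 1)).biUnion fun Q => R.filter (Q ⊆ ·) := by
          intro A hA
          rw [Finset.mem_filter] at hA
          have hc : s + 1 ≤ (A ∩ B).card := by
            rcases hA.2 with h | h
            · rw [h, Finset.inter_self]; omega
            · exact h
          obtain ⟨Q, hQ, hQc⟩ := Finset.exists_subset_card_eq hc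
          rw [Finset.mem_biUnion]
          exact ⟨Q, Finset.mem_powersetCard.2 ⟨hQ.trans Finset.inter_subset_right, hQc⟩,
            Finset.mem_filter.2 ⟨hA.1, hQ.trans Finset.inter_subset_left⟩⟩
        refine (Finset.card_le_card hsub).trans ?_
        refine (Finset.card_biUnion_le_card_mul _ _ D fun Q hQ =>
          hdeg Q (Finset.mem_powersetCard.1 hQ).2).trans ?_
        refine Nat.mul_le_mul_right _ ?_
        rw [Finset.card_powersetCard]
        exact (Nat.choose_le_pow _ _).trans (Nat.pow_le_pow_left (hR B (hPR hB)) _)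
    have hlt : (P.biUnion fun B => R.filter fun A => A = B ∨ s < (A ∩ B).card).card < R.card := by
      refine lt_of_le_of_lt (Finset.card_biUnion_le_card_mul _ _ _ hblock) ?_
      rw [hPc]; nlinarith
    obtain ⟨A, hAR, hA⟩ := Finset.exists_mem_notMem_of_card_lt_card hlt
    have hA' : ∀ B ∈ P, ¬ (A = B ∨ s < (A ∩ B).card) := by
      intro B hB h
      exact hA (Finset.mem_biUnion.2 ⟨B, hB, Finset.mem_filter.2 ⟨hAR, h⟩⟩)
    refine ⟨insert A P, Finset.insert_subset hAR hPR, ?_, hP.insert fun B hB _ => ?_⟩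
    · rw [Finset.card_insert_of_notMem fun h => hA' A h (Or.inl rfl), hPc]
    · exact not_lt.1 fun h => hA' B hB (Or.inr h)

/-- If more than `r * k` times as many members of `R` contain `Q` as can contain a larger set, then
some member of `R` containing `Q` meets `k` given sets only inside `Q`. -/
theorem exists_avoiding {R P : Finset (Finset V)} {Q : Finset V} {r D : ℕ}
    (hP : ∀ B ∈ P, B.card ≤ r) (hdeg : ∀ x ∉ Q, deg R (insert x Q) ≤ D)
    (h : P.card * r * D < deg R Q) : ∃ A ∈ R, Q ⊆ A ∧ ∀ B ∈ P, A ∩ B ⊆ Q := by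
  by_contra! hcon
  -- If every member above `Q` met some `B` outside `Q`, it would contain `Q` and one of at most
  -- `P.card * r` further points, each of which accounts for at most `D` members.
  have hsub : R.filter (Q ⊆ ·) ⊆
      ((P.biUnion id) \ Q).biUnion fun x => R.filter (insert x Q ⊆ ·) := by
    intro A hA
    rw [Finset.mem_filter] at hA
    obtain ⟨B, hB, hAB⟩ := hcon A hA.1 hA.2
    obtain ⟨x, hx, hxQ⟩ := Finset.not_subset.1 hAB
    rw [Finset.mem_inter] at hx
    rw [Finset.mem_biUnion]
    refine ⟨x, ?_, Finset.mem_filter.2 ⟨hA.1, Finset.insert_subset hx.1 hA.2⟩⟩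
    rw [Finset.mem_sdiff, Finset.mem_biUnion]
    exact ⟨⟨B, hB, hx.2⟩, hxQ⟩
  have h1 := (Finset.card_le_card hsub).trans (Finset.card_biUnion_le_card_mul _ _ D fun x hx =>
    hdeg x (Finset.mem_sdiff.1 hx).2)
  have h2 : ((P.biUnion id) \ Q).card ≤ P.card * r :=
    (Finset.card_le_card Finset.sdiff_subset).trans (Finset.card_biUnion_le_card_mul _ _ r hP)
  have := h1.trans (Nat.mul_le_mul_right D h2)
  unfold deg at h
  omega

/-- A maximal subfamily with bounded degrees, together with the sets that almost lie in one of its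
members, contains a packing as large as any. -/
theorem exists_overlap_near {S R : Finset (Finset V)} {r s k : ℕ} (hsr : s + 2 ≤ r) (hk : 1 ≤ k)
    (hRS : R ⊆ S) (hS : ∀ A ∈ S, A.card ≤ r)
    (hdeg : ∀ Q, deg R Q ≤ threshold r s k Q.card)
    (hmax : ∀ A ∈ S, A ∉ R → ∃ Q ⊆ A, threshold r s k Q.card ≤ deg R Q)
    {P : Finset (Finset V)} (hPS : P ⊆ S) (hPk : P.card = k) (hP : Overlap s P) :
    ∃ P' ⊆ S, P'.card = k ∧ Overlap s P' ∧
      ∀ A ∈ P', A ∈ R ∨ ∃ B ∈ R, r - 1 ≤ (A ∩ B).card := by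
  classical
  have hrk : 1 ≤ r * k := Nat.mul_pos (by omega) hk
  -- Induction on the number of members that are neither in `R` nor near it; every exchange lowers
  -- it.
  induction hb : (P.filter fun A => ¬ (A ∈ R ∨ ∃ B ∈ R, r - 1 ≤ (A ∩ B).card)).card
    using Nat.strong_induction_on generalizing P with
  | _ b ih =>
  by_cases hall : ∀ A ∈ P, A ∈ R ∨ ∃ B ∈ R, r - 1 ≤ (A ∩ B).card
  · exact ⟨P, hPS, hPk, hP, hall⟩
  push Not at hall
  obtain ⟨A, hAP, hAR, hAE⟩ := hall
  obtain ⟨Q, hQA, hQ⟩ := hmax A (hPS hAP) hAR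
  rcases le_or_gt Q.card s with hQs | hQs
  · rw [threshold, if_pos hQs] at hQ
    -- The threshold for at most s elements is exactly k r^(s+1) times the threshold for s + 1
    -- elements, as the greedy argument requires.
    have hle : k * (r ^ (s + 1) * (r * k) ^ (r - 1 - (s + 1))) ≤ R.card := by
      refine le_trans (le_of_eq ?_) (hQ.trans (Finset.card_filter_le _ _))
      rw [show r - s - 1 = (r - 1 - (s + 1)) + 1 by omega]
      ring
    obtain ⟨P', hP', hc, ho⟩ := exists_overlap_of_le_card (by omega) (Nat.pow_pos hrk)
      (fun A hA => hS A (hRS hA))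
      (fun Q hQ => by simpa [threshold, hQ] using hdeg Q) k hle
    exact ⟨P', hP'.trans hRS, hc, ho, fun A hA => Or.inl (hP' hA)⟩
  rw [threshold, if_neg (by omega)] at hQ
  -- From r - 1 elements on the threshold is 1, so some member of `R` contains `Q`, and `A` would be
  -- near.
  rcases le_or_gt (r - 1) Q.card with hQr | hQr
  · have : 0 < deg R Q := lt_of_lt_of_le (Nat.pow_pos hrk) hQ
    obtain ⟨B, hB⟩ := Finset.card_pos.1 this
    rw [Finset.mem_filter] at hB
    have := Finset.card_le_card (Finset.subset_inter hQA hB.2)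
    have := hAE B hB.1
    omega
  -- The threshold drops by the factor rk with each additional element, while the k - 1 other
  -- members of the packing occupy at most r(k - 1) points.
  obtain ⟨A', hA'R, hQA', hA'⟩ := exists_avoiding (R := R) (P := P.erase A) (Q := Q) (r := r)
    (D := (r * k) ^ (r - 1 - (Q.card + 1)))
    (fun B hB => hS B (hPS (Finset.mem_of_mem_erase hB)))
    (fun x hx => by
      have := hdeg (insert x Q)
      rwa [threshold, Finset.card_insert_of_notMem hx, if_neg (by omega)] at this)
    (by
      refine lt_of_lt_of_le ?_ hQ
      rw [Finset.card_erase_of_mem hAP, hPk,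
        show r - 1 - Q.card = (r - 1 - (Q.card + 1)) + 1 by omega, pow_succ]
      generalize hX : (r * k) ^ (r - 1 - (Q.card + 1)) = X
      have hX' : 1 ≤ X := hX ▸ Nat.pow_pos hrk
      obtain ⟨k, rfl⟩ := Nat.exists_eq_add_of_le' hk
      have : 0 < r * X := Nat.mul_pos (by omega) hX'
      simp only [Nat.add_sub_cancel]
      nlinarith)
  have hint : ∀ B ∈ P.erase A, (A' ∩ B).card ≤ s := by
    intro B hB
    have hB' := Finset.mem_erase.1 hB
    refine le_trans (Finset.card_le_card ?_) (hP A hAP B hB'.2 hB'.1.symm)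
    intro x hx
    exact Finset.mem_inter.2 ⟨hQA (hA' B hB hx), (Finset.mem_inter.1 hx).2⟩
  -- Otherwise `A'` would share all its elements with itself, and it has at least |Q| > s of them.
  have hnot : A' ∉ P.erase A := by
    intro h
    have h1 := hint A' h
    rw [Finset.inter_self] at h1
    have := Finset.card_le_card hQA'
    omega
  refine ih _ ?_ (P := insert A' (P.erase A)) ?_ ?_ ?_ rfl
  · rw [← hb]
    refine Finset.card_lt_card (Finset.ssubset_iff_of_subset ?_ |>.2 ⟨A, ?_, ?_⟩)
    · intro B hB
      rw [Finset.mem_filter, Finset.mem_insert] at hB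
      rcases hB.1 with rfl | h
      · exact absurd (Or.inl hA'R) hB.2
      · exact Finset.mem_filter.2 ⟨Finset.mem_of_mem_erase h, hB.2⟩
    · refine Finset.mem_filter.2 ⟨hAP, ?_⟩
      push Not
      exact ⟨hAR, hAE⟩
    · intro h
      rcases Finset.mem_insert.1 (Finset.mem_filter.1 h).1 with h | h
      · exact hAR (h ▸ hA'R)
      · exact (Finset.mem_erase.1 h).1 rfl
  · exact Finset.insert_subset (hRS hA'R) ((Finset.erase_subset _ _).trans hPS)
  · rw [Finset.card_insert_of_notMem hnot, Finset.card_erase_of_mem hAP, hPk]; omega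
  · exact (hP.mono (Finset.erase_subset _ _)).insert fun B hB _ => hint B hB

/-- The crown replacement: if `T` is a set of `(r-1)`-sets matched by `g` to vertices outside `cov`
such that every vertex whose neighbours are not all in `T` is kept, then any packing whose members
have at most one vertex outside `cov` can be moved into the kept vertices. -/
theorem exists_overlap_kept {S R : Finset (Finset V)} {cov kept : Finset V} {r s k : ℕ}
    (hsr : s + 2 ≤ r) (hS : ∀ A ∈ S, A.card ≤ r) (hcov : ∀ B ∈ R, B ⊆ cov)
    {bip : V → Finset V → Prop}
    (hbip : ∀ o Q, bip o Q ↔ o ∉ cov ∧ Q.card = r - 1 ∧ (∃ B ∈ R, Q ⊆ B) ∧ insert o Q ∈ S)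
    {T : Finset V → Prop} {g : Finset V → V}
    (hg : ∀ Q, T Q → bip (g Q) Q) (hgk : ∀ Q, T Q → g Q ∈ kept)
    (hginj : ∀ Q Q', T Q → T Q' → g Q = g Q' → Q = Q')
    (hT : ∀ Q Q', T Q → bip (g Q) Q' → T Q')
    (hout : ∀ o Q, o ∉ kept → bip o Q → T Q)
    {P : Finset (Finset V)} (hPS : P ⊆ S) (hPk : P.card = k) (hP : Overlap s P)
    (hnear : ∀ A ∈ P, A ∈ R ∨ ∃ B ∈ R, r - 1 ≤ (A ∩ B).card) :
    ∃ P' ⊆ S, P'.card = k ∧ Overlap s P' ∧ ∀ A ∈ P', A ⊆ cov ∪ kept := by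
  classical
  let φ : Finset V → Finset V := fun A =>
    if ¬ A ⊆ cov ∧ T (A ∩ cov) then insert (g (A ∩ cov)) (A ∩ cov) else A
  -- A member that leaves `cov` shares r - 1 of its at most r elements with a set inside `cov`, so
  -- exactly one vertex lies outside.
  have hst : ∀ A ∈ P, ∀ o ∈ A, o ∉ cov → bip o (A ∩ cov) ∧ A = insert o (A ∩ cov) := by
    intro A hA o ho hoc
    rcases hnear A hA with h | ⟨B, hB, hAB⟩
    · exact absurd (hcov A h ho) hoc
    have h1 : A ∩ B ⊆ A ∩ cov := Finset.inter_subset_inter_left (hcov B hB)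
    have h2 : A ∩ cov ⊆ A.erase o := fun x hx => by
      rw [Finset.mem_inter] at hx
      exact Finset.mem_erase.2 ⟨fun h => hoc (h ▸ hx.2), hx.1⟩
    have h3 : (A.erase o).card ≤ r - 1 := by
      rw [Finset.card_erase_of_mem ho]; have := hS A (hPS hA); omega
    have e1 : A ∩ B = A.erase o := Finset.eq_of_subset_of_card_le (h1.trans h2) (h3.trans hAB)
    have e2 : A ∩ cov = A.erase o := h2.antisymm (e1 ▸ h1)
    have e3 : A = insert o (A ∩ cov) := by rw [e2, Finset.insert_erase ho]
    refine ⟨(hbip _ _).2 ⟨hoc, ?_, ⟨B, hB, ?_⟩, ?_⟩, e3⟩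
    · rw [e2]; rw [e1] at hAB; omega
    · rw [e2, ← e1]; exact Finset.inter_subset_right
    · rw [← e3]; exact hPS hA
  have hrep : ∀ A, ¬ A ⊆ cov ∧ T (A ∩ cov) → φ A = insert (g (A ∩ cov)) (A ∩ cov) :=
    fun A h => if_pos h
  have hnrep : ∀ A, ¬ (¬ A ⊆ cov ∧ T (A ∩ cov)) → φ A = A := fun A h => if_neg h
  have hgcov : ∀ Q, T Q → g Q ∉ cov := fun Q hQ => ((hbip _ _).1 (hg Q hQ)).1
  have hcardφ : ∀ A ∈ P, (φ A).card = A.card := by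
    intro A hA
    by_cases h : ¬ A ⊆ cov ∧ T (A ∩ cov)
    · obtain ⟨o, ho, hoc⟩ := Finset.not_subset.1 h.1
      rw [hrep A h, Finset.card_insert_of_notMem fun h' =>
        hgcov _ h.2 (Finset.mem_inter.1 h').2]
      conv_rhs => rw [(hst A hA o ho hoc).2]
      rw [Finset.card_insert_of_notMem fun h' => hoc (Finset.mem_inter.1 h').2]
    · rw [hnrep A h]
  -- The new vertex of a moved member cannot lie in an unmoved one: every neighbour of this vertex
  -- is in `T`, so that member would have been moved too.
  have hmix : ∀ A ∈ P, ∀ B ∈ P, (¬ A ⊆ cov ∧ T (A ∩ cov)) → ¬ (¬ B ⊆ cov ∧ T (B ∩ cov)) →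
      φ A ∩ φ B ⊆ A ∩ B := by
    intro A hA B hB h h'
    rw [hrep A h, hnrep B h']
    intro x hx
    rw [Finset.mem_inter, Finset.mem_insert] at hx
    rcases hx.1 with rfl | hxA
    · have hxc := hgcov _ h.2
      exact absurd ⟨fun hs => hxc (hs hx.2), hT _ _ h.2 (hst B hB _ hx.2 hxc).1⟩ h'
    · exact Finset.mem_inter.2 ⟨(Finset.mem_inter.1 hxA).1, hx.2⟩
  have hint : ∀ A ∈ P, ∀ B ∈ P, A ≠ B → φ A ∩ φ B ⊆ A ∩ B := by
    intro A hA B hB hne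
    by_cases h : ¬ A ⊆ cov ∧ T (A ∩ cov) <;> by_cases h' : ¬ B ⊆ cov ∧ T (B ∩ cov)
    -- Two members over the same (r-1)-set would share more than s elements; hence the new vertices
    -- are distinct.
    · have hQ : A ∩ cov ≠ B ∩ cov := by
        intro he
        have h1 := ((hbip _ _).1 (hg _ h.2)).2.1
        have h2 : A ∩ cov ⊆ A ∩ B := Finset.subset_inter Finset.inter_subset_left
          (he ▸ Finset.inter_subset_left)
        have := Finset.card_le_card h2
        have := hP A hA B hB hne
        omega
      rw [hrep A h, hrep B h']
      intro x hx
      rw [Finset.mem_inter, Finset.mem_insert, Finset.mem_insert] at hx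
      rcases hx with ⟨rfl | hxA, hxB | hxB⟩
      · exact absurd (hginj _ _ h.2 h'.2 hxB) hQ
      · exact absurd (Finset.mem_inter.1 hxB).2 (hgcov _ h.2)
      · exact absurd (Finset.mem_inter.1 hxA).2 (hxB ▸ hgcov _ h'.2)
      · exact Finset.mem_inter.2 ⟨(Finset.mem_inter.1 hxA).1, (Finset.mem_inter.1 hxB).1⟩
    · exact hmix A hA B hB h h'
    · rw [Finset.inter_comm, Finset.inter_comm A]
      exact hmix B hB A hA h' h
    · rw [hnrep A h, hnrep B h']
  -- If distinct members had the same image, their intersection would be as large as each of them,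
  -- because `φ` preserves cardinalities and creates no common elements.
  have hinj : Set.InjOn φ P := by
    intro A hA B hB he
    by_contra hne
    have h1 := hint A hA B hB hne
    rw [he, Finset.inter_self] at h1
    have h2 := Finset.card_le_card h1
    rw [hcardφ B hB] at h2
    have h3 : A ∩ B = B := Finset.eq_of_subset_of_card_le Finset.inter_subset_right h2
    rw [← hcardφ B hB, ← he, hcardφ A hA] at h2
    have h4 : A ∩ B = A := Finset.eq_of_subset_of_card_le Finset.inter_subset_left h2
    exact hne (h4.symm.trans h3)
  refine ⟨P.image φ, ?_, by rw [Finset.card_image_of_injOn hinj, hPk], ?_, ?_⟩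
  · intro A' hA'
    obtain ⟨A, hA, rfl⟩ := Finset.mem_image.1 hA'
    by_cases h : ¬ A ⊆ cov ∧ T (A ∩ cov)
    · rw [hrep A h]; exact ((hbip _ _).1 (hg _ h.2)).2.2.2
    · rw [hnrep A h]; exact hPS hA
  · intro A' hA' B' hB' hne
    obtain ⟨A, hA, rfl⟩ := Finset.mem_image.1 hA'
    obtain ⟨B, hB, rfl⟩ := Finset.mem_image.1 hB'
    have hAB : A ≠ B := fun h => hne (h ▸ rfl)
    exact (Finset.card_le_card (hint A hA B hB hAB)).trans (hP A hA B hB hAB)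
  · intro A' hA'
    obtain ⟨A, hA, rfl⟩ := Finset.mem_image.1 hA'
    by_cases h : ¬ A ⊆ cov ∧ T (A ∩ cov)
    · rw [hrep A h]
      refine Finset.insert_subset (Finset.mem_union_right _ (hgk _ h.2)) ?_
      exact Finset.inter_subset_right.trans Finset.subset_union_left
    · rw [hnrep A h]
      intro x hx
      by_cases hxc : x ∈ cov
      · exact Finset.mem_union_left _ hxc
      -- An unmoved member that leaves `cov` does so at a kept vertex, since discarded vertices see
      -- only sets in `T`.
      · refine Finset.mem_union_right _ (by_contra fun hk => h ⟨fun hs => hxc (hs hx), ?_⟩)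
        exact hout x _ hk (hst A hA x hx hxc).1

/-- The number of `(r-1)`-subsets of members of `R` is at most `r * |R|`. -/
theorem card_subsets_le {R J : Finset (Finset V)} {r : ℕ} (hr : 1 ≤ r) (hR : ∀ A ∈ R, A.card ≤ r)
    (hJ : ∀ Q ∈ J, Q.card = r - 1 ∧ ∃ B ∈ R, Q ⊆ B) : J.card ≤ R.card * r := by
  have hsub : J ⊆ R.biUnion fun B => B.powersetCard (r - 1) := by
    intro Q hQ
    obtain ⟨hc, B, hB, hQB⟩ := hJ Q hQ
    exact Finset.mem_biUnion.2 ⟨B, hB, Finset.mem_powersetCard.2 ⟨hQB, hc⟩⟩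
  refine (Finset.card_le_card hsub).trans (Finset.card_biUnion_le_card_mul _ _ r fun B hB => ?_)
  rw [Finset.card_powersetCard]
  refine (Nat.choose_le_choose (r - 1) (hR B hB)).trans (le_of_eq ?_)
  obtain ⟨r, rfl⟩ := Nat.exists_eq_add_of_le' hr
  simp

end SetPacking

/-! ### The auction method for bipartite matchings -/

namespace Auction

/-- The state of an auction: item `j` has price `p j` and is owned by bidder `o` if
`w j = o + 1`, by nobody if `w j = 0`. -/
structure Valid (bip : ℕ → ℕ → Prop) (cap : ℕ) (p w : ℕ → ℕ) : Prop where
  bip_of_owner : ∀ j o, w j = o + 1 → bip o j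
  owner_inj : ∀ j j' o, w j = o + 1 → w j' = o + 1 → j = j'
  owned : ∀ j, 0 < p j → w j ≠ 0
  cheap : ∀ j j' o, w j = o + 1 → bip o j' → p j ≤ p j' + 1
  le_cap : ∀ j, p j ≤ cap

/-- Bidder `o` owns nothing, and `j` is a cheapest item for `o`. -/
def CanBid (bip : ℕ → ℕ → Prop) (cap : ℕ) (p w : ℕ → ℕ) (o j : ℕ) : Prop :=
  bip o j ∧ (∀ j', w j' ≠ o + 1) ∧ p j < cap ∧ ∀ j', bip o j' → p j ≤ p j'

variable {bip : ℕ → ℕ → Prop} {cap : ℕ} {p w : ℕ → ℕ}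

theorem Valid.zero (bip : ℕ → ℕ → Prop) (cap : ℕ) : Valid bip cap (fun _ => 0) (fun _ => 0) := by
  constructor <;> simp

/-- Prices only rise, so the almost-cheapest condition survives for the other owners. It holds for
the new one because it chose a cheapest item and raised its price by one. A former owner of the item
simply becomes free. -/
theorem Valid.bid (h : Valid bip cap p w) {o j : ℕ} (hb : CanBid bip cap p w o j) :
    Valid bip cap (Function.update p j (p j + 1)) (Function.update w j (o + 1)) := by
  obtain ⟨hoj, hfree, hlt, hmin⟩ := hb
  have hmono : ∀ j', p j' ≤ Function.update p j (p j + 1) j' := by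
    intro j'
    by_cases hj : j' = j
    · subst hj; simp
    · simp [hj]
  constructor
  · intro i o' hi
    by_cases hj : i = j
    · subst hj; simp at hi; exact hi ▸ hoj
    · rw [Function.update_of_ne hj] at hi; exact h.bip_of_owner i o' hi
  · intro i i' o' hi hi'
    by_cases hj : i = j <;> by_cases hj' : i' = j
    · rw [hj, hj']
    · subst hj
      rw [Function.update_of_ne hj'] at hi'
      simp at hi
      exact absurd (hi ▸ hi') (hfree i')
    · subst hj'
      rw [Function.update_of_ne hj] at hi
      simp at hi'
      exact absurd (hi' ▸ hi) (hfree i)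
    · rw [Function.update_of_ne hj] at hi
      rw [Function.update_of_ne hj'] at hi'
      exact h.owner_inj i i' o' hi hi'
  · intro i hi
    by_cases hj : i = j
    · subst hj; simp
    · rw [Function.update_of_ne hj] at hi ⊢; exact h.owned i hi
  · intro i i' o' hi hb
    refine le_trans ?_ (Nat.add_le_add_right (hmono i') 1)
    by_cases hj : i = j
    · subst hj
      simp at hi ⊢
      exact hmin i' (hi ▸ hb)
    · rw [Function.update_of_ne hj] at hi ⊢; exact h.cheap i i' o' hi hb
  · intro i
    by_cases hj : i = j
    · subst hj; simpa using hlt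
    · rw [Function.update_of_ne hj]; exact h.le_cap i

/-- When nobody can bid, the items above a price level which no item has form the head of a
crown. -/
theorem Valid.exists_level (h : Valid bip cap p w) {m : ℕ} (hm : m < cap)
    (hbip : ∀ o j, bip o j → j < m) (hend : ∀ o j, ¬ CanBid bip cap p w o j) :
    ∃ l, (∀ j, l < p j → w j ≠ 0) ∧ (∀ j o j', l < p j → w j = o + 1 → bip o j' → l < p j') ∧
      ∀ o j, (∀ j', w j' ≠ o + 1) → bip o j → l < p j := by
  -- Pigeonhole: m items cannot take all of the more than m prices below `cap`.
  obtain ⟨l, hl, hgap⟩ : ∃ l < cap, ∀ j < m, p j ≠ l := by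
    by_contra! hcon
    have : Finset.range cap ⊆ (Finset.range m).image p := by
      intro l hl
      obtain ⟨j, hj, hjl⟩ := hcon l (Finset.mem_range.1 hl)
      exact Finset.mem_image.2 ⟨j, Finset.mem_range.2 hj, hjl⟩
    have := (Finset.card_le_card this).trans Finset.card_image_le
    simp at this
    omega
  -- An owner of an item priced above `l` sees only prices at least `l`, hence above `l` because of
  -- the gap. A free bidder that sees a price at most `l` could bid on its cheapest item.
  refine ⟨l, fun j hj => h.owned j (by omega), fun j o j' hj hw hb => ?_, fun o j hfree hb => ?_⟩
  · have := h.cheap j j' o hw hb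
    have := hgap j' (hbip o j' hb)
    omega
  · by_contra hlt
    obtain ⟨j₀, hj₀, hmin⟩ : ∃ j₀, bip o j₀ ∧ ∀ j', bip o j' → p j₀ ≤ p j' := by
      have hne : ∃ v j, bip o j ∧ p j = v := ⟨_, j, hb, rfl⟩
      classical
      obtain ⟨j₀, hj₀, hv⟩ := Nat.find_spec hne
      exact ⟨j₀, hj₀, fun j' hj' => hv ▸ Nat.find_min' hne ⟨j', hj', rfl⟩⟩
    have := hmin j hb
    exact hend o j₀ ⟨hj₀, hfree, by omega, hmin⟩

end Auction

/-! ### Cliques as vertex sets -/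

/-- Replaces isomorphism with some complete graph by a finite vertex set that is pairwise adjacent
in the subgraph. -/
theorem isFamilySubgraph_cliqueFamily {V : Type*} {G : SimpleGraph V} {a r : ℕ} {H : G.Subgraph} :
    IsFamilySubgraph (cliqueFamily a r) H ↔ ∃ c : Finset V, H.verts = c ∧ a ≤ c.card ∧
      c.card ≤ r ∧ ∀ x ∈ c, ∀ y ∈ c, x ≠ y → H.Adj x y := by
  classical
  constructor
  · rintro ⟨F, ⟨s, hs, hs', rfl⟩, ⟨e⟩⟩
    have : Finite H.verts := Finite.of_equiv _ e.toEquiv.symm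
    have hfin : H.verts.Finite := this
    refine ⟨hfin.toFinset, by simp, ?_⟩
    have hc : hfin.toFinset.card = s := by
      rw [← Set.ncard_eq_toFinset_card _ hfin, ← Nat.card_coe_set_eq, Nat.card_congr e.toEquiv]
      simp
    refine ⟨hc ▸ hs, hc ▸ hs', fun x hx y hy hxy => ?_⟩
    have hx' : x ∈ H.verts := by simpa using hx
    have hy' : y ∈ H.verts := by simpa using hy
    have h := e.map_rel_iff (a := ⟨x, hx'⟩) (b := ⟨y, hy'⟩)
    have h2 : H.coe.Adj ⟨x, hx'⟩ ⟨y, hy'⟩ := h.1 (by simpa using hxy)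
    simpa using h2
  · rintro ⟨c, hv, ha, hr, hadj⟩
    refine ⟨_, ⟨c.card, ha, hr, rfl⟩, ?_⟩
    have e1 : H.verts ≃ Fin c.card := (Equiv.setCongr hv).trans c.equivFin
    refine ⟨⟨e1, ?_⟩⟩
    intro x y
    simp only [SimpleGraph.top_adj, ne_eq, EmbeddingLike.apply_eq_iff_eq, SimpleGraph.Subgraph.coe_adj]
    constructor
    · intro hne
      have hx : (x : V) ∈ c := Finset.mem_coe.1 (hv.subset x.2)
      have hy : (y : V) ∈ c := Finset.mem_coe.1 (hv.subset y.2)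
      exact hadj x hx y hy fun h => hne (Subtype.ext h)
    · rintro h rfl
      exact H.loopless.irrefl _ h

theorem ncard_edgeSet_inter {V : Type*} {G : SimpleGraph V} {H H' : G.Subgraph} {c c' : Finset V}
    (hv : H.verts = c) (hv' : H'.verts = c') (ha : ∀ x ∈ c, ∀ y ∈ c, x ≠ y → H.Adj x y)
    (ha' : ∀ x ∈ c', ∀ y ∈ c', x ≠ y → H'.Adj x y) :
    (H.edgeSet ∩ H'.edgeSet).ncard = (H.verts ∩ H'.verts).ncard.choose 2 := by
  classical
  have hset : H.verts ∩ H'.verts = ((c ∩ c' : Finset V) : Set V) := by rw [hv, hv']; simp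
  -- The pairs of distinct common vertices are counted as the image of the off-diagonal in `Sym2`.
  rw [hset, Set.ncard_coe_finset, ← Sym2.card_image_offDiag, ← Set.ncard_coe_finset]
  congr 1
  ext e
  induction e using Sym2.ind with
  | _ x y =>
  simp only [Set.mem_inter_iff, SimpleGraph.Subgraph.mem_edgeSet, Finset.coe_image, Set.mem_image,
    Finset.mem_coe, Finset.mem_offDiag, Finset.mem_inter]
  constructor
  · rintro ⟨h, h'⟩
    have m1 := H.edge_vert h
    have m2 := H.edge_vert h.symm
    have m3 := H'.edge_vert h'
    have m4 := H'.edge_vert h'.symm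
    rw [hv, Finset.mem_coe] at m1 m2
    rw [hv', Finset.mem_coe] at m3 m4
    exact ⟨(x, y), ⟨⟨m1, m3⟩, ⟨m2, m4⟩, h.ne⟩, rfl⟩
  · rintro ⟨⟨u, v⟩, ⟨⟨h1, h2⟩, ⟨h3, h4⟩, hne⟩, he⟩
    rcases Sym2.eq_iff.1 he with ⟨rfl, rfl⟩ | ⟨rfl, rfl⟩
    · exact ⟨ha _ h1 _ h3 hne, ha' _ h2 _ h4 hne⟩
    · exact ⟨(ha _ h1 _ h3 hne).symm, (ha' _ h2 _ h4 hne).symm⟩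

theorem choose_two_le_iff {t t' : ℕ} (ht : IsGreatest {s : ℕ | s * (s - 1) / 2 ≤ t} t') (s : ℕ) :
    s.choose 2 ≤ t ↔ s ≤ t' := by
  constructor
  · intro h
    exact ht.2 (by simpa [Nat.choose_two_right] using h)
  · intro h
    refine (Nat.choose_le_choose 2 h).trans ?_
    rw [Nat.choose_two_right]
    exact ht.1

theorem isEdgePacking_iff_isVertexPacking {r t t' : ℕ}
    (ht : IsGreatest {s : ℕ | s * (s - 1) / 2 ≤ t} t') {V : Type*} (G : SimpleGraph V) (k : ℕ)
    (K : Finset G.Subgraph) : IsEdgePacking (cliqueFamily (t + 1) r) k t K ↔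
      IsVertexPacking (cliqueFamily (t + 1) r) k t' K := by
  unfold IsEdgePacking IsVertexPacking
  refine and_congr_right fun _ => and_congr_right fun hK => forall₂_congr fun H hH =>
    forall₂_congr fun H' hH' => imp_congr_right fun _ => ?_
  obtain ⟨c, hv, _, _, ha⟩ := isFamilySubgraph_cliqueFamily.1 (hK H hH)
  obtain ⟨c', hv', _, _, ha'⟩ := isFamilySubgraph_cliqueFamily.1 (hK H' hH')
  rw [ncard_edgeSet_inter hv hv' ha ha', choose_two_le_iff ht]

open Classical in
/-- The vertex sets of the cliques in `W` with at least `a` and at most `r` vertices. -/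
noncomputable def cliqueSets (H : SimpleGraph ℕ) (a r : ℕ) (W : Finset ℕ) : Finset (Finset ℕ) :=
  W.powerset.filter fun A => H.IsClique A ∧ a ≤ A.card ∧ A.card ≤ r

theorem mem_cliqueSets {H : SimpleGraph ℕ} {a r : ℕ} {W A : Finset ℕ} :
    A ∈ cliqueSets H a r W ↔ A ⊆ W ∧ H.IsClique A ∧ a ≤ A.card ∧ A.card ≤ r := by
  simp [cliqueSets]

/-- `S` contains `k` many sets any two of which share at most `s` elements. -/
def HasPacking (S : Finset (Finset ℕ)) (s k : ℕ) : Prop :=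
  ∃ P ⊆ S, P.card = k ∧ SetPacking.Overlap s P

/-- All graphs are placed on the natural numbers, so that input and kernel become two vertex sets of
a single graph `H`. A clique subgraph is determined by its vertex set, in one direction by
completeness and in the other as an induced subgraph. -/
theorem cliqueEdgeOverlapProblem_iff {r t t' : ℕ}
    (ht : IsGreatest {s : ℕ | s * (s - 1) / 2 ≤ t} t') {H : SimpleGraph ℕ} {n : ℕ}
    (f : Fin n ↪ ℕ) (k : ℕ) : cliqueEdgeOverlapProblem r t n (H.comap f) k ↔
      HasPacking (cliqueSets H (t + 1) r (Finset.univ.map f)) t' k := by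
  classical
  unfold cliqueEdgeOverlapProblem HasPacking
  simp only [isEdgePacking_iff_isVertexPacking ht]
  constructor
  · rintro ⟨K, hk, hK, ho⟩
    let φ : (H.comap f).Subgraph → Finset ℕ := fun X => X.verts.toFinset.map f
    have hinj : Set.InjOn φ K := by
      intro X hX Y hY he
      have hverts : X.verts = Y.verts := by
        have := Finset.map_injective f he
        simpa using this
      obtain ⟨c, hv, _, _, ha⟩ := isFamilySubgraph_cliqueFamily.1 (hK X hX)
      obtain ⟨c', hv', _, _, ha'⟩ := isFamilySubgraph_cliqueFamily.1 (hK Y hY)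
      have hcc : c = c' := by
        rw [hv, hv'] at hverts; exact_mod_cast hverts
      subst hcc
      refine SimpleGraph.Subgraph.ext hverts ?_
      funext x y
      refine propext ⟨fun h => ?_, fun h => ?_⟩
      · have m1 := X.edge_vert h
        have m2 := X.edge_vert h.symm
        rw [hv, Finset.mem_coe] at m1 m2
        exact ha' x m1 y m2 h.ne
      · have m1 := Y.edge_vert h
        have m2 := Y.edge_vert h.symm
        rw [hv', Finset.mem_coe] at m1 m2
        exact ha x m1 y m2 h.ne
    refine ⟨K.image φ, ?_, by rw [Finset.card_image_of_injOn hinj, hk], ?_⟩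
    · intro A hA
      obtain ⟨X, hX, rfl⟩ := Finset.mem_image.1 hA
      obtain ⟨c, hv, h1, h2, ha⟩ := isFamilySubgraph_cliqueFamily.1 (hK X hX)
      have hφ : φ X = c.map f := by simp [φ, hv]
      rw [mem_cliqueSets, hφ, Finset.card_map]
      refine ⟨Finset.map_subset_map.2 (Finset.subset_univ _), ?_, h1, h2⟩
      intro x hx y hy hne
      simp only [Finset.coe_map, Set.mem_image, Finset.mem_coe] at hx hy
      obtain ⟨x, hx, rfl⟩ := hx
      obtain ⟨y, hy, rfl⟩ := hy
      exact X.adj_sub (ha x hx y hy fun h => hne (h ▸ rfl))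
    · intro A hA B hB hne
      obtain ⟨X, hX, rfl⟩ := Finset.mem_image.1 hA
      obtain ⟨Y, hY, rfl⟩ := Finset.mem_image.1 hB
      rw [← Finset.map_inter, Finset.card_map, ← Set.ncard_coe_finset]
      simpa using ho X hX Y hY fun h => hne (h ▸ rfl)
  · rintro ⟨P, hP, hk, ho⟩
    let ψ : Finset ℕ → (H.comap f).Subgraph := fun A =>
      (⊤ : (H.comap f).Subgraph).induce (f ⁻¹' (A : Set ℕ))
    have hrange : ∀ A ∈ P, (A : Set ℕ) ⊆ Set.range f := by
      intro A hA x hx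
      have := (mem_cliqueSets.1 (hP hA)).1 hx
      simpa using this
    have hinj : Set.InjOn ψ P := by
      intro A hA B hB he
      have hverts : f ⁻¹' (A : Set ℕ) = f ⁻¹' (B : Set ℕ) :=
        congrArg SimpleGraph.Subgraph.verts he
      have := congrArg (fun s => f '' s) hverts
      simp only [Set.image_preimage_eq_of_subset (hrange A hA),
        Set.image_preimage_eq_of_subset (hrange B hB)] at this
      exact_mod_cast this
    refine ⟨P.image ψ, by rw [Finset.card_image_of_injOn hinj, hk], ?_, ?_⟩
    · intro X hX
      obtain ⟨A, hA, rfl⟩ := Finset.mem_image.1 hX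
      obtain ⟨hAW, hcl, h1, h2⟩ := mem_cliqueSets.1 (hP hA)
      obtain ⟨c, -, rfl⟩ := Finset.subset_map_iff.1 hAW
      have hverts : f ⁻¹' ((c.map f : Finset ℕ) : Set ℕ) = c := by
        rw [Finset.coe_map, Set.preimage_image_eq _ f.injective]
      rw [Finset.card_map] at h1 h2
      refine isFamilySubgraph_cliqueFamily.2 ⟨c, hverts, h1, h2, fun x hx y hy hne => ?_⟩
      simp only [ψ, hverts, SimpleGraph.Subgraph.induce_adj, SimpleGraph.Subgraph.top_adj,
        SimpleGraph.comap_adj, Finset.mem_coe]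
      exact ⟨hx, hy, hcl (by simpa using hx) (by simpa using hy) fun h => hne (f.injective h)⟩
    · intro X hX Y hY hne
      obtain ⟨A, hA, rfl⟩ := Finset.mem_image.1 hX
      obtain ⟨B, hB, rfl⟩ := Finset.mem_image.1 hY
      have h := ho A hA B hB fun h => hne (h ▸ rfl)
      have h3 : (ψ A).verts ∩ (ψ B).verts = f ⁻¹' ((A ∩ B : Finset ℕ) : Set ℕ) := by
        simp [ψ]
      rw [h3, Set.ncard_preimage_of_injective_subset_range f.injective, Set.ncard_coe_finset]
      · exact h
      · exact (by simpa using Set.inter_subset_left.trans (hrange A hA))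

namespace RAM

/-! ### Conditions and loops in the loop language -/

namespace HExpr

/-- The value of `e`, read as a truth value. -/
def Holds (e : HExpr) (σ : State) : Prop := e.eval σ ≠ 0

instance (e : HExpr) (σ : State) : Decidable (e.Holds σ) :=
  inferInstanceAs (Decidable (e.eval σ ≠ 0))

/-- `a < b` -/
def lt (a b : HExpr) : HExpr := sub b a

/-- `a ≤ b` -/
def le (a b : HExpr) : HExpr := ite (sub a b) (const 0) (const 1)

/-- `a = b` -/
def eq (a b : HExpr) : HExpr := ite (add (sub a b) (sub b a)) (const 0) (const 1)

/-- Conjunction. -/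
def and (a b : HExpr) : HExpr := ite a b (const 0)

/-- Disjunction. -/
def or (a b : HExpr) : HExpr := ite a (const 1) b

/-- Implication. -/
def imp (a b : HExpr) : HExpr := ite a b (const 1)

/-- Negation. -/
def not (a : HExpr) : HExpr := ite a (const 0) (const 1)

/-- Bounded existential quantifier. -/
def ex (x : ℕ) (a : HExpr) : HExpr := sum x a

/-- Bounded universal quantifier. -/
def all (x : ℕ) (a : HExpr) : HExpr := not (ex x (not a))

section
variable (σ : State) (a b c : HExpr)

@[simp] theorem eval_const (n : ℕ) : (const n).eval σ = n := rfl
@[simp] theorem eval_var (x : ℕ) : (var x).eval σ = σ.var x := rfl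
@[simp] theorem eval_arr (n : ℕ) : (arr n a b).eval σ = σ.arr n (a.eval σ) (b.eval σ) := rfl
@[simp] theorem eval_add : (add a b).eval σ = a.eval σ + b.eval σ := rfl
@[simp] theorem eval_sub : (sub a b).eval σ = a.eval σ - b.eval σ := rfl
@[simp] theorem eval_ite : (ite c a b).eval σ = if c.Holds σ then a.eval σ else b.eval σ := rfl
@[simp] theorem eval_sum (x : ℕ) : (sum x a).eval σ =
    ∑ i ∈ Finset.range (σ.var 2), a.eval (σ.setVar x i) := rfl

@[simp] theorem holds_arr (n : ℕ) : (arr n a b).Holds σ ↔ σ.arr n (a.eval σ) (b.eval σ) ≠ 0 :=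
  Iff.rfl

@[simp] theorem holds_lt : (lt a b).Holds σ ↔ a.eval σ < b.eval σ := by
  simp only [Holds, lt, eval_sub]; omega

@[simp] theorem holds_le : (le a b).Holds σ ↔ a.eval σ ≤ b.eval σ := by
  have h : (sub a b).Holds σ ↔ a.eval σ - b.eval σ ≠ 0 := Iff.rfl
  unfold Holds le
  rw [eval_ite, eval_const, eval_const]
  split_ifs <;> simp only [h] at * <;> omega

@[simp] theorem holds_eq : (eq a b).Holds σ ↔ a.eval σ = b.eval σ := by
  have h : (add (sub a b) (sub b a)).Holds σ ↔
      a.eval σ - b.eval σ + (b.eval σ - a.eval σ) ≠ 0 := Iff.rfl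
  unfold Holds eq
  rw [eval_ite, eval_const, eval_const]
  split_ifs <;> simp only [h] at * <;> omega

@[simp] theorem holds_and : (and a b).Holds σ ↔ a.Holds σ ∧ b.Holds σ := by
  by_cases h : a.Holds σ
  · simp only [h, true_and]; unfold Holds HExpr.and; rw [eval_ite, if_pos h]
  · simp only [h, false_and]; unfold Holds HExpr.and; rw [eval_ite, if_neg h]; simp

@[simp] theorem holds_or : (or a b).Holds σ ↔ a.Holds σ ∨ b.Holds σ := by
  by_cases h : a.Holds σ
  · simp only [h, true_or]; unfold Holds HExpr.or; rw [eval_ite, if_pos h]; simp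
  · simp only [h, false_or]; unfold Holds HExpr.or; rw [eval_ite, if_neg h]

@[simp] theorem holds_imp : (imp a b).Holds σ ↔ (a.Holds σ → b.Holds σ) := by
  by_cases h : a.Holds σ
  · simp only [h, true_imp_iff]; unfold Holds HExpr.imp; rw [eval_ite, if_pos h]
  · simp only [h, false_imp_iff]; unfold Holds HExpr.imp; rw [eval_ite, if_neg h]; simp

@[simp] theorem holds_not : (not a).Holds σ ↔ ¬ a.Holds σ := by
  by_cases h : a.Holds σ
  · simp only [h]; unfold Holds HExpr.not; rw [eval_ite, if_pos h]; simp
  · simp only [h]; unfold Holds HExpr.not; rw [eval_ite, if_neg h]; simp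

@[simp] theorem holds_ex (x : ℕ) : (ex x a).Holds σ ↔ ∃ i < σ.var 2, a.Holds (σ.setVar x i) := by
  simp [Holds, ex]

@[simp] theorem holds_all (x : ℕ) :
    (all x a).Holds σ ↔ ∀ i < σ.var 2, a.Holds (σ.setVar x i) := by
  simp [all]

end

end HExpr

namespace HProg

/-- The program does not store into array `a`. -/
def NotStores (a : ℕ) : HProg → Prop
  | assign _ _ => True
  | store b _ _ _ => a ≠ b
  | seq c₁ c₂ => c₁.NotStores a ∧ c₂.NotStores a
  | ite _ c => c.NotStores a
  | .loop _ c => c.NotStores a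

/-- The program does not assign to variable `y`. -/
def NotAssigns (y : ℕ) : HProg → Prop
  | assign x _ => y ≠ x
  | store _ _ _ _ => True
  | seq c₁ c₂ => c₁.NotAssigns y ∧ c₂.NotAssigns y
  | ite _ c => c.NotAssigns y
  | .loop x c => y ≠ x ∧ c.NotAssigns y

theorem foldl_induction {c : HProg} {x : ℕ} (σ : State) (Inv : ℕ → State → Prop) (h0 : Inv 0 σ)
    (N : ℕ) (hs : ∀ i < N, ∀ τ, Inv i τ → Inv (i + 1) (c.run (τ.setVar x i))) :
    Inv N ((List.range N).foldl (fun τ i => c.run (τ.setVar x i)) σ) := by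
  induction N with
  | zero => exact h0
  | succ N ih =>
    rw [List.range_succ, List.foldl_append, List.foldl_cons, List.foldl_nil]
    exact hs N (by omega) _ (ih fun i hi => hs i (by omega))

/-- Frame rule, together with `run_var`: the syntactic check is settled by `simp`, and it carries
all untouched data through the phases of the program. -/
theorem run_arr {a : ℕ} {c : HProg} (hc : c.NotStores a) : ∀ σ, (c.run σ).arr a = σ.arr a := by
  induction c with
  | assign x e => intro σ; rfl
  | store b i j e =>
    intro σ; funext p q
    simp only [run, State.setArr_arr]; rw [if_neg fun h => hc h.1]
  | seq c₁ c₂ h₁ h₂ => intro σ; rw [run, h₂ hc.2, h₁ hc.1]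
  | ite e c h => intro σ; rw [run]; split_ifs; exacts [h hc σ, rfl]
  | loop x c h =>
    intro σ
    exact foldl_induction σ (fun _ τ => τ.arr a = σ.arr a) rfl _
      fun i _ τ hτ => by rw [h hc]; exact hτ

theorem run_var {y : ℕ} {c : HProg} (hc : c.NotAssigns y) : ∀ σ, (c.run σ).var y = σ.var y := by
  induction c with
  | assign x e => intro σ; simp only [run, State.setVar_var]; rw [if_neg hc]
  | store b i j e => intro σ; rfl
  | seq c₁ c₂ h₁ h₂ => intro σ; rw [run, h₂ hc.2, h₁ hc.1]
  | ite e c h => intro σ; rw [run]; split_ifs; exacts [h hc σ, rfl]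
  | loop x c h =>
    intro σ
    exact foldl_induction σ (fun _ τ => τ.var y = σ.var y) rfl _
      fun i _ τ hτ => by rw [h hc.2, State.setVar_var, if_neg hc.1]; exact hτ

/-- Loop invariants; the loop body may be assumed to start from a state that agrees with the
initial one on everything the body does not write to. -/
theorem run_loop {c : HProg} {x : ℕ} (σ : State) (Inv : ℕ → State → Prop) (h0 : Inv 0 σ)
    (hs : ∀ i < σ.var 2, ∀ τ, (∀ a, c.NotStores a → τ.arr a = σ.arr a) →
      (∀ y, y ≠ x → c.NotAssigns y → τ.var y = σ.var y) → Inv i τ →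
      Inv (i + 1) (c.run (τ.setVar x i))) :
    Inv (σ.var 2) ((HProg.loop x c).run σ) := by
  refine (foldl_induction (c := c) (x := x) σ (fun i τ => (∀ a, c.NotStores a → τ.arr a = σ.arr a) ∧
    (∀ y, y ≠ x → c.NotAssigns y → τ.var y = σ.var y) ∧ Inv i τ)
    ⟨fun _ _ => rfl, fun _ _ _ => rfl, h0⟩ (σ.var 2) ?_).2.2
  rintro i hi τ ⟨ha, hv, hI⟩
  refine ⟨fun a h => ?_, fun y hy h => ?_, hs i hi τ ha hv hI⟩
  · rw [run_arr h]; exact ha a h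
  · rw [run_var h, State.setVar_var, if_neg hy]; exact hv y hy h

theorem run_ite (e : HExpr) (c : HProg) (σ : State) :
    (HProg.ite e c).run σ = if e.Holds σ then c.run σ else σ := rfl

@[simp] theorem run_seq (c₁ c₂ : HProg) (σ : State) :
    (HProg.seq c₁ c₂).run σ = c₂.run (c₁.run σ) := rfl

@[simp] theorem run_assign (x : ℕ) (e : HExpr) (σ : State) :
    (HProg.assign x e).run σ = σ.setVar x (e.eval σ) := rfl

@[simp] theorem run_store (a : ℕ) (i j e : HExpr) (σ : State) :
    (HProg.store a i j e).run σ = σ.setArr a (i.eval σ) (j.eval σ) (e.eval σ) := rfl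

end HProg

open HExpr HProg

/-! ### Families of sets stored as rows of an array -/

/-- Row `i` of array `2` is the indicator function of `C i`. -/
structure Rows (σ : State) (C : ℕ → Finset ℕ) : Prop where
  arr : ∀ i u, σ.arr 2 i u = if u ∈ C i then 1 else 0
  lt : ∀ i, ∀ u ∈ C i, u < σ.var 2

/-- Column `0` of array `3` is the indicator function of `I`. -/
structure Chosen (σ : State) (I : Finset ℕ) : Prop where
  arr : ∀ i, σ.arr 3 i 0 = if i ∈ I then 1 else 0
  lt : ∀ i ∈ I, i < σ.var 2

theorem Rows.congr {σ τ : State} {C : ℕ → Finset ℕ} (h : Rows σ C) (ha : τ.arr 2 = σ.arr 2)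
    (hv : τ.var 2 = σ.var 2) : Rows τ C :=
  ⟨fun i u => by rw [ha]; exact h.arr i u, fun i u hu => by rw [hv]; exact h.lt i u hu⟩

theorem Chosen.congr {σ τ : State} {I : Finset ℕ} (h : Chosen σ I) (ha : τ.arr 3 = σ.arr 3)
    (hv : τ.var 2 = σ.var 2) : Chosen τ I :=
  ⟨fun i => by rw [ha]; exact h.arr i, fun i hi => by rw [hv]; exact h.lt i hi⟩

/-- The size of row `x`. -/
def sizeE (x : ℕ) : HExpr := .sum 10 (.arr 2 (.var x) (.var 10))

/-- Row `x` is contained in row `y`. -/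
def subsetE (x y : ℕ) : HExpr :=
  .all 10 (.imp (.arr 2 (.var x) (.var 10)) (.arr 2 (.var y) (.var 10)))

/-- Vertex `x` is adjacent to all members of row `y`. -/
def joinedE (x y : ℕ) : HExpr :=
  .all 10 (.imp (.arr 2 (.var y) (.var 10)) (.arr 0 (.var x) (.var 10)))

/-- The number of chosen rows that contain row `x`. -/
def degE (x : ℕ) : HExpr :=
  .sum 11 (.ite (.and (.arr 3 (.var 11) (.const 0)) (subsetE x 11)) (.const 1) (.const 0))

/-- Vertex `x` lies in a chosen row. -/
def coveredE (x : ℕ) : HExpr :=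
  .ex 11 (.and (.arr 3 (.var 11) (.const 0)) (.arr 2 (.var 11) (.var x)))

/-- Row `x` is contained in a chosen row. -/
def insideE (x : ℕ) : HExpr := .ex 11 (.and (.arr 3 (.var 11) (.const 0)) (subsetE x 11))

section
variable {σ : State} {C : ℕ → Finset ℕ} {I : Finset ℕ}

theorem eval_sizeE (h : Rows σ C) {x : ℕ} (hx : x ≠ 10) :
    (sizeE x).eval σ = (C (σ.var x)).card := by
  simp only [sizeE, eval_sum, eval_arr, eval_var, State.setVar_var, State.setVar_arr, if_neg hx,
    if_true, h.arr]
  rw [← Finset.sum_filter, ← Finset.card_eq_sum_ones]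
  congr 1
  ext u
  simp only [Finset.mem_filter, Finset.mem_range]
  exact ⟨fun hu => hu.2, fun hu => ⟨h.lt _ u hu, hu⟩⟩

theorem holds_subsetE (h : Rows σ C) {x y : ℕ} (hx : x ≠ 10) (hy : y ≠ 10) :
    (subsetE x y).Holds σ ↔ C (σ.var x) ⊆ C (σ.var y) := by
  simp only [subsetE, holds_all, holds_imp, holds_arr, eval_var, State.setVar_var,
    State.setVar_arr, if_neg hx, if_neg hy, if_true, h.arr]
  constructor
  · intro hh u hu
    simpa [hu] using hh u (h.lt _ u hu)
  · intro hh u _ hu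
    have : u ∈ C (σ.var x) := by simpa using hu
    simp [hh this]

theorem holds_joinedE (h : Rows σ C) {x y : ℕ} (hx : x ≠ 10) (hy : y ≠ 10) :
    (joinedE x y).Holds σ ↔ ∀ u ∈ C (σ.var y), σ.arr 0 (σ.var x) u ≠ 0 := by
  simp only [joinedE, holds_all, holds_imp, holds_arr, eval_var, State.setVar_var,
    State.setVar_arr, if_neg hx, if_neg hy, if_true, h.arr]
  constructor
  · intro hh u hu
    exact hh u (h.lt _ u hu) (by simp [hu])
  · intro hh u _ hu
    exact hh u (by simpa using hu)

theorem eval_degE (h : Rows σ C) (hI : Chosen σ I) {x : ℕ} (hx : x ≠ 10) (hx' : x ≠ 11) :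
    (degE x).eval σ = (I.filter (C (σ.var x) ⊆ C ·)).card := by
  have key : ∀ i, (subsetE x 11).Holds (σ.setVar 11 i) ↔ C (σ.var x) ⊆ C i := fun i => by
    rw [holds_subsetE (h.congr (τ := σ.setVar 11 i) rfl rfl) hx (by decide)]; simp [hx']
  simp only [degE, eval_sum, eval_ite, holds_and, key, holds_arr, eval_var, eval_const,
    State.setVar_var, State.setVar_arr, if_true, hI.arr]
  rw [← Finset.sum_filter, ← Finset.card_eq_sum_ones]
  congr 1
  ext i
  simp only [Finset.mem_filter, Finset.mem_range, ne_eq, ite_eq_right_iff, one_ne_zero, imp_false,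
    not_not]
  exact ⟨fun hi => hi.2, fun hi => ⟨hI.lt i hi.1, hi⟩⟩

theorem holds_coveredE (h : Rows σ C) (hI : Chosen σ I) {x : ℕ} (hx : x ≠ 11) :
    (coveredE x).Holds σ ↔ ∃ i ∈ I, σ.var x ∈ C i := by
  simp only [coveredE, holds_ex, holds_and, holds_arr, eval_var, eval_const, State.setVar_var,
    State.setVar_arr, if_true, if_neg hx, hI.arr, h.arr, ne_eq, ite_eq_right_iff, one_ne_zero,
    imp_false, not_not]
  exact ⟨fun ⟨i, _, hi⟩ => ⟨i, hi⟩, fun ⟨i, hi⟩ => ⟨i, hI.lt i hi.1, hi⟩⟩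

theorem holds_insideE (h : Rows σ C) (hI : Chosen σ I) {x : ℕ} (hx : x ≠ 10) (hx' : x ≠ 11) :
    (insideE x).Holds σ ↔ ∃ i ∈ I, C (σ.var x) ⊆ C i := by
  have key : ∀ i, (subsetE x 11).Holds (σ.setVar 11 i) ↔ C (σ.var x) ⊆ C i := fun i => by
    rw [holds_subsetE (h.congr (τ := σ.setVar 11 i) rfl rfl) hx (by decide)]; simp [hx']
  simp only [insideE, holds_ex, holds_and, holds_arr, key, eval_var, eval_const, State.setVar_var,
    State.setVar_arr, if_true, hI.arr, ne_eq, ite_eq_right_iff, one_ne_zero,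
    imp_false, not_not]
  exact ⟨fun ⟨i, _, hi⟩ => ⟨i, hi⟩, fun ⟨i, hi⟩ => ⟨i, hI.lt i hi.1, hi⟩⟩

end

/-! ### Listing all small cliques -/

/-- Append the row `var 6`, with `var 5` inserted, to the list of rows. -/
def appendRow : HProg :=
  .seq (.loop 7 (.store 2 (.var 3) (.var 7) (.arr 2 (.var 6) (.var 7))))
    (.seq (.store 2 (.var 3) (.var 5) (.const 1)) (.assign 3 (.add (.var 3) (.const 1))))

/-- The target row is empty at the start and is not the row being copied, so after `q` rounds it
holds the part of the source below `q`. -/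
theorem run_appendRow {σ : State} {C : ℕ → Finset ℕ} (h : Rows σ C) (hm : C (σ.var 3) = ∅)
    (hne : σ.var 6 ≠ σ.var 3) (hv : σ.var 5 < σ.var 2) :
    Rows (appendRow.run σ) (Function.update C (σ.var 3) (insert (σ.var 5) (C (σ.var 6)))) ∧
      (appendRow.run σ).var 3 = σ.var 3 + 1 := by
  have key := run_loop (c := .store 2 (.var 3) (.var 7) (.arr 2 (.var 6) (.var 7))) (x := 7) σ
    (fun q τ => ∀ i u, τ.arr 2 i u = if u ∈ (if i = σ.var 3 then (C (σ.var 6)).filter (· < q)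
      else C i) then 1 else 0)
    (by
      intro i u
      rw [h.arr]
      by_cases hi : i = σ.var 3
      · simp [hi, hm]
      · simp [hi])
    (by
      intro q hq τ ha hv hI i u
      have h3 := hv 3 (by decide) trivial
      have h6 := hv 6 (by decide) trivial
      simp only [run_store, eval_var, eval_arr, State.setVar_var, State.setVar_arr,
        State.setArr_arr, h3, h6, hI]
      by_cases hi : i = σ.var 3
      · by_cases hu : u = q
        · simp [hi, hu, hne]
        · have : u ≤ q ↔ u < q := by omega
          simp [hi, hu, this]
      · simp [hi])
  set τ := (HProg.loop 7 (.store 2 (.var 3) (.var 7) (.arr 2 (.var 6) (.var 7)))).run σ with hτ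
  have h3 : τ.var 3 = σ.var 3 := run_var (by simp [NotAssigns]) σ
  have h5 : τ.var 5 = σ.var 5 := run_var (by simp [NotAssigns]) σ
  have h2 : τ.var 2 = σ.var 2 := run_var (by simp [NotAssigns]) σ
  have hrun : appendRow.run σ =
      (τ.setArr 2 (σ.var 3) (σ.var 5) 1).setVar 3 (σ.var 3 + 1) := by
    simp [appendRow, ← hτ, h3, h5]
  rw [hrun]
  refine ⟨⟨fun i u => ?_, fun i u hu => ?_⟩, by simp⟩
  · simp only [State.setVar_arr, State.setArr_arr, key]
    by_cases hi : i = σ.var 3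
    · by_cases hu : u = σ.var 5
      · simp [hi, hu]
      · by_cases hu' : u ∈ C (σ.var 6)
        · simp [hi, hu, hu', h.lt _ u hu']
        · simp [hi, hu, hu']
    · simp [hi]
  · simp only [State.setVar_var, State.setArr_var, h2]
    by_cases hi : i = σ.var 3
    · subst hi
      rw [Function.update_self, Finset.mem_insert] at hu
      rcases hu with rfl | hu
      · simpa using hv
      · simpa using h.lt _ u hu
    · rw [Function.update_of_ne hi] at hu
      simpa using h.lt _ u hu

/-- The sets `C 0, …, C (m - 1)` are distinct, and they are the sets with property `p`. -/
structure IsListing (C : ℕ → Finset ℕ) (m : ℕ) (p : Finset ℕ → Prop) : Prop where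
  inj : ∀ i < m, ∀ j < m, C i = C j → i = j
  empty : ∀ i, m ≤ i → C i = ∅
  mem : ∀ A, (∃ i < m, C i = A) ↔ p A

/-- Compare `n.choose i` ≤ n^i ≤ n^i `r.choose i` with the binomial expansion of (n+1)^r. -/
theorem card_small_subsets_le (n r : ℕ) :
    ((Finset.range n).powerset.filter fun A => A.card ≤ r).card ≤ (n + 1) ^ r := by
  have hsub : ((Finset.range n).powerset.filter fun A => A.card ≤ r) ⊆
      (Finset.range (r + 1)).biUnion fun i => (Finset.range n).powersetCard i := by
    intro A hA
    rw [Finset.mem_filter, Finset.mem_powerset] at hA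
    exact Finset.mem_biUnion.2 ⟨A.card, Finset.mem_range.2 (by omega),
      Finset.mem_powersetCard.2 ⟨hA.1, rfl⟩⟩
  refine (Finset.card_le_card hsub).trans (Finset.card_biUnion_le.trans ?_)
  rw [add_pow]
  refine Finset.sum_le_sum fun i hi => ?_
  rw [Finset.card_powersetCard, Finset.card_range, one_pow, mul_one]
  refine (Nat.choose_le_pow n i).trans (Nat.le_mul_of_pos_right _ (Nat.choose_pos ?_))
  have := Finset.mem_range.1 hi
  omega

theorem IsListing.le_pow {C : ℕ → Finset ℕ} {m n r : ℕ} {p : Finset ℕ → Prop}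
    (h : IsListing C m p) (hp : ∀ A, p A → A ⊆ Finset.range n ∧ A.card ≤ r) : m ≤ (n + 1) ^ r := by
  refine le_trans ?_ (card_small_subsets_le n r)
  have hc : ((Finset.range m).image C).card = m := by
    rw [Finset.card_image_of_injOn, Finset.card_range]
    intro i hi j hj hij
    exact h.inj i (by simpa using hi) j (by simpa using hj) hij
  refine hc.symm.le.trans (Finset.card_le_card ?_)
  intro A hA
  obtain ⟨i, hi, rfl⟩ := Finset.mem_image.1 hA
  have := hp _ ((h.mem _).1 ⟨i, Finset.mem_range.1 hi, rfl⟩)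
  exact Finset.mem_filter.2 ⟨Finset.mem_powerset.2 this.1, this.2⟩

/-- Extend by vertex `var 5` all of the first `var 4` rows for which this gives a clique with at
most `r` vertices. -/
def extendRows (r : ℕ) : HProg :=
  .loop 6 (.ite (.and (.lt (.var 6) (.var 4)) (.and (.lt (sizeE 6) (.const r)) (joinedE 5 6)))
    appendRow)

/-- List all cliques with at most `r` vertices as rows of array `2`, their number in
variable `3`. -/
def listCliques (r : ℕ) : HProg :=
  .seq (.assign 3 (.const 1))
    (.loop 5 (.ite (.lt (.var 5) (.var 0)) (.seq (.assign 4 (.var 3)) (extendRows r))))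

/-- Rows appended during the loop lie behind the first `var 4` rows, so no row created here is
extended again. -/
theorem run_extendRows {σ : State} {C₀ : ℕ → Finset ℕ} {r v : ℕ} {p : Finset ℕ → Prop}
    (h : Rows σ C₀) (hC : IsListing C₀ (σ.var 3) p) (h4 : σ.var 4 = σ.var 3)
    (hm : σ.var 3 ≤ σ.var 2) (h5 : σ.var 5 = v) (hv : v < σ.var 2) (hpv : ∀ A, p A → v ∉ A) :
    ∃ C, Rows ((extendRows r).run σ) C ∧ IsListing C (((extendRows r).run σ).var 3)
      (fun A => p A ∨ ∃ B, p B ∧ B.card < r ∧ (∀ u ∈ B, σ.arr 0 v u ≠ 0) ∧ A = insert v B) := by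
  set m₀ := σ.var 3 with hm₀
  have hpC : ∀ j < m₀, p (C₀ j) := fun j hj => (hC.mem _).1 ⟨j, hj, rfl⟩
  have key := run_loop (c := .ite (.and (.lt (.var 6) (.var 4))
      (.and (.lt (sizeE 6) (.const r)) (joinedE 5 6))) appendRow) (x := 6) σ
    (fun i τ => ∃ C, Rows τ C ∧ m₀ ≤ τ.var 3 ∧ (∀ j < m₀, C j = C₀ j) ∧ IsListing C (τ.var 3)
      (fun A => p A ∨ ∃ j < i, j < m₀ ∧ (C₀ j).card < r ∧ (∀ u ∈ C₀ j, σ.arr 0 v u ≠ 0) ∧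
        A = insert v (C₀ j)))
    ⟨C₀, h, le_rfl, fun _ _ => rfl, by simpa using hC⟩
    (by
      rintro i hi τ ha hvar ⟨C, hR, hle, hCC, hL⟩
      have ha0 := ha 0 (by simp [NotStores, appendRow])
      have e2 := hvar 2 (by decide) (by simp [NotAssigns, appendRow])
      have e4 := hvar 4 (by decide) (by simp [NotAssigns, appendRow])
      have e5 := hvar 5 (by decide) (by simp [NotAssigns, appendRow])
      have hR' : Rows (τ.setVar 6 i) C := hR.congr rfl rfl
      rw [run_ite]
      have hcond : (HExpr.and (.lt (.var 6) (.var 4))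
          (.and (.lt (sizeE 6) (.const r)) (joinedE 5 6))).Holds (τ.setVar 6 i) ↔
          i < m₀ ∧ (C₀ i).card < r ∧ ∀ u ∈ C₀ i, σ.arr 0 v u ≠ 0 := by
        simp only [holds_and, holds_lt, eval_sizeE hR' (show 6 ≠ 10 by decide),
          holds_joinedE hR' (show 5 ≠ 10 by decide) (show 6 ≠ 10 by decide), eval_var, eval_const,
          State.setVar_var, State.setVar_arr, ha0]
        simp only [if_true, show (4 : ℕ) ≠ 6 by decide, show (5 : ℕ) ≠ 6 by decide, if_false, e4,
          e5, h4, h5]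
        refine and_congr_right fun hi => ?_
        rw [hCC i hi]
      by_cases hc : i < m₀ ∧ (C₀ i).card < r ∧ ∀ u ∈ C₀ i, σ.arr 0 v u ≠ 0
      · rw [if_pos (hcond.2 hc)]
        obtain ⟨hR₁, hv₁⟩ := run_appendRow (σ := τ.setVar 6 i) hR'
          (by simpa using hL.empty _ le_rfl)
          (by simp; omega) (by simp [e5, e2, h5, hv])
        simp only [State.setVar_var, show (3 : ℕ) ≠ 6 by decide, show (5 : ℕ) ≠ 6 by decide,
          if_false, if_true, e5, h5, hCC i hc.1] at hR₁ hv₁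
        refine ⟨_, hR₁, by omega, fun j hj => ?_, ?_⟩
        · rw [Function.update_of_ne (by omega), hCC j hj]
        rw [hv₁]
        -- The appended set contains `v`, unlike the old rows; it differs from the other new ones
        -- because erasing `v` gives back distinct old rows.
        have hnew : ∀ j < τ.var 3, C j ≠ insert v (C₀ i) := by
          intro j hj he
          rcases (hL.mem _).1 ⟨j, hj, rfl⟩ with hp | ⟨j', hj', hj'm, -, -, he'⟩
          · exact hpv _ hp (he ▸ Finset.mem_insert_self _ _)
          · have e : insert v (C₀ j') = insert v (C₀ i) := he' ▸ he
            have := congrArg (fun A => A.erase v) e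
            simp only [Finset.erase_insert (hpv _ (hpC j' hj'm)),
              Finset.erase_insert (hpv _ (hpC i hc.1))] at this
            have := hC.inj _ hj'm _ hc.1 this
            omega
        constructor
        · intro a ha b hb hab
          by_cases ha' : a = τ.var 3 <;> by_cases hb' : b = τ.var 3
          · omega
          · rw [ha', Function.update_self, Function.update_of_ne hb'] at hab
            exact absurd hab.symm (hnew b (by omega))
          · rw [hb', Function.update_self, Function.update_of_ne ha'] at hab
            exact absurd hab (hnew a (by omega))
          · rw [Function.update_of_ne ha', Function.update_of_ne hb'] at hab
            exact hL.inj a (by omega) b (by omega) hab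
        · intro a ha
          rw [Function.update_of_ne (by omega)]
          exact hL.empty a (by omega)
        · intro A
          constructor
          · rintro ⟨a, ha, rfl⟩
            by_cases ha' : a = τ.var 3
            · subst ha'
              rw [Function.update_self]
              exact Or.inr ⟨i, by omega, hc.1, hc.2.1, hc.2.2, rfl⟩
            · rw [Function.update_of_ne ha']
              rcases (hL.mem _).1 ⟨a, by omega, rfl⟩ with h | ⟨j, hj, hh⟩
              · exact Or.inl h
              · exact Or.inr ⟨j, by omega, hh⟩
          · intro hA
            have hold : (∃ a < τ.var 3, C a = A) → ∃ a < τ.var 3 + 1,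
                Function.update C (τ.var 3) (insert v (C₀ i)) a = A := by
              rintro ⟨a, ha, rfl⟩
              exact ⟨a, by omega, by rw [Function.update_of_ne (by omega)]⟩
            rcases hA with h | ⟨j, hj, hh⟩
            · exact hold ((hL.mem _).2 (Or.inl h))
            · rcases Nat.lt_succ_iff_lt_or_eq.1 hj with hj | rfl
              · exact hold ((hL.mem _).2 (Or.inr ⟨j, hj, hh⟩))
              · exact ⟨τ.var 3, by omega, by rw [Function.update_self, hh.2.2.2]⟩
      · rw [if_neg (mt hcond.1 hc)]
        refine ⟨C, hR', hle, hCC, hL.inj, hL.empty, fun A => (hL.mem A).trans ?_⟩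
        refine or_congr_right ⟨fun ⟨j, hj, hh⟩ => ⟨j, by omega, hh⟩, fun ⟨j, hj, hh⟩ => ?_⟩
        rcases Nat.lt_succ_iff_lt_or_eq.1 hj with hj | rfl
        · exact ⟨j, hj, hh⟩
        · exact absurd ⟨hh.1, hh.2.1, hh.2.2.1⟩ hc)
  obtain ⟨C, hR, -, -, hL⟩ := key
  refine ⟨C, hR, hL.inj, hL.empty, fun A => (hL.mem A).trans (or_congr_right ?_)⟩
  constructor
  · rintro ⟨j, -, hj, h1, h2, rfl⟩
    exact ⟨C₀ j, hpC j hj, h1, h2, rfl⟩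
  · rintro ⟨B, hB, h1, h2, rfl⟩
    obtain ⟨j, hj, rfl⟩ := (hC.mem B).2 hB
    exact ⟨j, by omega, hj, h1, h2, rfl⟩

/-- The recursion behind the listing: a clique below v + 1 either avoids v or arises from a smaller
clique joined to v. -/
theorem clique_succ_iff {H : SimpleGraph ℕ} {v r : ℕ} {A : Finset ℕ} :
    ((A ⊆ Finset.range v ∧ H.IsClique A ∧ A.card ≤ r) ∨
      ∃ B : Finset ℕ, (B ⊆ Finset.range v ∧ H.IsClique B ∧ B.card ≤ r) ∧ B.card < r ∧
        (∀ u ∈ B, H.Adj v u) ∧ A = insert v B) ↔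
    A ⊆ Finset.range (v + 1) ∧ H.IsClique A ∧ A.card ≤ r := by
  constructor
  · rintro (⟨h1, h2, h3⟩ | ⟨B, ⟨h1, h2, -⟩, h3, h4, rfl⟩)
    · exact ⟨h1.trans (Finset.range_subset_range.2 (Nat.le_succ v)), h2, h3⟩
    · refine ⟨?_, ?_, (Finset.card_insert_le _ _).trans h3⟩
      · rw [Finset.range_add_one]; exact Finset.insert_subset_insert _ h1
      · rw [Finset.coe_insert]
        exact h2.insert fun u hu _ => h4 u hu
  · rintro ⟨h1, h2, h3⟩
    rw [Finset.range_add_one] at h1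
    by_cases hv : v ∈ A
    · refine Or.inr ⟨A.erase v, ⟨Finset.subset_insert_iff.1 h1, ?_, ?_⟩, ?_, ?_,
        (Finset.insert_erase hv).symm⟩
      · exact h2.subset (by simp)
      · exact (Finset.card_erase_le).trans h3
      · exact lt_of_lt_of_le (Finset.card_erase_lt_of_mem hv) h3
      · intro u hu
        rw [Finset.mem_erase] at hu
        exact h2 hv hu.2 hu.1.symm
    · exact Or.inl ⟨(Finset.subset_insert_iff_of_notMem hv).1 h1, h2, h3⟩

theorem run_listCliques {σ : State} {H : SimpleGraph ℕ} {n r : ℕ}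
    (h0 : σ.var 0 = n) (hadj : ∀ u v, σ.arr 0 u v ≠ 0 ↔ H.Adj u v)
    (h2 : ∀ i u, σ.arr 2 i u = 0) (hL : (n + 1) ^ r < σ.var 2) (hn : n ≤ σ.var 2) :
    ∃ C, Rows ((listCliques r).run σ) C ∧ IsListing C (((listCliques r).run σ).var 3)
      (fun A => A ⊆ Finset.range n ∧ H.IsClique A ∧ A.card ≤ r) := by
  have key := run_loop (c := .ite (.lt (.var 5) (.var 0)) (.seq (.assign 4 (.var 3)) (extendRows r)))
    (x := 5) (σ.setVar 3 1)
    (fun v τ => ∃ C, Rows τ C ∧ IsListing C (τ.var 3)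
      (fun A => A ⊆ Finset.range (min v n) ∧ H.IsClique A ∧ A.card ≤ r))
    (by
      -- The count starts at 1 because the blank row `0` already represents the empty clique.
      refine ⟨fun _ => ∅, ⟨by simp [h2], by simp⟩, ⟨?_, by simp, ?_⟩⟩
      · simp only [State.setVar_var, if_true]; omega
      · intro A
        simp only [State.setVar_var, if_true, Nat.zero_min, Finset.range_zero,
          Finset.subset_empty]
        constructor
        · rintro ⟨_, _, rfl⟩; simp
        · rintro ⟨rfl, _⟩; exact ⟨0, by simp⟩)
    (by
      rintro v hv τ ha hvar ⟨C, hR, hC⟩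
      have ha0 : τ.arr 0 = σ.arr 0 := ha 0 (by simp [NotStores, extendRows, appendRow])
      have e2 : τ.var 2 = σ.var 2 :=
        hvar 2 (by decide) (by simp [NotAssigns, extendRows, appendRow])
      have e0 : τ.var 0 = n :=
        (hvar 0 (by decide) (by simp [NotAssigns, extendRows, appendRow])).trans h0
      rw [run_ite]
      have hcond : (HExpr.lt (.var 5) (.var 0)).Holds (τ.setVar 5 v) ↔ v < n := by
        simp [e0]
      by_cases hvn : v < n
      · rw [if_pos (hcond.2 hvn), run_seq, run_assign, eval_var]
        have hm := hC.le_pow (n := n) (r := r) fun A hA =>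
          ⟨hA.1.trans (Finset.range_subset_range.2 (min_le_right _ _)), hA.2.2⟩
        obtain ⟨C', hR', hC'⟩ := run_extendRows (σ := (τ.setVar 5 v).setVar 4 (τ.var 3))
          (r := r) (v := v) (hR.congr rfl rfl) (by simpa using hC) (by simp)
          (by simp; omega) (by simp) (by simp; omega)
          (fun A hA hvA => by have := hA.1 hvA; simp at this)
        refine ⟨C', by simpa using hR', by simpa using hC'.inj, by simpa using hC'.empty, ?_⟩
        intro A
        have hA := hC'.mem A
        simp only [State.setVar_arr, ha0, hadj, show min v n = v by omega] at hA
        rw [show min (v + 1) n = v + 1 by omega, ← clique_succ_iff]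
        exact hA
      · rw [if_neg (mt hcond.1 hvn)]
        refine ⟨C, hR.congr rfl rfl, ?_⟩
        rw [show min (v + 1) n = min v n by omega]
        simpa using hC)
  obtain ⟨C, hR, hC⟩ := key
  refine ⟨C, hR, ?_⟩
  rwa [show min ((σ.setVar 3 1).var 2) n = n by simp; omega] at hC

end RAM

namespace RAM

open HExpr HProg

/-- Tabulation by a double loop. The expression may not depend on the array being filled, so the
order of the stores does not matter. -/
theorem run_fill {a x y : ℕ} {e : HExpr} (σ : State) (val : ℕ → ℕ → ℕ) (hx : x ≠ 2)
    (hy : y ≠ 2) (hxy : x ≠ y)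
    (he : ∀ τ, (∀ b, b ≠ a → τ.arr b = σ.arr b) → (∀ z, z ≠ x → z ≠ y → τ.var z = σ.var z) →
      e.eval τ = val (τ.var x) (τ.var y)) (p q : ℕ) :
    ((HProg.loop x (.loop y (.store a (.var x) (.var y) e))).run σ).arr a p q =
      if p < σ.var 2 ∧ q < σ.var 2 then val p q else σ.arr a p q := by
  refine run_loop σ (fun i τ => ∀ p q, τ.arr a p q =
    if p < i ∧ q < σ.var 2 then val p q else σ.arr a p q) (by simp) ?_ p q
  intro i hi τ ha hv hI
  have hinner := run_loop (c := .store a (.var x) (.var y) e) (x := y) (τ.setVar x i)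
    (fun j ρ => ∀ p q, ρ.arr a p q = if p = i ∧ q < j then val p q else τ.arr a p q)
    (by simp)
    (by
      intro j hj ρ ha' hv' hI' p q
      have hρx : ρ.var x = i := by rw [hv' x hxy trivial]; simp
      have hval : e.eval (ρ.setVar y j) = val i j := by
        rw [he]
        · simp [hxy, hρx]
        · intro b hb
          rw [State.setVar_arr, ha' b hb]
          exact ha b hb
        · intro z hzx hzy
          rw [State.setVar_var, if_neg hzy, hv' z hzy trivial, State.setVar_var, if_neg hzx]
          exact hv z hzx ⟨hzy, trivial⟩
      rw [run_store, hval]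
      simp only [State.setArr_arr, eval_var, State.setVar_var, State.setVar_arr, if_neg hxy, if_true,
        hρx, hI', true_and]
      by_cases h1 : p = i
      · by_cases h2 : q = j
        · simp [h1, h2]
        · have : q < j + 1 ↔ q < j := by omega
          simp only [h1, h2, this, and_false, if_false]
      · simp [h1])
  intro p q
  rw [hinner p q, hI p q]
  have h2 : (τ.setVar x i).var 2 = σ.var 2 := by
    rw [State.setVar_var, if_neg hx.symm]
    exact hv 2 hx.symm ⟨hy.symm, trivial⟩
  rw [h2]
  by_cases h1 : p = i
  · simp only [h1, true_and, lt_irrefl, false_and, if_false, Nat.lt_succ_self]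
  · have : p < i + 1 ↔ p < i := by omega
    simp only [h1, this, false_and, if_false]

/-! ### The thresholds -/

/-- `min (var 1) (var 2) * r` times the value of `e`. -/
def scaledE (r : ℕ) (e : HExpr) : HExpr :=
  .sum 6 (.ite (.lt (.var 6) (.var 1))
    (.sum 7 (.ite (.lt (.var 7) (.const r)) e (.const 0))) (.const 0))

theorem sum_ite_lt (L k c : ℕ) :
    (∑ i ∈ Finset.range L, if i < k then c else 0) = min L k * c := by
  rw [← Finset.sum_filter, Finset.sum_const, smul_eq_mul]
  congr 1
  rw [show (Finset.range L).filter (· < k) = Finset.range (min L k) by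
    ext i; simp, Finset.card_range]

/-- The machine cannot multiply; a product is a double sum in which only indices below each factor
contribute. This is also where k is cut down to the loop bound. -/
theorem eval_scaledE {σ : State} {r c : ℕ} (hr : r ≤ σ.var 2) :
    (scaledE r (.arr 4 (.var 5) (.const c))).eval σ =
      r * min (σ.var 1) (σ.var 2) * σ.arr 4 (σ.var 5) c := by
  simp [scaledE, sum_ite_lt, min_eq_right hr, min_comm (σ.var 2)]
  ring

/-- Fill columns `0` and `1` of array `4` with the powers of `r * min (var 1) (var 2)`, the second
multiplied by `r ^ s`. -/
def powers (r s : ℕ) : HProg :=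
  .seq (.store 4 (.const 0) (.const 0) (.const 1))
    (.seq (.store 4 (.const 0) (.const 1) (.const (r ^ s)))
      (.loop 5 (.seq
        (.store 4 (.add (.var 5) (.const 1)) (.const 0) (scaledE r (.arr 4 (.var 5) (.const 0))))
        (.store 4 (.add (.var 5) (.const 1)) (.const 1) (scaledE r (.arr 4 (.var 5) (.const 1)))))))

/-- Array `4` holds the thresholds for the parameter `κ`. -/
def Powers (σ : State) (r s κ : ℕ) : Prop :=
  ∀ x ≤ σ.var 2, σ.arr 4 x 0 = (r * κ) ^ x ∧ σ.arr 4 x 1 = r ^ s * (r * κ) ^ x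

theorem run_powers {σ : State} {r s : ℕ} (hr : r ≤ σ.var 2) :
    Powers ((powers r s).run σ) r s (min (σ.var 1) (σ.var 2)) := by
  set κ := min (σ.var 1) (σ.var 2) with hκ
  intro x hx
  have h2 : ((powers r s).run σ).var 2 = σ.var 2 := run_var (by simp [powers, NotAssigns]) σ
  rw [h2] at hx
  refine run_loop (c := .seq
        (.store 4 (.add (.var 5) (.const 1)) (.const 0) (scaledE r (.arr 4 (.var 5) (.const 0))))
        (.store 4 (.add (.var 5) (.const 1)) (.const 1) (scaledE r (.arr 4 (.var 5) (.const 1)))))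
    (x := 5) ((σ.setArr 4 0 0 1).setArr 4 0 1 (r ^ s))
    (fun i τ => ∀ x ≤ i, τ.arr 4 x 0 = (r * κ) ^ x ∧ τ.arr 4 x 1 = r ^ s * (r * κ) ^ x) ?_ ?_ x hx
  · intro x hx
    obtain rfl : x = 0 := by omega
    simp
  · intro i hi τ ha hv hI x hx
    have e1 : τ.var 1 = σ.var 1 := hv 1 (by decide) (by simp [NotAssigns])
    have e2 : τ.var 2 = σ.var 2 := hv 2 (by decide) (by simp [NotAssigns])
    obtain ⟨p0, p1⟩ := hI i le_rfl
    rw [run_seq, run_store, run_store, eval_scaledE (by simpa [e2] using hr),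
      eval_scaledE (by simpa [e2] using hr)]
    simp only [State.setArr_arr, State.setArr_var, State.setVar_var, State.setVar_arr, eval_add,
      eval_var, eval_const, if_true, show (1 : ℕ) ≠ 5 by decide, show (2 : ℕ) ≠ 5 by decide,
      if_false, e1, e2, ← hκ, p0, p1]
    by_cases hxi : x = i + 1
    · subst hxi
      simp [pow_succ]
      constructor <;> ring
    · simp [hxi, hI x (by omega)]

/-- The threshold for the size of row `x`. -/
def thresholdE (r s x : ℕ) : HExpr :=
  .ite (.le (sizeE x) (.const s)) (.arr 4 (.const (r - s - 1)) (.const 1))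
    (.arr 4 (.sub (.const (r - 1)) (sizeE x)) (.const 0))

theorem eval_thresholdE {σ : State} {C : ℕ → Finset ℕ} {r s κ x : ℕ} (h : Rows σ C)
    (hp : Powers σ r s κ) (hr : r ≤ σ.var 2) (hx : x ≠ 10) :
    (thresholdE r s x).eval σ = SetPacking.threshold r s κ (C (σ.var x)).card := by
  simp only [thresholdE, eval_ite, holds_le, eval_sizeE h hx, eval_const, eval_arr, eval_sub,
    SetPacking.threshold, (hp (r - s - 1) (by omega)).2]
  split_ifs
  · rfl
  · exact (hp _ (by omega)).1

/-! ### Choosing a maximal family of bounded degrees -/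

/-- Choose rows of at least `a` elements greedily, in column `0` of array `3`, keeping all degrees
below the thresholds. -/
def choose (a r s : ℕ) : HProg :=
  .loop 5 (.ite (.and (.lt (.var 5) (.var 3)) (.and (.le (.const a) (sizeE 5))
    (.all 6 (.imp (.and (.lt (.var 6) (.var 3)) (subsetE 6 5)) (.lt (degE 6) (thresholdE r s 6))))))
    (.store 3 (.var 5) (.const 0) (.const 1)))

/-- Degrees never decrease while rows are added, so the set responsible for a rejection still meets
its threshold at the end. -/
theorem run_choose {σ : State} {C : ℕ → Finset ℕ} {a r s κ m : ℕ} (h : Rows σ C)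
    (hp : Powers σ r s κ) (hr : r ≤ σ.var 2) (hm : σ.var 3 = m) (hmL : m ≤ σ.var 2)
    (h3 : ∀ i, σ.arr 3 i 0 = 0) :
    ∃ I ⊆ Finset.range m, Chosen ((choose a r s).run σ) I ∧ (∀ i ∈ I, a ≤ (C i).card) ∧
      (∀ j < m, (I.filter (C j ⊆ C ·)).card ≤ SetPacking.threshold r s κ (C j).card) ∧
      ∀ i < m, a ≤ (C i).card → i ∉ I → ∃ j < m, C j ⊆ C i ∧
        SetPacking.threshold r s κ (C j).card ≤ (I.filter (C j ⊆ C ·)).card := by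
  have key := run_loop (c := .ite (.and (.lt (.var 5) (.var 3)) (.and (.le (.const a) (sizeE 5))
    (.all 6 (.imp (.and (.lt (.var 6) (.var 3)) (subsetE 6 5)) (.lt (degE 6) (thresholdE r s 6))))))
    (.store 3 (.var 5) (.const 0) (.const 1))) (x := 5) σ
    (fun i τ => ∃ I ⊆ Finset.range m, I ⊆ Finset.range i ∧ Chosen τ I ∧
      (∀ i ∈ I, a ≤ (C i).card) ∧
      (∀ j < m, (I.filter (C j ⊆ C ·)).card ≤ SetPacking.threshold r s κ (C j).card) ∧
      ∀ i' < i, i' < m → a ≤ (C i').card → i' ∉ I → ∃ j < m, C j ⊆ C i' ∧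
        SetPacking.threshold r s κ (C j).card ≤ (I.filter (C j ⊆ C ·)).card)
    ⟨∅, by simp, by simp, ⟨by simp [h3], by simp⟩, by simp, by simp, by simp⟩
    (by
      rintro i hi τ harr hvar ⟨I, hIm, hIi, hI, hIa, hIdeg, hImax⟩
      have e2 : τ.var 2 = σ.var 2 := hvar 2 (by decide) (by simp [NotAssigns])
      have e3 : τ.var 3 = m := (hvar 3 (by decide) (by simp [NotAssigns])).trans hm
      have a2 : τ.arr 2 = σ.arr 2 := harr 2 (by simp [NotStores])
      have a4 : τ.arr 4 = σ.arr 4 := harr 4 (by simp [NotStores])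
      have hR : ∀ j, Rows ((τ.setVar 5 i).setVar 6 j) C := fun j => h.congr a2 (by simpa using e2)
      have hR' : Rows (τ.setVar 5 i) C := h.congr a2 (by simpa using e2)
      have hI' : ∀ j, Chosen ((τ.setVar 5 i).setVar 6 j) I := fun j => hI.congr rfl rfl
      have hP : ∀ j, Powers ((τ.setVar 5 i).setVar 6 j) r s κ := fun j x hx => by
        simp only [State.setVar_arr, a4]
        exact hp x (by simpa [e2] using hx)
      have hr' : ∀ j, r ≤ ((τ.setVar 5 i).setVar 6 j).var 2 := fun j => by simpa [e2] using hr
      rw [run_ite]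
      have hcond : (HExpr.and (.lt (.var 5) (.var 3)) (.and (.le (.const a) (sizeE 5))
          (.all 6 (.imp (.and (.lt (.var 6) (.var 3)) (subsetE 6 5))
            (.lt (degE 6) (thresholdE r s 6)))))).Holds (τ.setVar 5 i) ↔
          i < m ∧ a ≤ (C i).card ∧ ∀ j < m, C j ⊆ C i →
            (I.filter (C j ⊆ C ·)).card < SetPacking.threshold r s κ (C j).card := by
        have k1 : ∀ j, (subsetE 6 5).Holds ((τ.setVar 5 i).setVar 6 j) ↔ C j ⊆ C i := fun j => by
          rw [holds_subsetE (hR j) (by decide) (by decide)]; simp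
        have k2 : ∀ j, (degE 6).eval ((τ.setVar 5 i).setVar 6 j) =
            (I.filter (C j ⊆ C ·)).card := fun j => by
          rw [eval_degE (hR j) (hI' j) (by decide) (by decide)]; simp
        have k3 : ∀ j, (thresholdE r s 6).eval ((τ.setVar 5 i).setVar 6 j) =
            SetPacking.threshold r s κ (C j).card := fun j => by
          rw [eval_thresholdE (hR j) (hP j) (hr' j) (by decide)]; simp
        have k4 : (sizeE 5).eval (τ.setVar 5 i) = (C i).card := by
          rw [eval_sizeE hR' (by decide)]; simp
        simp only [holds_and, holds_lt, holds_le, holds_all, holds_imp, k1, k2, k3, k4, eval_var,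
          eval_const, State.setVar_var]
        simp only [if_true, show (3 : ℕ) ≠ 5 by decide, show (3 : ℕ) ≠ 6 by decide,
          show (2 : ℕ) ≠ 5 by decide, if_false, e2, e3, and_imp]
        exact and_congr_right fun _ => and_congr_right fun _ =>
          ⟨fun hh j hj => hh j (by omega) hj, fun hh j _ hj => hh j hj⟩
      have hmono : ∀ {J : Finset ℕ}, I ⊆ J → ∀ j, (I.filter (C j ⊆ C ·)).card ≤
          (J.filter (C j ⊆ C ·)).card := fun hIJ j =>
        Finset.card_le_card (Finset.filter_subset_filter _ hIJ)
      by_cases hc : i < m ∧ a ≤ (C i).card ∧ ∀ j < m, C j ⊆ C i →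
            (I.filter (C j ⊆ C ·)).card < SetPacking.threshold r s κ (C j).card
      · rw [if_pos (hcond.2 hc)]
        refine ⟨insert i I, ?_, ?_, ⟨?_, ?_⟩, ?_, ?_, ?_⟩
        · exact Finset.insert_subset (Finset.mem_range.2 hc.1) hIm
        · rw [Finset.range_add_one]; exact Finset.insert_subset_insert _ hIi
        · intro i'
          simp only [run_store, eval_var, eval_const, State.setArr_arr, State.setVar_var, if_true,
            State.setVar_arr, hI.arr, and_true, true_and, Finset.mem_insert]
          by_cases hi' : i' = i
          · simp [hi']
          · simp [hi']
        · intro i' hi'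
          rw [run_store, State.setArr_var, State.setVar_var, if_neg (by decide)]
          rcases Finset.mem_insert.1 hi' with rfl | hi'
          · omega
          · exact hI.lt i' hi'
        · intro i' hi'
          rcases Finset.mem_insert.1 hi' with rfl | hi'
          · exact hc.2.1
          · exact hIa i' hi'
        -- Only sets inside the added row gain a degree, and the test found them strictly below the
        -- threshold.
        · intro j hj
          rw [Finset.filter_insert]
          split_ifs with hji
          · exact (Finset.card_insert_le _ _).trans (hc.2.2 j hj hji)
          · exact hIdeg j hj
        · intro i' hi' hi'm hai' hnot
          rw [Finset.mem_insert, not_or] at hnot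
          obtain ⟨j, hj, hji, hh⟩ := hImax i' (by omega) hi'm hai' hnot.2
          exact ⟨j, hj, hji, hh.trans (hmono (Finset.subset_insert _ _) j)⟩
      · rw [if_neg (mt hcond.1 hc)]
        refine ⟨I, hIm, hIi.trans (Finset.range_subset_range.2 (Nat.le_succ i)),
          hI.congr rfl rfl, hIa, hIdeg, ?_⟩
        intro i' hi' hi'm hai' hnot
        by_cases hii : i' = i
        · subst hii
          push Not at hc
          exact hc hi'm hai'
        · exact hImax i' (by omega) hi'm hai' hnot)
  obtain ⟨I, hIm, -, hI, hIa, hIdeg, hImax⟩ := key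
  exact ⟨I, hIm, hI, hIa, hIdeg, fun i hi => hImax i (by omega) hi⟩

/-! ### The bipartite graph and the auction -/

/-- Vertex `var 5` is uncovered, row `var 6` has `r - 1` elements and is contained in a chosen row,
and together they form a clique. -/
def pairE (r : ℕ) : HExpr :=
  .and (.lt (.var 5) (.var 0)) (.and (.not (coveredE 5)) (.and (.lt (.var 6) (.var 3))
    (.and (.eq (sizeE 6) (.const (r - 1))) (.and (insideE 6) (joinedE 5 6)))))

/-- Store in array `5` which vertices and rows fit together. -/
def fillPairs (r : ℕ) : HProg :=
  .loop 5 (.loop 6 (.store 5 (.var 5) (.var 6) (.ite (pairE r) (.const 1) (.const 0))))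

theorem run_fillPairs {σ : State} {C : ℕ → Finset ℕ} {I : Finset ℕ} {r : ℕ} (h : Rows σ C)
    (hI : Chosen σ I) (hn : σ.var 0 ≤ σ.var 2) (hm : σ.var 3 ≤ σ.var 2)
    (h5 : ∀ o j, σ.arr 5 o j = 0) (o j : ℕ) :
    ((fillPairs r).run σ).arr 5 o j ≠ 0 ↔ o < σ.var 0 ∧ (¬ ∃ i ∈ I, o ∈ C i) ∧ j < σ.var 3 ∧
      (C j).card = r - 1 ∧ (∃ i ∈ I, C j ⊆ C i) ∧ ∀ u ∈ C j, σ.arr 0 o u ≠ 0 := by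
  classical
  rw [fillPairs, run_fill σ (fun o j => if o < σ.var 0 ∧ (¬ ∃ i ∈ I, o ∈ C i) ∧ j < σ.var 3 ∧
      (C j).card = r - 1 ∧ (∃ i ∈ I, C j ⊆ C i) ∧ ∀ u ∈ C j, σ.arr 0 o u ≠ 0 then 1 else 0)
      (by decide) (by decide) (by decide), h5]
  · have : ∀ (p : Prop) [Decidable p], ((if o < σ.var 2 ∧ j < σ.var 2 then (if p then 1 else 0) else 0) ≠ 0 ↔
      (o < σ.var 2 ∧ j < σ.var 2) ∧ p) := by
      intro p _; split_ifs <;> simp_all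
    rw [this]
    exact ⟨fun hh => hh.2, fun hh => ⟨⟨by omega, by omega⟩, hh⟩⟩
  · intro τ ha hv
    have hR : Rows τ C := h.congr (ha 2 (by decide)) (hv 2 (by decide) (by decide))
    have hI' : Chosen τ I := hI.congr (ha 3 (by decide)) (hv 2 (by decide) (by decide))
    rw [eval_ite]
    refine if_congr ?_ rfl rfl
    simp only [pairE, holds_and, holds_lt, holds_not, holds_eq, eval_sizeE hR (show 6 ≠ 10 by decide),
      holds_coveredE hR hI' (show 5 ≠ 11 by decide),
      holds_insideE hR hI' (show 6 ≠ 10 by decide) (show 6 ≠ 11 by decide),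
      holds_joinedE hR (show 5 ≠ 10 by decide) (show 6 ≠ 10 by decide), eval_var, eval_const,
      ha 0 (by decide), hv 0 (by decide) (by decide), hv 3 (by decide) (by decide)]

/-- Bidder `var 7` is free, and `var 8` is a cheapest item for it, of price less than `var 2`. -/
def canBidE : HExpr :=
  .and (.arr 5 (.var 7) (.var 8))
    (.and (.all 9 (.not (.eq (.arr 7 (.var 9) (.const 0)) (.add (.var 7) (.const 1)))))
      (.and (.lt (.arr 6 (.var 8) (.const 0)) (.var 2))
        (.all 9 (.imp (.arr 5 (.var 7) (.var 9))
          (.le (.arr 6 (.var 8) (.const 0)) (.arr 6 (.var 9) (.const 0)))))))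

/-- Bidder `var 7` bids for item `var 8` if possible. -/
def bid : HProg :=
  .ite canBidE (.seq
    (.store 6 (.var 8) (.const 0) (.add (.arr 6 (.var 8) (.const 0)) (.const 1)))
    (.store 7 (.var 8) (.const 0) (.add (.var 7) (.const 1))))

/-- Let each bidder once try to bid for each item. -/
def sweep : HProg := .loop 7 (.loop 8 bid)

/-- The auction: prices in array `6`, owners in array `7`. -/
def auction : HProg := .loop 5 (.loop 6 sweep)

/-- The prices in a state. -/
def State.price (σ : State) (j : ℕ) : ℕ := σ.arr 6 j 0

/-- The owners in a state. -/
def State.owner (σ : State) (j : ℕ) : ℕ := σ.arr 7 j 0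

section
variable {bip : ℕ → ℕ → Prop} {L m : ℕ}

/-- The program quantifies only over items below the loop bound; the items that are owned or seen by
a bidder are all below m < L. -/
theorem holds_canBidE {σ : State} (hσ : ∀ o j, σ.arr 5 o j ≠ 0 ↔ bip o j) (hL : σ.var 2 = L)
    (hm : m < L) (hbip : ∀ o j, bip o j → o < L ∧ j < m)
    (hv : Auction.Valid bip L σ.price σ.owner) :
    canBidE.Holds σ ↔ Auction.CanBid bip L σ.price σ.owner (σ.var 7) (σ.var 8) := by
  simp only [canBidE, holds_and, holds_arr, holds_all, holds_not, holds_eq, holds_lt, holds_imp,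
    holds_le, eval_var, eval_arr, eval_add, eval_const, State.setVar_var, State.setVar_arr, if_true,
    show (7 : ℕ) ≠ 9 by decide, show (8 : ℕ) ≠ 9 by decide, if_false, hσ, hL]
  refine and_congr_right fun _ => and_congr ?_ (and_congr_right fun _ => ?_)
  · refine ⟨fun h j' he => ?_, fun h j' _ => h j'⟩
    have := (hbip _ _ (hv.bip_of_owner _ _ he)).2
    exact h j' (by omega) he
  · refine ⟨fun h j' hj' => ?_, fun h j' _ => h j'⟩
    have := (hbip _ _ hj').2
    exact h j' (by omega) hj'

theorem run_bid {σ : State} (h : canBidE.Holds σ) :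
    (bid.run σ).price = Function.update σ.price (σ.var 8) (σ.price (σ.var 8) + 1) ∧
      (bid.run σ).owner = Function.update σ.owner (σ.var 8) (σ.var 7 + 1) := by
  rw [bid, run_ite, if_pos h]
  constructor <;>
  · funext j
    by_cases hj : j = σ.var 8 <;> simp [State.price, State.owner, hj]

theorem run_bid_of_not {σ : State} (h : ¬ canBidE.Holds σ) : bid.run σ = σ := by
  rw [bid, run_ite, if_neg h]

theorem sum_update_price {p : ℕ → ℕ} {j : ℕ} (hj : j < m) :
    ∑ i ∈ Finset.range m, p i + 1 ≤ ∑ i ∈ Finset.range m, Function.update p j (p j + 1) i := by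
  refine Nat.succ_le_of_lt (Finset.sum_lt_sum (fun i _ => ?_) ⟨j, Finset.mem_range.2 hj, ?_⟩)
  swap
  · rw [Function.update_self]; exact Nat.lt_succ_self _
  by_cases hi : i = j
  · subst hi; simp
  · simp [hi]

theorem run_sweep {σ : State} (hσ : ∀ o j, σ.arr 5 o j ≠ 0 ↔ bip o j) (hL : σ.var 2 = L)
    (hm : m < L) (hbip : ∀ o j, bip o j → o < L ∧ j < m)
    (hv : Auction.Valid bip L σ.price σ.owner) :
    Auction.Valid bip L (sweep.run σ).price (sweep.run σ).owner ∧
      ((∑ j ∈ Finset.range m, σ.price j + 1 ≤ ∑ j ∈ Finset.range m, (sweep.run σ).price j ∧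
          ∃ o j, Auction.CanBid bip L σ.price σ.owner o j) ∨
        ((sweep.run σ).price = σ.price ∧ (sweep.run σ).owner = σ.owner ∧
          ∀ o j, ¬ Auction.CanBid bip L σ.price σ.owner o j)) := by
  -- Either the sweep has already seen a bid and raised the total price, or nothing has changed and
  -- no pair tried so far could bid at the start.
  let Inv : (ℕ → ℕ → Prop) → State → Prop := fun done τ =>
    Auction.Valid bip L τ.price τ.owner ∧
      ((∑ j ∈ Finset.range m, σ.price j + 1 ≤ ∑ j ∈ Finset.range m, τ.price j ∧
          ∃ o j, Auction.CanBid bip L σ.price σ.owner o j) ∨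
        (τ.price = σ.price ∧ τ.owner = σ.owner ∧
          ∀ o j, done o j → ¬ Auction.CanBid bip L σ.price σ.owner o j))
  have step : ∀ (done : ℕ → ℕ → Prop) (τ : State), τ.arr 5 = σ.arr 5 → τ.var 2 = L → Inv done τ →
      Inv (fun o j => done o j ∨ (o = τ.var 7 ∧ j = τ.var 8)) (bid.run τ) := by
    rintro done τ h5 h2 ⟨hval, hor⟩
    have hc := holds_canBidE (σ := τ) (fun o j => by rw [h5]; exact hσ o j) h2 hm hbip hval
    by_cases h : canBidE.Holds τ
    · obtain ⟨hp, hw⟩ := run_bid h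
      refine ⟨by rw [hp, hw]; exact hval.bid (hc.1 h), Or.inl ?_⟩
      have hlt := sum_update_price (p := τ.price) (hbip _ _ (hc.1 h).1).2
      rw [hp]
      rcases hor with ⟨h1, h2⟩ | ⟨h1, h2, -⟩
      · exact ⟨by omega, h2⟩
      · rw [h1] at hlt ⊢
        exact ⟨hlt, _, _, h2 ▸ h1 ▸ hc.1 h⟩
    · rw [run_bid_of_not h]
      refine ⟨hval, hor.imp id ?_⟩
      rintro ⟨h1, h2, h3⟩
      refine ⟨h1, h2, fun o j hd => ?_⟩
      rcases hd with hd | ⟨rfl, rfl⟩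
      · exact h3 o j hd
      · rw [← h1, ← h2]; exact mt hc.2 h
  have weaken : ∀ {d d' : ℕ → ℕ → Prop} {τ : State}, Inv d τ → (∀ o j, d' o j → d o j) →
      Inv d' τ := fun h hd => ⟨h.1, h.2.imp id fun hh =>
        ⟨hh.1, hh.2.1, fun o j ho => hh.2.2 o j (hd o j ho)⟩⟩
  have key := run_loop (c := .loop 8 bid) (x := 7) σ (fun i τ => Inv (fun o j => o < i ∧ j < L) τ)
    ⟨hv, Or.inr ⟨rfl, rfl, by simp⟩⟩
    (by
      intro i hi τ ha hvar hI
      have e5 : τ.arr 5 = σ.arr 5 := ha 5 (by simp [NotStores, bid])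
      have e2 : τ.var 2 = L := (hvar 2 (by decide) (by simp [NotAssigns, bid])).trans hL
      have inner := run_loop (c := bid) (x := 8) (τ.setVar 7 i)
        (fun i' ρ => Inv (fun o j => (o < i ∧ j < L) ∨ (o = i ∧ j < i')) ρ)
        (weaken (d := fun o j => o < i ∧ j < L) hI (by simp))
        (by
          intro i' hi' ρ ha' hvar' hI'
          have f5 : ρ.arr 5 = σ.arr 5 := (ha' 5 (by simp [NotStores, bid])).trans e5
          have f2 : ρ.var 2 = L := (hvar' 2 (by decide) (by simp [NotAssigns, bid])).trans
            (by simpa using e2)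
          have f7 : ρ.var 7 = i := (hvar' 7 (by decide) (by simp [NotAssigns, bid])).trans
            (by simp)
          refine weaken (step _ (ρ.setVar 8 i') f5 (by simpa using f2) hI') ?_
          simp only [State.setVar_var, if_true, show (7 : ℕ) ≠ 8 by decide, if_false, f7]
          intro o j h
          omega)
      refine weaken inner ?_
      simp only [State.setVar_var, show (2 : ℕ) ≠ 7 by decide, if_false, e2]
      intro o j h
      omega)
  obtain ⟨k1, k2⟩ := key
  refine ⟨k1, k2.imp id fun ⟨h1, h2, h3⟩ => ⟨h1, h2, fun o j hb => ?_⟩⟩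
  have := hbip o j hb.1
  exact h3 o j (by omega) hb

/-- The total price is the clock: every sweep raises it until no bid is left. After L² sweeps it
would be at least L², but m items of price at most L give only mL < L². -/
theorem run_auction {σ : State} (hσ : ∀ o j, σ.arr 5 o j ≠ 0 ↔ bip o j) (hL : σ.var 2 = L)
    (hm : m < L) (hbip : ∀ o j, bip o j → o < L ∧ j < m)
    (h6 : ∀ j, σ.arr 6 j 0 = 0) (h7 : ∀ j, σ.arr 7 j 0 = 0) :
    Auction.Valid bip L (auction.run σ).price (auction.run σ).owner ∧
      ∀ o j, ¬ Auction.CanBid bip L (auction.run σ).price (auction.run σ).owner o j := by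
  let Inv : ℕ → State → Prop := fun t τ => Auction.Valid bip L τ.price τ.owner ∧
    (t ≤ ∑ j ∈ Finset.range m, τ.price j ∨ ∀ o j, ¬ Auction.CanBid bip L τ.price τ.owner o j)
  have step : ∀ t (τ : State), τ.arr 5 = σ.arr 5 → τ.var 2 = L → Inv t τ →
      Inv (t + 1) (sweep.run τ) := by
    rintro t τ h5 h2 ⟨hval, hor⟩
    obtain ⟨hval', h⟩ := run_sweep (σ := τ) (fun o j => by rw [h5]; exact hσ o j) h2 hm hbip hval
    refine ⟨hval', ?_⟩
    rcases h with ⟨hlt, o, j, hb⟩ | ⟨h1, h2, h3⟩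
    · refine Or.inl ?_
      rcases hor with h | h
      · omega
      · exact absurd hb (h o j)
    · exact Or.inr (by rw [h1, h2]; exact h3)
  have key := run_loop (c := .loop 6 sweep) (x := 5) σ (fun i τ => Inv (i * L) τ)
    ⟨by
      have hp : σ.price = fun _ => 0 := funext h6
      have hw : σ.owner = fun _ => 0 := funext h7
      rw [hp, hw]; exact Auction.Valid.zero _ _, Or.inl (by simp)⟩
    (by
      intro i hi τ ha hvar hI
      have e5 : τ.arr 5 = σ.arr 5 := ha 5 (by simp [NotStores, sweep, bid])
      have e2 : τ.var 2 = L := (hvar 2 (by decide) (by simp [NotAssigns, sweep, bid])).trans hL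
      have inner := run_loop (c := sweep) (x := 6) (τ.setVar 5 i)
        (fun i' ρ => Inv (i * L + i') ρ) hI
        (by
          intro i' hi' ρ ha' hvar' hI'
          have f5 : ρ.arr 5 = σ.arr 5 := (ha' 5 (by simp [NotStores, sweep, bid])).trans e5
          have f2 : ρ.var 2 = L := (hvar' 2 (by decide) (by simp [NotAssigns, sweep, bid])).trans
            (by simpa using e2)
          exact step _ (ρ.setVar 6 i') f5 (by simpa using f2) hI')
      simp only [State.setVar_var, show (2 : ℕ) ≠ 5 by decide, if_false, e2] at inner
      rw [Nat.succ_mul]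
      exact inner)
  rw [hL] at key
  refine ⟨key.1, key.2.resolve_left fun h => ?_⟩
  have hle : ∑ j ∈ Finset.range m, (auction.run σ).price j ≤ m * L := by
    exact (Finset.sum_le_card_nsmul (Finset.range m) _ L fun j _ => key.1.le_cap j).trans_eq
      (by simp)
  have h' : L * L ≤ ∑ j ∈ Finset.range m, (auction.run σ).price j := h
  have := Nat.mul_lt_mul_of_pos_right hm (show 0 < L by omega)
  omega

end

/-! ### The output -/

/-- Mark in array `8` the covered vertices and the owners. -/
def markKept : HProg :=
  .loop 5 (.loop 6 (.store 8 (.var 5) (.var 6) (.ite (.or (coveredE 5)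
    (.ex 9 (.eq (.arr 7 (.var 9) (.const 0)) (.add (.var 5) (.const 1))))) (.const 1) (.const 0))))

theorem run_markKept {σ : State} {C : ℕ → Finset ℕ} {I W : Finset ℕ} (h : Rows σ C)
    (hI : Chosen σ I) (h8 : ∀ v, σ.arr 8 v 0 = 0) (hWL : ∀ v ∈ W, v < σ.var 2)
    (hW : ∀ v, v ∈ W ↔ (∃ i ∈ I, v ∈ C i) ∨ ∃ j < σ.var 2, σ.owner j = v + 1) (v : ℕ) :
    (markKept.run σ).arr 8 v 0 = if v ∈ W then 1 else 0 := by
  rw [markKept, run_fill σ (fun v _ => if v ∈ W then 1 else 0) (by decide) (by decide) (by decide), h8]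
  · by_cases hv : v ∈ W
    · have := hWL v hv
      simp [hv, this, show 0 < σ.var 2 by omega]
    · simp [hv]
  · intro τ ha hv
    have e2 : τ.var 2 = σ.var 2 := hv 2 (by decide) (by decide)
    have hR : Rows τ C := h.congr (ha 2 (by decide)) e2
    have hI' : Chosen τ I := hI.congr (ha 3 (by decide)) e2
    rw [eval_ite]
    refine if_congr ?_ rfl rfl
    rw [hW]
    simp only [holds_or, holds_coveredE hR hI' (show 5 ≠ 11 by decide), holds_ex, holds_eq, eval_arr,
      eval_var, eval_const, eval_add, State.setVar_var, State.setVar_arr, if_true,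
      show (5 : ℕ) ≠ 9 by decide, if_false, ha 7 (by decide), e2, State.owner]

/-- The number of marked vertices below vertex `x`. -/
def rankE (x : ℕ) : HExpr :=
  .sum 9 (.ite (.and (.lt (.var 9) (.var x)) (.arr 8 (.var 9) (.const 0))) (.const 1) (.const 0))

theorem eval_rankE {σ : State} {W : Finset ℕ} (h8 : ∀ v, σ.arr 8 v 0 = if v ∈ W then 1 else 0)
    (hWL : ∀ v ∈ W, v < σ.var 2) {x : ℕ} (hx : x ≠ 9) :
    (rankE x).eval σ = (W.filter (· < σ.var x)).card := by
  simp only [rankE, eval_sum, eval_ite, holds_and, holds_lt, holds_arr, eval_var, eval_const,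
    State.setVar_var, State.setVar_arr, if_true, if_neg hx, h8]
  rw [← Finset.sum_filter, ← Finset.card_eq_sum_ones]
  congr 1
  ext v
  simp only [Finset.mem_filter, Finset.mem_range, ne_eq, ite_eq_right_iff, one_ne_zero, imp_false,
    not_not]
  exact ⟨fun hv => ⟨hv.2.2, hv.2.1⟩, fun hv => ⟨hWL v hv.1, hv.2, hv.1⟩⟩

/-- Copy array `0` to array `9`. -/
def copyGraph : HProg :=
  .loop 5 (.loop 6 (.store 9 (.var 5) (.var 6) (.arr 0 (.var 5) (.var 6))))

/-- Write the subgraph on the marked vertices to array `0`. -/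
def relabel : HProg :=
  .loop 5 (.loop 6 (.ite (.and (.arr 8 (.var 5) (.const 0)) (.arr 8 (.var 6) (.const 0)))
    (.store 0 (rankE 5) (rankE 6) (.arr 9 (.var 5) (.var 6)))))

/-- Ranks serve as the vertex names of the kernel; injectivity ensures that no entry of the new
matrix is overwritten by another pair. -/
theorem rank_injOn (W : Finset ℕ) : Set.InjOn (fun v => (W.filter (· < v)).card) W := by
  have key : ∀ u ∈ W, ∀ v ∈ W, u < v → (W.filter (· < u)).card < (W.filter (· < v)).card := by
    intro u hu v hv huv
    refine Finset.card_lt_card (Finset.ssubset_iff_of_subset ?_ |>.2 ⟨u, ?_, ?_⟩)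
    · intro x hx
      rw [Finset.mem_filter] at hx ⊢
      exact ⟨hx.1, hx.2.trans huv⟩
    · exact Finset.mem_filter.2 ⟨hu, huv⟩
    · simp
  intro u hu v hv he
  rcases lt_trichotomy u v with h | h | h
  · exact absurd he (key u hu v hv h).ne
  · exact h
  · exact absurd he (key v hv u hu h).ne'

/-- The old matrix is read from its copy in array `9`, since array `0` is overwritten during the
loop. -/
theorem run_relabel {σ : State} {W : Finset ℕ} (h8 : ∀ v, σ.arr 8 v 0 = if v ∈ W then 1 else 0)
    (hWL : ∀ v ∈ W, v < σ.var 2) : ∀ u ∈ W, ∀ v ∈ W,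
    (relabel.run σ).arr 0 (W.filter (· < u)).card (W.filter (· < v)).card = σ.arr 9 u v := by
  let Inv : (ℕ → ℕ → Prop) → State → Prop := fun done τ => ∀ u ∈ W, ∀ v ∈ W, done u v →
    τ.arr 0 (W.filter (· < u)).card (W.filter (· < v)).card = σ.arr 9 u v
  let c : HProg := .ite (.and (.arr 8 (.var 5) (.const 0)) (.arr 8 (.var 6) (.const 0)))
    (.store 0 (rankE 5) (rankE 6) (.arr 9 (.var 5) (.var 6)))
  have step : ∀ (done : ℕ → ℕ → Prop) (τ : State), τ.arr 8 = σ.arr 8 → τ.arr 9 = σ.arr 9 →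
      τ.var 2 = σ.var 2 → Inv done τ →
      Inv (fun u v => done u v ∨ (u = τ.var 5 ∧ v = τ.var 6)) (c.run τ) := by
    intro done τ e8 e9 e2 hI u hu v hv hd
    have k8 : ∀ v, τ.arr 8 v 0 = if v ∈ W then 1 else 0 := fun v => by rw [e8]; exact h8 v
    have hcond : (HExpr.and (.arr 8 (.var 5) (.const 0)) (.arr 8 (.var 6) (.const 0))).Holds τ ↔
        τ.var 5 ∈ W ∧ τ.var 6 ∈ W := by
      simp [k8]
    simp only [c, run_ite, hcond]
    split_ifs with hW
    · rw [run_store, eval_rankE k8 (by rw [e2]; exact hWL) (by decide),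
        eval_rankE k8 (by rw [e2]; exact hWL) (by decide)]
      simp only [State.setArr_arr, eval_arr, eval_var, e9]
      split_ifs with h
      · rw [rank_injOn W hu hW.1 h.2.1, rank_injOn W hv hW.2 h.2.2]
      · refine hI u hu v hv (hd.resolve_right ?_)
        rintro ⟨rfl, rfl⟩
        exact h (by simp)
    · refine hI u hu v hv (hd.resolve_right ?_)
      rintro ⟨rfl, rfl⟩
      exact hW ⟨hu, hv⟩
  have key := run_loop (c := .loop 6 c) (x := 5) σ
    (fun i τ => Inv (fun u v => u < i ∧ v < σ.var 2) τ) (by simp [Inv])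
    (by
      intro i hi τ ha hvar hI
      have e8 : τ.arr 8 = σ.arr 8 := ha 8 (by simp [NotStores, c])
      have e9 : τ.arr 9 = σ.arr 9 := ha 9 (by simp [NotStores, c])
      have e2 : τ.var 2 = σ.var 2 := hvar 2 (by decide) (by simp [NotAssigns, c])
      have inner := run_loop (c := c) (x := 6) (τ.setVar 5 i)
        (fun i' ρ => Inv (fun u v => (u < i ∧ v < σ.var 2) ∨ (u = i ∧ v < i')) ρ)
        (fun u hu v hv hd => hI u hu v hv (by simpa using hd))
        (by
          intro i' hi' ρ ha' hvar' hI'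
          have f8 : ρ.arr 8 = σ.arr 8 := (ha' 8 (by simp [NotStores, c])).trans e8
          have f9 : ρ.arr 9 = σ.arr 9 := (ha' 9 (by simp [NotStores, c])).trans e9
          have f2 : ρ.var 2 = σ.var 2 := (hvar' 2 (by decide) (by simp [NotAssigns, c])).trans
            (by simpa using e2)
          have f5 : ρ.var 5 = i := (hvar' 5 (by decide) (by simp [NotAssigns, c])).trans
            (by simp)
          intro u hu v hv hd
          refine step _ (ρ.setVar 6 i') f8 f9 (by simpa using f2) hI' u hu v hv ?_
          simp only [State.setVar_var, if_true, show (5 : ℕ) ≠ 6 by decide, if_false, f5]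
          omega)
      intro u hu v hv hd
      refine inner u hu v hv ?_
      simp only [State.setVar_var, show (2 : ℕ) ≠ 5 by decide, if_false, e2]
      omega)
  exact fun u hu v hv => key u hu v hv ⟨hWL u hu, hWL v hv⟩

end RAM

open RAM HExpr HProg SetPacking

/-! ### Correctness of the kernelization -/

theorem deg_image {C : ℕ → Finset ℕ} {I : Finset ℕ} (hinj : Set.InjOn C I) (Q : Finset ℕ) :
    deg (I.image C) Q = (I.filter (Q ⊆ C ·)).card := by
  rw [deg, Finset.filter_image, Finset.card_image_of_injOn]
  exact hinj.mono (Finset.coe_subset.2 (Finset.filter_subset _ _))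

/-- Joins the two exchange arguments with the crown given by the auction, translating between row
indices and sets; the head consists of the rows priced above the level `l`. -/
theorem hasPacking_kept {H : SimpleGraph ℕ} {C : ℕ → Finset ℕ} {I kept : Finset ℕ}
    {n m a r s k L : ℕ} {p w : ℕ → ℕ} (hsr : s + 2 ≤ r) (har : a ≤ r) (hmL : m < L)
    (hC : IsListing C m fun A => A ⊆ Finset.range n ∧ H.IsClique A ∧ A.card ≤ r)
    (hIm : I ⊆ Finset.range m) (hIa : ∀ i ∈ I, a ≤ (C i).card)
    (hIdeg : ∀ j < m, (I.filter (C j ⊆ C ·)).card ≤ threshold r s k (C j).card)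
    (hImax : ∀ i < m, a ≤ (C i).card → i ∉ I → ∃ j < m, C j ⊆ C i ∧
        threshold r s k (C j).card ≤ (I.filter (C j ⊆ C ·)).card)
    {bip : ℕ → ℕ → Prop} (hbip : ∀ o j, bip o j ↔ o < n ∧ (¬ ∃ i ∈ I, o ∈ C i) ∧ j < m ∧
      (C j).card = r - 1 ∧ (∃ i ∈ I, C j ⊆ C i) ∧ ∀ u ∈ C j, H.Adj o u)
    (hv : Auction.Valid bip L p w) (hend : ∀ o j, ¬ Auction.CanBid bip L p w o j)
    (hkept : ∀ o j, w j = o + 1 → o ∈ kept)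
    (h : HasPacking (cliqueSets H a r (Finset.range n)) s k) :
    HasPacking (cliqueSets H a r (I.biUnion C ∪ kept)) s k := by
  classical
  rcases Nat.eq_zero_or_pos k with rfl | hk
  · exact ⟨∅, by simp, by simp, by simp [Overlap]⟩
  have hinj : Set.InjOn C I := fun i hi j hj hij =>
    hC.inj i (Finset.mem_range.1 (hIm hi)) j (Finset.mem_range.1 (hIm hj)) hij
  have hCi : ∀ i < m, C i ⊆ Finset.range n ∧ H.IsClique (C i : Set ℕ) ∧ (C i).card ≤ r :=
    fun i hi => (hC.mem _).1 ⟨i, hi, rfl⟩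
  have hRS : I.image C ⊆ cliqueSets H a r (Finset.range n) := by
    intro A hA
    obtain ⟨i, hi, rfl⟩ := Finset.mem_image.1 hA
    obtain ⟨h1, h2, h3⟩ := hCi i (Finset.mem_range.1 (hIm hi))
    exact mem_cliqueSets.2 ⟨h1, h2, hIa i hi, h3⟩
  have hS : ∀ A ∈ cliqueSets H a r (Finset.range n), A.card ≤ r := fun A hA =>
    (mem_cliqueSets.1 hA).2.2.2
  have hdeg : ∀ Q, deg (I.image C) Q ≤ threshold r s k Q.card := by
    intro Q
    -- Testing listed sets is enough: a subset of a small clique is itself a listed clique, so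
    -- unlisted sets have degree 0.
    by_cases hQ : ∃ j < m, C j = Q
    · obtain ⟨j, hj, rfl⟩ := hQ
      rw [deg_image hinj]
      exact hIdeg j hj
    · have : deg (I.image C) Q = 0 := by
        rw [deg, Finset.card_eq_zero, Finset.filter_eq_empty_iff]
        intro A hA hQA
        obtain ⟨h1, h2, -, h3⟩ := mem_cliqueSets.1 (hRS hA)
        exact hQ ((hC.mem Q).2 ⟨hQA.trans h1, h2.subset (by exact_mod_cast hQA),
          (Finset.card_le_card hQA).trans h3⟩)
      omega
  have hmax : ∀ A ∈ cliqueSets H a r (Finset.range n), A ∉ I.image C →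
      ∃ Q ⊆ A, threshold r s k Q.card ≤ deg (I.image C) Q := by
    intro A hA hAR
    obtain ⟨h1, h2, h3, h4⟩ := mem_cliqueSets.1 hA
    obtain ⟨i, hi, rfl⟩ := (hC.mem A).2 ⟨h1, h2, h4⟩
    obtain ⟨j, hj, hji, hle⟩ := hImax i hi h3 fun hiI => hAR (Finset.mem_image_of_mem C hiI)
    exact ⟨C j, hji, by rwa [deg_image hinj]⟩
  obtain ⟨P, hPS, hPk, hP⟩ := h
  obtain ⟨P, hPS, hPk, hP, hnear⟩ := exists_overlap_near hsr hk hRS hS hdeg hmax hPS hPk hP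
  obtain ⟨l, hl1, hl2, hl3⟩ := hv.exists_level hmL (fun o j hb => ((hbip o j).1 hb).2.2.1) hend
  -- The matching is a function of the set and not of its index, which is possible because the rows
  -- are distinct.
  have hg : ∀ Q : Finset ℕ, ∃ o, ∀ j < m, C j = Q → l < p j → w j = o + 1 := by
    intro Q
    by_cases hQ : ∃ j < m, C j = Q ∧ l < p j
    · obtain ⟨j, hj, rfl, hlj⟩ := hQ
      obtain ⟨o, ho⟩ := Nat.exists_eq_succ_of_ne_zero (hl1 j hlj)
      exact ⟨o, fun j' hj' he _ => by rw [hC.inj j' hj' j hj he]; exact ho⟩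
    · exact ⟨0, fun j hj he hlj => absurd ⟨j, hj, he, hlj⟩ hQ⟩
  choose g hg using hg
  have hbip' : ∀ o, ∀ j < m, bip o j ↔ o ∉ I.biUnion C ∧ (C j).card = r - 1 ∧
      (∃ B ∈ I.image C, C j ⊆ B) ∧ insert o (C j) ∈ cliqueSets H a r (Finset.range n) := by
    intro o j hj
    rw [hbip, mem_cliqueSets]
    simp only [Finset.mem_biUnion, Finset.mem_image, exists_exists_and_eq_and]
    constructor
    · rintro ⟨h1, h2, -, h3, ⟨i, hi, hji⟩, h4⟩
      have hoj : o ∉ C j := fun h => h2 ⟨i, hi, hji h⟩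
      refine ⟨h2, h3, ⟨i, hi, hji⟩, Finset.insert_subset (Finset.mem_range.2 h1) (hCi j hj).1, ?_,
        ?_, ?_⟩
      · rw [Finset.coe_insert]
        exact (hCi j hj).2.1.insert fun u hu _ => h4 u hu
      · rw [Finset.card_insert_of_notMem hoj]; omega
      · rw [Finset.card_insert_of_notMem hoj]; omega
    · rintro ⟨h2, h3, ⟨i, hi, hji⟩, h5, h6, -⟩
      refine ⟨Finset.mem_range.1 (h5 (Finset.mem_insert_self _ _)), h2, hj, h3, ⟨i, hi, hji⟩,
        fun u hu => ?_⟩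
      refine h6 (by simp) (by simp [hu]) ?_
      rintro rfl
      exact h2 ⟨i, hi, hji hu⟩
  have hlisted : ∀ Q, (∃ B ∈ I.image C, Q ⊆ B) → ∃ j < m, C j = Q := by
    rintro Q ⟨B, hB, hQB⟩
    obtain ⟨h1, h2, -, h3⟩ := mem_cliqueSets.1 (hRS hB)
    exact (hC.mem Q).2 ⟨hQB.trans h1, h2.subset (by exact_mod_cast hQB),
      (Finset.card_le_card hQB).trans h3⟩
  obtain ⟨P', hP'S, hP'k, hP', hP'W⟩ := exists_overlap_kept (S := cliqueSets H a r (Finset.range n))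
    (R := I.image C) (cov := I.biUnion C) (kept := kept) hsr hS
    (by
      intro B hB
      obtain ⟨i, hi, rfl⟩ := Finset.mem_image.1 hB
      exact Finset.subset_biUnion_of_mem C hi)
    (bip := fun o Q => o ∉ I.biUnion C ∧ Q.card = r - 1 ∧
      (∃ B ∈ I.image C, Q ⊆ B) ∧ insert o Q ∈ cliqueSets H a r (Finset.range n))
    (fun _ _ => Iff.rfl) (T := fun Q => ∃ j < m, C j = Q ∧ l < p j) (g := g)
    (by
      rintro Q ⟨j, hj, rfl, hlj⟩
      exact (hbip' _ j hj).1 (hv.bip_of_owner _ _ (hg _ j hj rfl hlj)))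
    (by
      rintro Q ⟨j, hj, rfl, hlj⟩
      exact hkept _ j (hg _ j hj rfl hlj))
    (by
      rintro Q Q' ⟨j, hj, rfl, hlj⟩ ⟨j', hj', rfl, hlj'⟩ he
      have h1 := hg _ j hj rfl hlj
      have h2 := hg _ j' hj' rfl hlj'
      rw [← he] at h2
      rw [hv.owner_inj j j' _ h1 h2])
    (by
      rintro Q Q' ⟨j, hj, rfl, hlj⟩ hb
      obtain ⟨j', hj', rfl⟩ := hlisted Q' hb.2.2.1
      exact ⟨j', hj', rfl, hl2 j _ j' hlj (hg _ j hj rfl hlj) ((hbip' _ j' hj').2 hb)⟩)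
    (by
      rintro o Q ho hb
      obtain ⟨j, hj, rfl⟩ := hlisted Q hb.2.2.1
      exact ⟨j, hj, rfl, hl3 o j (fun j' hj' => ho (hkept o j' hj')) ((hbip' o j hj).2 hb)⟩)
    hPS hPk hP hnear
  refine ⟨P', fun A hA => ?_, hP'k, hP'⟩
  obtain ⟨-, h⟩ := mem_cliqueSets.1 (hP'S hA)
  exact mem_cliqueSets.2 ⟨hP'W A hA, h⟩

/-- Covered vertices number at most r|R|. Owners are no more than owned items, which are distinct
(r-1)-subsets of members of R, so there are again at most r|R|. -/
theorem card_kept_le {C : ℕ → Finset ℕ} {I kept : Finset ℕ} {m r s k : ℕ} {w : ℕ → ℕ}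
    (hsr : s + 2 ≤ r) (hCr : ∀ i ∈ I, (C i).card ≤ r)
    (hIcard : I.card ≤ r ^ s * (r * k) ^ (r - s - 1))
    (hinj : ∀ i < m, ∀ j < m, C i = C j → i = j)
    (hw : ∀ j o, w j = o + 1 → j < m ∧ (C j).card = r - 1 ∧ ∃ i ∈ I, C j ⊆ C i)
    (hkept : ∀ o ∈ kept, ∃ j, w j = o + 1) :
    (I.biUnion C ∪ kept).card ≤ 2 * r ^ r * k ^ (r - s - 1) := by
  classical
  have h1 : (I.biUnion C).card ≤ I.card * r := Finset.card_biUnion_le_card_mul _ _ r hCr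
  let J := (Finset.range m).filter fun j => w j ≠ 0
  have hJ : J.card ≤ I.card * r := by
    have hJi : (J.image C).card = J.card := by
      refine Finset.card_image_of_injOn fun i hi j hj hij => ?_
      simp only [J, Finset.coe_filter, Set.mem_ofPred_eq, Finset.mem_range] at hi hj
      exact hinj i hi.1 j hj.1 hij
    rw [← hJi]
    refine (card_subsets_le (R := I.image C) (by omega) ?_ ?_).trans
      (Nat.mul_le_mul_right r Finset.card_image_le)
    · intro A hA
      obtain ⟨i, hi, rfl⟩ := Finset.mem_image.1 hA
      exact hCr i hi
    · intro Q hQ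
      obtain ⟨j, hj, rfl⟩ := Finset.mem_image.1 hQ
      obtain ⟨o, ho⟩ := Nat.exists_eq_succ_of_ne_zero (Finset.mem_filter.1 hj).2
      obtain ⟨-, h2, i, hi, hji⟩ := hw j o ho
      exact ⟨h2, C i, Finset.mem_image_of_mem C hi, hji⟩
  have h2 : kept.card ≤ J.card := by
    refine (Finset.card_le_card (t := J.image fun j => w j - 1) ?_).trans Finset.card_image_le
    intro o ho
    obtain ⟨j, hj⟩ := hkept o ho
    refine Finset.mem_image.2 ⟨j, Finset.mem_filter.2 ⟨Finset.mem_range.2 (hw j o hj).1, ?_⟩, ?_⟩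
    · omega
    · omega
  -- The exponents of r add up as s + (r - s - 1) + 1 = r.
  have h3 : (r ^ s * (r * k) ^ (r - s - 1)) * r = r ^ r * k ^ (r - s - 1) := by
    rw [mul_pow]
    conv_rhs => rw [show r ^ r = r ^ (s + (r - s - 1) + 1) by congr 1; omega]
    ring
  have h4 := Nat.mul_le_mul_right r hIcard
  have h5 := Finset.card_union_le (I.biUnion C) kept
  rw [h3] at h4
  have : 2 * r ^ r * k ^ (r - s - 1) = 2 * (r ^ r * k ^ (r - s - 1)) := by ring
  omega

/-! ### The assembled programs and their loop bound. -/

namespace RAM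

/-- The kernelization, for loop bound `var 2`. -/
def kernelProg (a r s : ℕ) : HProg :=
  .seq (powers r s) (.seq (listCliques r) (.seq (choose a r s) (.seq (fillPairs r) (.seq auction
    (.seq markKept (.seq copyGraph (.seq relabel
      (.assign 0 (.sum 9 (.arr 8 (.var 9) (.const 0)))))))))))

/-- The size bound holds for every k, but packings are transferred only when k ≤ L, where the
computed thresholds are those for k itself. -/
theorem run_kernelProg {σ : State} {H : SimpleGraph ℕ} {n a r s k L : ℕ} (hsr : s + 2 ≤ r)
    (har : a ≤ r) (h0 : σ.var 0 = n) (h1 : σ.var 1 = k) (h2 : σ.var 2 = L) (hn : n ≤ L)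
    (hL : (n + 1) ^ r < L) (hrL : r ≤ L) (hadj : ∀ u v, σ.arr 0 u v ≠ 0 ↔ H.Adj u v)
    (hz : ∀ b i j, b ≠ 0 → σ.arr b i j = 0) :
    ∃ W ⊆ Finset.range n, W.card ≤ 2 * r ^ r * (min k L) ^ (r - s - 1) ∧
      (k ≤ L → HasPacking (cliqueSets H a r (Finset.range n)) s k →
        HasPacking (cliqueSets H a r W) s k) ∧
      ((kernelProg a r s).run σ).var 0 = W.card ∧ ((kernelProg a r s).run σ).var 1 = k ∧
      ∀ u ∈ W, ∀ v ∈ W, ((kernelProg a r s).run σ).arr 0 (W.filter (· < u)).card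
        (W.filter (· < v)).card = σ.arr 0 u v := by
  classical
  -- The intermediate states stay opaque; only the frame facts `v1`, …, `a8` and the specification
  -- of each phase are used.
  obtain ⟨σ₁, hσ₁⟩ : ∃ τ, τ = (powers r s).run σ := ⟨_, rfl⟩
  obtain ⟨σ₂, hσ₂⟩ : ∃ τ, τ = (listCliques r).run σ₁ := ⟨_, rfl⟩
  obtain ⟨σ₃, hσ₃⟩ : ∃ τ, τ = (choose a r s).run σ₂ := ⟨_, rfl⟩
  obtain ⟨σ₄, hσ₄⟩ : ∃ τ, τ = (fillPairs r).run σ₃ := ⟨_, rfl⟩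
  obtain ⟨σ₅, hσ₅⟩ : ∃ τ, τ = auction.run σ₄ := ⟨_, rfl⟩
  obtain ⟨σ₆, hσ₆⟩ : ∃ τ, τ = markKept.run σ₅ := ⟨_, rfl⟩
  obtain ⟨σ₇, hσ₇⟩ : ∃ τ, τ = copyGraph.run σ₆ := ⟨_, rfl⟩
  obtain ⟨σ₈, hσ₈⟩ : ∃ τ, τ = relabel.run σ₇ := ⟨_, rfl⟩
  have hrun : (kernelProg a r s).run σ =
      σ₈.setVar 0 ((HExpr.sum 9 (.arr 8 (.var 9) (.const 0))).eval σ₈) := by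
    simp only [kernelProg, run_seq, run_assign, hσ₁, hσ₂, hσ₃, hσ₄, hσ₅, hσ₆, hσ₇, hσ₈]
  have v1 : ∀ y, y ≠ 5 → σ₁.var y = σ.var y := fun y hy => by
    rw [hσ₁]
    exact run_var (by simp [powers, NotAssigns, hy]) _
  have a1 : ∀ b, b ≠ 4 → σ₁.arr b = σ.arr b := fun b hb => by
    rw [hσ₁]
    exact run_arr (by simp [powers, NotStores, hb]) _
  have v2 : ∀ y, y < 3 → σ₂.var y = σ₁.var y := fun y hy => by
    rw [hσ₂]
    exact run_var (by interval_cases y <;> simp [listCliques, extendRows, appendRow, NotAssigns]) _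
  have a2 : ∀ b, b ≠ 2 → σ₂.arr b = σ₁.arr b := fun b hb => by
    rw [hσ₂]
    exact run_arr (by simp [listCliques, extendRows, appendRow, NotStores, hb]) _
  have v3 : ∀ y, y < 4 → σ₃.var y = σ₂.var y := fun y hy => by
    rw [hσ₃]
    exact run_var (by interval_cases y <;> simp [choose, NotAssigns]) _
  have a3 : ∀ b, b ≠ 3 → σ₃.arr b = σ₂.arr b := fun b hb => by
    rw [hσ₃]
    exact run_arr (by simp [choose, NotStores, hb]) _
  have v4 : ∀ y, y < 4 → σ₄.var y = σ₃.var y := fun y hy => by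
    rw [hσ₄]
    exact run_var (by interval_cases y <;> simp [fillPairs, NotAssigns]) _
  have a4 : ∀ b, b ≠ 5 → σ₄.arr b = σ₃.arr b := fun b hb => by
    rw [hσ₄]
    exact run_arr (by simp [fillPairs, NotStores, hb]) _
  have v5 : ∀ y, y < 4 → σ₅.var y = σ₄.var y := fun y hy => by
    rw [hσ₅]
    exact run_var (by interval_cases y <;> simp [auction, sweep, bid, NotAssigns]) _
  have a5 : ∀ b, b ≠ 6 → b ≠ 7 → σ₅.arr b = σ₄.arr b := fun b hb hb' => by
    rw [hσ₅]
    exact run_arr (by simp [auction, sweep, bid, NotStores, hb, hb']) _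
  have v6 : ∀ y, y < 4 → σ₆.var y = σ₅.var y := fun y hy => by
    rw [hσ₆]
    exact run_var (by interval_cases y <;> simp [markKept, NotAssigns]) _
  have a6 : ∀ b, b ≠ 8 → σ₆.arr b = σ₅.arr b := fun b hb => by
    rw [hσ₆]
    exact run_arr (by simp [markKept, NotStores, hb]) _
  have v7 : ∀ y, y < 4 → σ₇.var y = σ₆.var y := fun y hy => by
    rw [hσ₇]
    exact run_var (by interval_cases y <;> simp [copyGraph, NotAssigns]) _
  have a7 : ∀ b, b ≠ 9 → σ₇.arr b = σ₆.arr b := fun b hb => by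
    rw [hσ₇]
    exact run_arr (by simp [copyGraph, NotStores, hb]) _
  have v8 : ∀ y, y < 4 → σ₈.var y = σ₇.var y := fun y hy => by
    rw [hσ₈]
    exact run_var (by interval_cases y <;> simp [relabel, NotAssigns]) _
  have a8 : ∀ b, b ≠ 0 → σ₈.arr b = σ₇.arr b := fun b hb => by
    rw [hσ₈]
    exact run_arr (by simp [relabel, NotStores, hb]) _
  -- thresholds
  have hp₁ : Powers σ₁ r s (min k L) := by
    rw [← h1, ← h2, hσ₁]; exact run_powers (by omega)
  -- the list of cliques
  have e1_0 : σ₁.arr 0 = σ.arr 0 := a1 0 (by decide)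
  have e1_2 : σ₁.var 2 = L := (v1 2 (by decide)).trans h2
  obtain ⟨C, hR, hC⟩ := run_listCliques (σ := σ₁) (H := H) (n := n) (r := r)
    ((v1 0 (by decide)).trans h0) (fun u v => by rw [e1_0]; exact hadj u v)
    (fun i u => by rw [a1 2 (by decide)]; exact hz 2 i u (by decide)) (by omega) (by omega)
  rw [← hσ₂] at hR hC
  obtain ⟨m, hm⟩ : ∃ m, σ₂.var 3 = m := ⟨_, rfl⟩
  rw [hm] at hC
  have hmL : m < L := lt_of_le_of_lt (hC.le_pow fun A hA => ⟨hA.1, hA.2.2⟩) hL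
  have e2_2 : σ₂.var 2 = L := (v2 2 (by decide)).trans e1_2
  have hp₂ : Powers σ₂ r s (min k L) := by
    intro x hx
    rw [a2 4 (by decide)]
    exact hp₁ x (by omega)
  -- the chosen family
  obtain ⟨I, hIm, hI, hIa, hIdeg, hImax⟩ := run_choose (a := a) hR hp₂ (by omega) hm
    (by omega) (fun i => by
      rw [a2 3 (by decide), a1 3 (by decide)]; exact hz 3 i 0 (by decide))
  rw [← hσ₃] at hI
  have e3_2 : σ₃.var 2 = L := (v3 2 (by decide)).trans e2_2
  have e3_0 : σ₃.var 0 = n := by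
    rw [v3 0 (by decide), v2 0 (by decide), v1 0 (by decide), h0]
  have e3_3 : σ₃.var 3 = m := (v3 3 (by decide)).trans hm
  have e3_a0 : σ₃.arr 0 = σ.arr 0 := by rw [a3 0 (by decide), a2 0 (by decide), e1_0]
  have hR₃ : Rows σ₃ C := hR.congr (a3 2 (by decide)) (v3 2 (by decide))
  -- the bipartite graph
  have hbip₄ := run_fillPairs (r := r) hR₃ hI (by omega) (by omega) (fun o j => by
    rw [a3 5 (by decide), a2 5 (by decide), a1 5 (by decide)]; exact hz 5 o j (by decide))
  rw [← hσ₄, e3_0, e3_3, e3_a0] at hbip₄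
  simp only [hadj] at hbip₄
  have e4_2 : σ₄.var 2 = L := (v4 2 (by decide)).trans e3_2
  -- the auction
  obtain ⟨hval, hend⟩ := run_auction (σ := σ₄) (bip := fun o j => σ₄.arr 5 o j ≠ 0)
    (fun _ _ => Iff.rfl) e4_2 hmL
    (fun o j hb => by have := (hbip₄ o j).1 hb; exact ⟨by omega, this.2.2.1⟩)
    (fun j => by
      rw [a4 6 (by decide), a3 6 (by decide), a2 6 (by decide), a1 6 (by decide)]
      exact hz 6 j 0 (by decide))
    (fun j => by
      rw [a4 7 (by decide), a3 7 (by decide), a2 7 (by decide), a1 7 (by decide)]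
      exact hz 7 j 0 (by decide))
  rw [← hσ₅] at hval hend
  have e5_2 : σ₅.var 2 = L := (v5 2 (by decide)).trans e4_2
  have hR₅ : Rows σ₅ C := hR₃.congr (by rw [a5 2 (by decide) (by decide), a4 2 (by decide)])
    (e5_2.trans e3_2.symm)
  have hI₅ : Chosen σ₅ I := hI.congr (by rw [a5 3 (by decide) (by decide), a4 3 (by decide)])
    (e5_2.trans e3_2.symm)
  have hown : ∀ j o, σ₅.owner j = o + 1 → o < n ∧ j < m ∧ (C j).card = r - 1 ∧
      ∃ i ∈ I, C j ⊆ C i := by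
    intro j o hj
    have := (hbip₄ o j).1 (hval.bip_of_owner j o hj)
    exact ⟨this.1, this.2.2.1, this.2.2.2.1, this.2.2.2.2.1⟩
  -- the kept vertices
  let kept : Finset ℕ := (Finset.range n).filter fun v => ∃ j < L, σ₅.owner j = v + 1
  have hkept : ∀ o j, σ₅.owner j = o + 1 → o ∈ kept := by
    intro o j hj
    have := hown j o hj
    exact Finset.mem_filter.2 ⟨Finset.mem_range.2 this.1, j, by omega, hj⟩
  have hkept' : ∀ o ∈ kept, ∃ j, σ₅.owner j = o + 1 := by
    intro o ho
    obtain ⟨j, -, hj⟩ := (Finset.mem_filter.1 ho).2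
    exact ⟨j, hj⟩
  have hCi : ∀ i ∈ I, C i ⊆ Finset.range n ∧ H.IsClique (C i : Set ℕ) ∧ (C i).card ≤ r :=
    fun i hi => (hC.mem _).1 ⟨i, Finset.mem_range.1 (hIm hi), rfl⟩
  set W := I.biUnion C ∪ kept with hW
  have hWn : W ⊆ Finset.range n :=
    Finset.union_subset (Finset.biUnion_subset.2 fun i hi => (hCi i hi).1) (Finset.filter_subset _ _)
  have hWL : ∀ v ∈ W, v < L := fun v hv => (Finset.mem_range.1 (hWn hv)).trans_le hn
  have h8 : ∀ v, σ₆.arr 8 v 0 = if v ∈ W then 1 else 0 := hσ₆ ▸ run_markKept hR₅ hI₅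
    (fun v => by
      rw [a5 8 (by decide) (by decide), a4 8 (by decide), a3 8 (by decide), a2 8 (by decide),
        a1 8 (by decide)]
      exact hz 8 v 0 (by decide))
    (by rw [e5_2]; exact hWL)
    (fun v => by
      rw [hW, Finset.mem_union, Finset.mem_biUnion, e5_2, Finset.mem_filter]
      refine or_congr_right ⟨fun h => h.2, fun ⟨j, hj, h⟩ => ⟨?_, j, hj, h⟩⟩
      exact Finset.mem_range.2 (hown j v h).1)
  -- the output
  have e6_2 : σ₆.var 2 = L := (v6 2 (by decide)).trans e5_2
  have e7_2 : σ₇.var 2 = L := (v7 2 (by decide)).trans e6_2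
  have e6_a0 : σ₆.arr 0 = σ.arr 0 := by
    rw [a6 0 (by decide), a5 0 (by decide) (by decide), a4 0 (by decide), e3_a0]
  have h9 : ∀ u ∈ W, ∀ v ∈ W, σ₇.arr 9 u v = σ.arr 0 u v := by
    intro u hu v hv
    rw [hσ₇, copyGraph, run_fill σ₆ (σ.arr 0) (by decide) (by decide) (by decide),
      if_pos ⟨by rw [e6_2]; exact hWL u hu, by rw [e6_2]; exact hWL v hv⟩]
    intro τ ha _
    rw [eval_arr, ha 0 (by decide), e6_a0, eval_var, eval_var]
  have h8' : ∀ v, σ₇.arr 8 v 0 = if v ∈ W then 1 else 0 := fun v => by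
    rw [a7 8 (by decide)]; exact h8 v
  have hout := run_relabel h8' (by rw [e7_2]; exact hWL)
  rw [← hσ₈] at hout
  refine ⟨W, hWn, ?_, ?_, ?_, ?_, ?_⟩
  · refine card_kept_le hsr (fun i hi => (hCi i hi).2.2) ?_ hC.inj
      (fun j o hj => (hown j o hj).2) hkept'
    -- The empty clique is a listed row, and its degree is the size of the chosen family.
    obtain ⟨j, hj, hj0⟩ := (hC.mem ∅).2 ⟨by simp, by simp, by simp⟩
    have := hIdeg j hj
    simpa [hj0, threshold] using this
  · intro hkL hpack
    rw [min_eq_left hkL] at hIdeg hImax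
    exact hasPacking_kept hsr har hmL hC hIm hIa hIdeg hImax hbip₄ hval hend hkept hpack
  · rw [hrun, State.setVar_var, if_pos rfl]
    simp only [eval_sum, eval_arr, eval_var, eval_const, State.setVar_var, State.setVar_arr, if_true,
      a8 8 (by decide), h8', v8 2 (by decide), e7_2]
    rw [← Finset.sum_filter, ← Finset.card_eq_sum_ones]
    congr 1
    ext v
    simp only [Finset.mem_filter, Finset.mem_range]
    exact ⟨fun hv => hv.2, fun hv => ⟨hWL v hv, hv⟩⟩
  · rw [hrun, State.setVar_var, if_neg (by decide), v8 1 (by decide), v7 1 (by decide),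
      v6 1 (by decide), v5 1 (by decide), v4 1 (by decide), v3 1 (by decide), v2 1 (by decide),
      v1 1 (by decide), h1]
  · intro u hu v hv
    rw [hrun, State.setVar_arr, hout u hu v hv, h9 u hu v hv]

/-- When distinct cliques never share too many vertices: count the cliques, and output an instance
without vertices. -/
def countProg (a r : ℕ) : HProg :=
  .seq (listCliques r) (.seq
    (.assign 4 (.sum 5 (.ite (.and (.lt (.var 5) (.var 3)) (.le (.const a) (sizeE 5)))
      (.const 1) (.const 0))))
    (.seq (.assign 1 (.ite (.lt (.var 4) (.var 1)) (.const 1) (.const 0))) (.assign 0 (.const 0))))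

theorem run_countProg {σ : State} {H : SimpleGraph ℕ} {n a r k L : ℕ}
    (h0 : σ.var 0 = n) (h1 : σ.var 1 = k) (h2 : σ.var 2 = L) (hn : n ≤ L)
    (hL : (n + 1) ^ r < L) (hadj : ∀ u v, σ.arr 0 u v ≠ 0 ↔ H.Adj u v)
    (hz : ∀ b i j, b ≠ 0 → σ.arr b i j = 0) :
    ((countProg a r).run σ).var 0 = 0 ∧ ((countProg a r).run σ).var 1 =
      if (cliqueSets H a r (Finset.range n)).card < k then 1 else 0 := by
  obtain ⟨C, hR, hC⟩ := run_listCliques (σ := σ) (H := H) (n := n) (r := r) h0 hadj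
    (fun i u => hz 2 i u (by decide)) (by omega) (by omega)
  set σ₂ := (listCliques r).run σ with hσ₂
  have v2 : ∀ y, y < 3 → σ₂.var y = σ.var y := fun y hy => by
    rw [hσ₂]
    exact run_var (by interval_cases y <;> simp [listCliques, extendRows, appendRow, NotAssigns]) _
  have hmL : σ₂.var 3 < L := lt_of_le_of_lt (hC.le_pow fun A hA => ⟨hA.1, hA.2.2⟩) hL
  have hcount : (HExpr.sum 5 (.ite (.and (.lt (.var 5) (.var 3)) (.le (.const a) (sizeE 5)))
      (.const 1) (.const 0))).eval σ₂ = (cliqueSets H a r (Finset.range n)).card := by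
    have k1 : ∀ i, (sizeE 5).eval (σ₂.setVar 5 i) = (C i).card := fun i => by
      rw [eval_sizeE (hR.congr (τ := σ₂.setVar 5 i) rfl rfl) (by decide)]; simp
    simp only [eval_sum, eval_ite, holds_and, holds_lt, holds_le, eval_var, eval_const, k1,
      State.setVar_var, if_true, show (3 : ℕ) ≠ 5 by decide, if_false]
    rw [← Finset.sum_filter, ← Finset.card_eq_sum_ones]
    refine Finset.card_bij (fun i _ => C i) ?_ ?_ ?_
    · intro i hi
      obtain ⟨-, h3, h4⟩ := Finset.mem_filter.1 hi
      obtain ⟨h5, h6, h7⟩ := (hC.mem _).1 ⟨i, h3, rfl⟩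
      exact mem_cliqueSets.2 ⟨h5, h6, h4, h7⟩
    · intro i hi j hj hij
      exact hC.inj i (Finset.mem_filter.1 hi).2.1 j (Finset.mem_filter.1 hj).2.1 hij
    · intro A hA
      obtain ⟨h5, h6, h4, h7⟩ := mem_cliqueSets.1 hA
      obtain ⟨i, hi, rfl⟩ := (hC.mem A).2 ⟨h5, h6, h7⟩
      refine ⟨i, Finset.mem_filter.2 ⟨Finset.mem_range.2 ?_, hi, h4⟩, rfl⟩
      rw [v2 2 (by decide)]
      omega
  refine ⟨by simp [countProg], ?_⟩
  have hk : σ₂.var 1 = k := (v2 1 (by decide)).trans h1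
  simp only [countProg, run_seq, run_assign, ← hσ₂, hcount, eval_ite, holds_lt, eval_var, eval_const,
    State.setVar_var, hk]
  simp

/-! ### The complete programs -/

/-- Compute `(var 2) ^ r` in variable `4`. -/
def powProg : ℕ → HProg
  | 0 => .assign 4 (.const 1)
  | r + 1 => .seq (powProg r) (.assign 4 (.sum 5 (.var 4)))

theorem State.setVar_setVar (σ : State) (x u v : ℕ) : (σ.setVar x u).setVar x v = σ.setVar x v := by
  simp only [State.setVar, State.mk.injEq, and_true]
  funext y
  split_ifs <;> rfl

theorem run_powProg (r : ℕ) (σ : State) : (powProg r).run σ = σ.setVar 4 (σ.var 2 ^ r) := by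
  induction r with
  | zero => simp [powProg]
  | succ r ih =>
    rw [powProg, run_seq, ih, run_assign, State.setVar_setVar]
    simp [pow_succ, mul_comm]

theorem powProg_WF (r : ℕ) : (powProg r).WF := by
  induction r with
  | zero => simp [powProg, HProg.WF, HExpr.WF, tmpBase]
  | succ r ih => simp [powProg, HProg.WF, HExpr.WF, tmpBase, ih]

/-- Run `c` with loop bound `(n + 2) ^ r`. -/
def withBound (r : ℕ) (c : HProg) : Prog :=
  .seq (.assign 2 (.add (.var 0) (.const 2))) (.seq ((powProg r).compile tmpBase)
    (.seq (.assign 2 (.var 4)) (c.compile tmpBase)))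

theorem eval_mono_nat (p : Polynomial ℕ) {a b : ℕ} (h : a ≤ b) : p.eval a ≤ p.eval b := by
  rw [Polynomial.eval_eq_sum_range, Polynomial.eval_eq_sum_range]
  exact Finset.sum_le_sum fun i _ => Nat.mul_le_mul_left _ (Nat.pow_le_pow_left h i)

/-- The number (n+2)^r is computed by r nested multiplications under the provisional bound n + 2 and
then installed as loop bound. -/
theorem exec_withBound (r : ℕ) {c : HProg} (hc : c.WF) : ∃ p : Polynomial ℕ, ∀ (σ : State) (N : ℕ),
    σ.var 0 ≤ N → ∃ σ' T, Exec (withBound r c) σ σ' T ∧ T ≤ p.eval N ∧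
      Agree (c.run ((σ.setVar 4 ((σ.var 0 + 2) ^ r)).setVar 2 ((σ.var 0 + 2) ^ r))) σ' := by
  refine ⟨(powProg r).time.comp (Polynomial.X + 2) + c.time.comp ((Polynomial.X + 2) ^ r) + 10,
    fun σ N hN => ?_⟩
  let σ₁ := σ.setVar 2 (σ.var 0 + 2)
  obtain ⟨σ₂, T₂, x₂, g₂, -, t₂⟩ := HProg.compile_exec (powProg_WF r) tmpBase σ₁ σ₁ le_rfl
    ⟨rfl, fun _ _ => rfl⟩
  rw [run_powProg] at g₂
  have hagree : Agree ((σ.setVar 4 ((σ.var 0 + 2) ^ r)).setVar 2 ((σ.var 0 + 2) ^ r))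
      (σ₂.setVar 2 (σ₂.var 4)) := by
    refine ⟨g₂.1, fun x hx => ?_⟩
    have h4 := g₂.2 4 (by decide)
    have hx' := g₂.2 x hx
    simp only [State.setVar_var, σ₁, if_true] at h4 hx' ⊢
    rw [← h4, ← hx']
    split_ifs <;> rfl
  obtain ⟨σ₃, T₃, x₃, g₃, -, t₃⟩ := HProg.compile_exec hc tmpBase _ _ le_rfl hagree
  refine ⟨σ₃, _, Exec.seq (Exec.assign _ _ _) (Exec.seq x₂ (Exec.seq (Exec.assign _ _ _) x₃)), ?_,
    g₃⟩
  have hb₂ : T₂ ≤ (powProg r).time.eval (N + 2) :=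
    t₂.trans (eval_mono_nat _ (by simpa [σ₁] using hN))
  have hb₃ : T₃ ≤ c.time.eval ((N + 2) ^ r) :=
    t₃.trans (eval_mono_nat _ (by simpa using Nat.pow_le_pow_left (by omega) r))
  simp only [Polynomial.eval_add, Polynomial.eval_comp, Polynomial.eval_pow, Polynomial.eval_X,
    Polynomial.eval_ofNat, Expr.cost]
  omega

theorem inputState_adj {n : ℕ} (G : SimpleGraph (Fin n)) (k u v : ℕ) :
    (inputState G k).arr 0 u v = 1 ∧ (G.map Fin.valEmbedding).Adj u v ∨
      (inputState G k).arr 0 u v = 0 ∧ ¬ (G.map Fin.valEmbedding).Adj u v := by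
  have h : (G.map Fin.valEmbedding).Adj u v ↔
      ∃ (hi : u < n) (hj : v < n), G.Adj ⟨u, hi⟩ ⟨v, hj⟩ := by
    rw [SimpleGraph.map_adj]
    constructor
    · rintro ⟨x, y, hxy, rfl, rfl⟩
      exact ⟨x.2, y.2, hxy⟩
    · rintro ⟨hi, hj, hh⟩
      exact ⟨_, _, hh, rfl, rfl⟩
  rw [h]
  simp only [inputState]
  split_ifs with hh
  · exact Or.inl ⟨rfl, hh.2⟩
  · exact Or.inr ⟨rfl, fun h => hh ⟨rfl, h⟩⟩

theorem inputState_ne_zero {n : ℕ} (G : SimpleGraph (Fin n)) (k u v : ℕ) :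
    (inputState G k).arr 0 u v ≠ 0 ↔ (G.map Fin.valEmbedding).Adj u v := by
  rcases inputState_adj G k u v with ⟨h, h'⟩ | ⟨h, h'⟩
  · exact iff_of_true (by rw [h]; exact one_ne_zero) h'
  · exact iff_of_false (fun hn => hn h) h'

theorem kernelProg_WF (a r s : ℕ) : (kernelProg a r s).WF := by
  simp [kernelProg, powers, scaledE, listCliques, extendRows, appendRow, RAM.choose, thresholdE,
    fillPairs, pairE, auction, sweep, bid, canBidE, markKept, copyGraph, relabel, rankE, sizeE,
    subsetE, joinedE, degE, coveredE, insideE, HExpr.lt, HExpr.le, HExpr.eq, HExpr.and, HExpr.or,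
    HExpr.imp, HExpr.not, HExpr.ex, HExpr.all, HProg.WF, HExpr.WF, tmpBase]

theorem countProg_WF (a r : ℕ) : (countProg a r).WF := by
  simp [countProg, listCliques, extendRows, appendRow, sizeE, joinedE, HExpr.lt, HExpr.le,
    HExpr.and, HExpr.imp, HExpr.not, HExpr.ex, HExpr.all, HProg.WF, HExpr.WF, tmpBase]

end RAM

/-! ### The two cases of the kernel and the main theorem. -/

theorem hasPacking_iff_le_card {S : Finset (Finset ℕ)} {r s k : ℕ} (hrs : r ≤ s + 1)
    (hS : ∀ A ∈ S, A.card ≤ r) : HasPacking S s k ↔ k ≤ S.card := by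
  constructor
  · rintro ⟨P, hP, rfl, -⟩
    exact Finset.card_le_card hP
  · intro h
    obtain ⟨P, hP, hk⟩ := Finset.exists_subset_card_eq h
    refine ⟨P, hP, hk, fun A hA B hB hne => ?_⟩
    -- An intersection of at least s + 1 ≥ r elements exhausts both sets.
    by_contra! hlt
    have h1 := hS A (hP hA)
    have h2 := hS B (hP hB)
    have e1 : A ∩ B = A := Finset.eq_of_subset_of_card_le Finset.inter_subset_left (by omega)
    have e2 : A ∩ B = B := Finset.eq_of_subset_of_card_le Finset.inter_subset_right (by omega)
    exact hne (e1.symm.trans e2)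

/-- Identifies the rank computed by the program with the position in the increasing enumeration,
which defines the output graph. -/
theorem rank_orderEmbOfFin (W : Finset ℕ) (i : Fin W.card) :
    (W.filter (· < W.orderEmbOfFin rfl i)).card = i := by
  have : W.filter (· < W.orderEmbOfFin rfl i) =
      (Finset.Iio i).map (W.orderEmbOfFin rfl).toEmbedding := by
    ext x
    simp only [Finset.mem_filter, Finset.mem_map, Finset.mem_Iio]
    constructor
    · rintro ⟨hx, hlt⟩
      have : x ∈ Set.range (W.orderEmbOfFin rfl) := by
        rw [Finset.range_orderEmbOfFin]; exact hx
      obtain ⟨j, rfl⟩ := this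
      exact ⟨j, by simpa using hlt, rfl⟩
    · rintro ⟨j, hj, rfl⟩
      exact ⟨Finset.orderEmbOfFin_mem _ _ _, by simpa using hj⟩
  rw [this, Finset.card_map, Fin.card_Iio]

theorem hasKernel_of_count {r t s : ℕ} (hrs : r ≤ s + 1) (htr : t + 1 ≤ r)
    (ht : IsGreatest {s : ℕ | s * (s - 1) / 2 ≤ t} s) {B : ℕ → ℝ} (hB : ∀ k, 0 ≤ B k) :
    HasKernelWithVertices (cliqueEdgeOverlapProblem r t) B := by
  obtain ⟨p, hp⟩ := exec_withBound r (countProg_WF (t + 1) r)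
  refine ⟨withBound r (countProg (t + 1) r), p, fun n G k => ?_⟩
  obtain ⟨σ', T, hex, hT, hag⟩ := hp (inputState G k) (n + Nat.size k) (by simp [inputState])
  have hv0 : (inputState G k).var 0 = n := by simp [inputState]
  rw [hv0] at hag
  obtain ⟨o0, o1⟩ := run_countProg (a := t + 1) (r := r) (H := G.map Fin.valEmbedding) (n := n)
    (k := k) (L := (n + 2) ^ r)
    (σ := ((inputState G k).setVar 4 ((n + 2) ^ r)).setVar 2 ((n + 2) ^ r))
    (by simp [inputState]) (by simp [inputState]) (by simp)
    ((Nat.le_add_right n 2).trans (Nat.le_self_pow (by omega) _))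
    (Nat.pow_lt_pow_left (by omega) (by omega))
    (inputState_ne_zero G k)
    (fun b i j hb => by simp [inputState, hb])
  set S := cliqueSets (G.map Fin.valEmbedding) (t + 1) r (Finset.range n) with hS
  have hQ := cliqueEdgeOverlapProblem_iff (r := r) ht (H := G.map Fin.valEmbedding)
    (Fin.valEmbedding (n := n)) k
  rw [SimpleGraph.comap_map_eq, Fin.map_valEmbedding_univ, Nat.Iio_eq_range, ← hS,
    hasPacking_iff_le_card (S := S) hrs fun A hA => (mem_cliqueSets.1 hA).2.2.2] at hQ
  -- On the graph without vertices the parameter 0 gives a yes-instance and 1 a no-instance, since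
  -- every clique must have at least t + 1 ≥ 1 vertices.
  have hQ' := cliqueEdgeOverlapProblem_iff (r := r) ht (H := G.map Fin.valEmbedding)
    (Function.Embedding.ofIsEmpty (α := Fin 0)) (if S.card < k then 1 else 0)
  rw [hasPacking_iff_le_card hrs fun A hA => (mem_cliqueSets.1 hA).2.2.2] at hQ'
  have hempty : cliqueSets (G.map Fin.valEmbedding) (t + 1) r
      (Finset.univ.map (Function.Embedding.ofIsEmpty (α := Fin 0) (β := ℕ))) = ∅ := by
    rw [Finset.eq_empty_iff_forall_notMem]
    intro A hA
    obtain ⟨h1, -, h2, -⟩ := mem_cliqueSets.1 hA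
    have := Finset.card_le_card h1
    simp at this
    simp [this] at h2
  rw [hempty, Finset.card_empty] at hQ'
  refine ⟨0, _, if S.card < k then 1 else 0, σ', T, hex, hT, ⟨?_, ?_, fun i => i.elim0⟩,
    hQ.trans (Iff.trans ?_ hQ'.symm), ?_, ?_⟩
  · rw [← hag.2 0 (by decide)]; exact o0
  · rw [← hag.2 1 (by decide)]; exact o1
  · split_ifs <;> omega
  · split_ifs <;> omega
  · simpa using hB k

theorem hasKernel_of_lt {r t s : ℕ} (hsr : s + 2 ≤ r) (htr : t + 1 ≤ r)
    (ht : IsGreatest {s : ℕ | s * (s - 1) / 2 ≤ t} s) :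
    HasKernelWithVertices (cliqueEdgeOverlapProblem r t)
      (fun k => 2 * (r : ℝ) ^ r * (k : ℝ) ^ (r - s - 1)) := by
  obtain ⟨p, hp⟩ := exec_withBound r (kernelProg_WF (t + 1) r s)
  refine ⟨withBound r (kernelProg (t + 1) r s), p, fun n G k => ?_⟩
  obtain ⟨σ', T, hex, hT, hag⟩ := hp (inputState G k) (n + Nat.size k) (by simp [inputState])
  have hv0 : (inputState G k).var 0 = n := by simp [inputState]
  rw [hv0] at hag
  set L := (n + 2) ^ r with hL
  have hlt : (n + 1) ^ r < L := Nat.pow_lt_pow_left (by omega) (by omega)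
  set H := G.map Fin.valEmbedding with hH
  obtain ⟨W, hWn, hWc, hpack, o0, o1, oadj⟩ := run_kernelProg (a := t + 1) (r := r) (s := s)
    (H := H) (n := n) (k := k) (L := L) hsr htr
    (σ := ((inputState G k).setVar 4 L).setVar 2 L)
    (by simp [inputState]) (by simp [inputState]) (by simp)
    ((Nat.le_add_right n 2).trans (Nat.le_self_pow (by omega) _))
    hlt ((Nat.lt_two_pow_self).le.trans (Nat.pow_le_pow_left (by omega) r))
    (inputState_ne_zero G k)
    (fun b i j hb => by simp [inputState, hb])
  have hQ := cliqueEdgeOverlapProblem_iff (r := r) ht (H := H) (Fin.valEmbedding (n := n)) k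
  rw [hH, SimpleGraph.comap_map_eq, Fin.map_valEmbedding_univ, Nat.Iio_eq_range, ← hH] at hQ
  let f : Fin W.card ↪ ℕ := (W.orderEmbOfFin rfl).toEmbedding
  have hf : Finset.univ.map f = W := by
    apply Finset.coe_injective
    simp [f]
  have hQ' := cliqueEdgeOverlapProblem_iff (r := r) ht (H := H) f k
  rw [hf] at hQ'
  refine ⟨W.card, H.comap f, k, σ', T, hex, hT, ⟨?_, ?_, fun i j => ?_⟩,
    hQ.trans (Iff.trans ⟨fun h => ?_, fun h => ?_⟩ hQ'.symm), le_rfl, ?_⟩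
  · rw [← hag.2 0 (by decide)]; exact o0
  · rw [← hag.2 1 (by decide)]; exact o1
  · have := oadj (f i) (Finset.orderEmbOfFin_mem _ _ _) (f j) (Finset.orderEmbOfFin_mem _ _ _)
    simp only [f, RelEmbedding.coe_toEmbedding, rank_orderEmbOfFin, State.setVar_arr] at this
    rw [← hag.1, this]
    rcases inputState_adj G k (f i) (f j) with h | h
    · exact ⟨fun _ => h.1, fun hn => absurd h.2 hn⟩
    · exact ⟨fun hn => absurd hn h.2, fun _ => h.1⟩
  -- A larger k exceeds the number of subsets with at most r vertices, so the input has no packing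
  -- of that size.
  · by_cases hk : k ≤ L
    · exact hpack hk h
    · exfalso
      obtain ⟨P, hP, rfl, -⟩ := h
      have h1 : P.card ≤ (n + 1) ^ r := by
        refine (Finset.card_le_card fun A hA => ?_).trans (card_small_subsets_le n r)
        obtain ⟨h1, -, -, h2⟩ := mem_cliqueSets.1 (hP hA)
        exact Finset.mem_filter.2 ⟨Finset.mem_powerset.2 h1, h2⟩
      omega
  · obtain ⟨P, hP, hk, ho⟩ := h
    refine ⟨P, fun A hA => ?_, hk, ho⟩
    obtain ⟨h1, h2⟩ := mem_cliqueSets.1 (hP hA)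
    exact mem_cliqueSets.2 ⟨h1.trans hWn, h2⟩
  · have : W.card ≤ 2 * r ^ r * k ^ (r - s - 1) :=
      hWc.trans (Nat.mul_le_mul_left _ (Nat.pow_le_pow_left (min_le_left _ _) _))
    change (W.card : ℝ) ≤ 2 * (r : ℝ) ^ r * (k : ℝ) ^ (r - s - 1)
    exact_mod_cast this

theorem mainTheorem9 :
    (∀ r t t' : ℕ, t + 1 ≤ r → IsGreatest {s : ℕ | s * (s - 1) / 2 ≤ t} t' →
      ∀ (V : Type*) (G : SimpleGraph V) (k : ℕ) (K : Finset G.Subgraph),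
        IsEdgePacking (cliqueFamily (t + 1) r) k t K ↔
          IsVertexPacking (cliqueFamily (t + 1) r) k t' K) ∧
    ∃ C : ℝ, 0 < C ∧
      ∀ r t t' : ℕ, t + 1 ≤ r → IsGreatest {s : ℕ | s * (s - 1) / 2 ≤ t} t' →
        HasKernelWithVertices (cliqueEdgeOverlapProblem r t)
          (fun k => C * (r : ℝ) ^ r * (k : ℝ) ^ ((r : ℤ) - (t' : ℤ) - 1)) := by
  refine ⟨fun r t t' _ ht V G k K => isEdgePacking_iff_isVertexPacking ht G k K, 2, two_pos,
    fun r t t' htr ht => ?_⟩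
  -- In the first case the exponent may be zero or negative, but a kernel without vertices only
  -- needs the bound to be nonnegative.
  rcases le_or_gt r (t' + 1) with h | h
  · exact hasKernel_of_count h htr ht fun k => by positivity
  · have he : (r : ℤ) - (t' : ℤ) - 1 = ((r - t' - 1 : ℕ) : ℤ) := by omega
    simp only [he, zpow_natCast]
    exact hasKernel_of_lt (by omega) htr ht
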